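/- **Setting.** Fix $T\ge 1$, $2\le p<3$, $\alpha$ with $\alpha+\frac1p>1$, integers $d,\ell\ge 0$, and put $\gamma=\min\{\frac3p,\alpha+\frac1p\}>1$. Let $h:[0,T]\to\mathbb R$ be $\alpha$-Hölder and let $\mathbf X=(X,\mathbb X)$ be a Hölder weak geometric $p$-rough path over $\mathbb R^\ell$ on $[0,T]$: for $s\le u\le t$, $X_{ts}=X_{us}+X_{tu}$, $\mathbb X^{jk}_{ts}=\mathbb X^{jk}_{us}+\mathbb X^{jk}_{tu}+X^j_{us}X^k_{tu}$, $\mathbb X^{jk}_{ts}+\mathbb X^{kj}_{ts}=X^j_{ts}X^k_{ts}$, $|X_{ts}|\le C|t-s|^{1/p}$, $|\mathbb X_{ts}|\le C|t-s|^{2/p}$. A path-dependent vector field is a map $V$ from $\mathcal P=\bigcup_{0\le a\le T}C([0,a],\mathbb R^d)$ to $\mathbb R^d$; $C([0,0],\mathbb R^d)$ is identified with $\mathbb R^d$. Let $\bar y$ be the extension of $y_{[0,a]}$ to $[0,T]$ that is constant on $[a,T]$. $V$ is strongly Lipschitz if $|V(y_{[0,a]})-V(z_{[0,b]})|\le L\|\bar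 y-\bar z\|_\infty$ for all $a,b\in[0,T]$. For maps $G$ on $\mathcal P$, $\|G\|_{C^k}$ is the sum over $i\le k$ of the suprema over $\mathcal P$ of the norms of the $i$-th Fréchet derivatives of $G$ on the spaces $C([0,a],\mathbb R^d)$. A fine derivative of $G:\mathcal P\to B$ ($B$ a Banach space) is a map $(y_{[0,a]},z_{[0,a]})\mapsto G'(y_{[0,a]};z_{[0,a]})\in B$, linear in $z$ and jointly continuous for the metric $|b-a|+\|\bar y-\bar z\|_\infty$, with $G(y_{[0,a]})=G(y_{[0,0]})+\int_0^aG'(y_{[0,r]};\dot y_{[0,r]})\,dr$ for every $C^1$ path. Higher fine derivatives $G^{\{i\}}$, and fine derivatives of a Fréchet derivative $V^{(k)}$, are obtained by restricting the linear arguments already present to constant paths $\bar v_{[0,a]}$, $v\in\mathbb R^d$, and taking a fine derivative of the resulting map with values in the fixed space of multilinear maps on $\mathbb R^d$. With $|G|_{C^m}=\sum_{i\le m}\sup|G^{\{i\}}|$, set $$⦅V⦆=\sum_{k=0}^2\Big\{|V^{(k)}|_{C^{3-k}}+\big\|(V^{(k)})^{\{2-k\}}\big\|_{C^1}\Big\},$$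 the infimum being taken over the choices of fine derivatives. Say that $(V,V_1,\dots,V_\ell)$ is *regular* if all these fields are strongly Lipschitz, $\|V\|_{C^2}<\infty$ and $⦅V_i⦆<\infty$ for all $i$. Put $(VW)(y_{[0,a]})=\frac{d}{d\epsilon}\big|_{\epsilon=0}W\big(y_\bullet+\epsilon V(y_{[0,a]})\big)$ and $[V,W]=VW-WV$. Let $\mu_{ts}(x)=y_1$, where $y_0=x$ and, for $0\le u\le 1$, $$\dot y_u=(h_t-h_s)V(y_{[0,u]})+X^i_{ts}V_i(y_{[0,u]})+\tfrac12\mathbb X^{jk}_{ts}[V_j,V_k](y_{[0,u]}).$$ A flow on $\mathbb R^d$ is a family of maps with $\varphi_{tu}\circ\varphi_{us}=\varphi_{ts}$ for $0\le s\le u\le t\le T$. A flow solves $d\varphi=V\,h(dt)+\mathrm F\,\mathbf X(dt)$, $\mathrm F=(V_1,\dots,V_\ell)$, with exponent $\gamma'>1$ if there are $c,\delta>0$ with $\|\varphi_{ts}-\mu_{ts}\|_\infty\le c|t-s|^{\gamma'}$ whenever $0\le s\le t\le T$, $t-s\le\delta$. The solution flow is a flow that solves the equation with the exponent $\gamma$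 above and coincides with every flow solving it with some exponent $>1$. For ordinary vector fields on $\mathbb R^d$ the solution flow is defined in the same way, from the ordinary differential equation in $\mathbb R^d$ with the usual Lie brackets. **Statement (vanishing delay).** Let $(V^\lambda,V^\lambda_1,\dots,V^\lambda_\ell)$, for each $\lambda$, and $(V,V_1,\dots,V_\ell)$ be regular. Suppose that for every $\lambda$ and $i$ the fine and the usual derivative of $V_i^\lambda$ coincide on paths of length $0$: $(V_i^\lambda)'(x;w)=D_xV_i^\lambda(w)$ for $x,w\in\mathbb R^d$. Suppose $\|V^\lambda-V\|_{C^2}\to0$ and $⦅V_i^\lambda-V_i⦆\to0$ for each $i$, as $\lambda\to\infty$ (along an arbitrary filter on the index set), and that $V(y_{[0,u]})$ and the $V_i(y_{[0,u]})$ depend only on $y_u$, for all $0\le u\le T$. Then for each $\lambda$ the path-dependent equation $$d\varphi^\lambda=V^\lambda h(dt)+\mathrm F^\lambda\mathbf X(dt)$$ has a solution flow $\varphi^\lambda$, the classical (Markovian) equation $d\varphi=V\,h(dt)+\mathrm F\,\mathbf X(dt)$, with the vector fields on $\mathbb R^d$ obtained by restricting $V,V_i$ to paths of length $0$, has a solution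 flow $\varphi$, and $$\sup_{0\le s\le t\le T}\ \sup_{x\in\mathbb R^d}|\varphi^\lambda_{ts}(x)-\varphi_{ts}(x)|\longrightarrow0 .$$ -/

import Mathlib

open Set Filter Topology MeasureTheory
open scoped ENNReal

noncomputable section

namespace PathRDE

/-- The state space `ℝ^d` with its Euclidean norm. -/
abbrev E (d : ℕ) : Type := EuclideanSpace ℝ (Fin d)

/-- `C([0,a], ℝ^d)` with the supremum norm. -/
abbrev Pth (d : ℕ) (a : ℝ) : Type := C(Icc (0 : ℝ) a, E d)

/-- A path-dependent vector field `y_{[0,a]} ↦ V(y_{[0,a]}) ∈ ℝ^d`. Only the values with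
`0 ≤ a ≤ T` are ever used. -/
abbrev PField (d : ℕ) : Type := (a : ℝ) → Pth d a → E d

/-- The constant path on `[0,a]`. -/
abbrev cst {d : ℕ} (a : ℝ) (x : E d) : Pth d a := ContinuousMap.const _ x

/-- The constant path on `[0,a]`, as a continuous linear map of its value. -/
def cstL (d : ℕ) (a : ℝ) : E d →L[ℝ] Pth d a :=
  LinearMap.mkContinuous
    { toFun := fun x => cst a x
      map_add' := fun _ _ => rfl
      map_smul' := fun _ _ => rfl } 1
    (fun x => by
      rw [one_mul]
      exact (ContinuousMap.norm_le _ (norm_nonneg x)).2 (fun _ => le_rfl))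

/-- The path `y_{[0,r]}` cut out of a path `y`. -/
abbrev seg {d : ℕ} (y : C(ℝ, E d)) (r : ℝ) : Pth d r := y.restrict (Icc 0 r)

/-- The path on `[0,T]` that follows `y` on `[0,a]` and then stays at `y_a`. -/
def stopped {d : ℕ} (T : ℝ) {a : ℝ} (ha : 0 ≤ a) (y : Pth d a) : Pth d T :=
  y.comp ⟨fun t => projIcc 0 a ha t, continuous_projIcc.comp continuous_subtype_val⟩

/-- `|V(y_{[0,a]}) - V(z_{[0,b]})| ≤ L ‖ȳ - z̄‖_∞` for all `a, b ∈ [0,T]`. -/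
def StronglyLipschitz {d : ℕ} (T : ℝ) (V : PField d) : Prop :=
  ∃ L : ℝ, ∀ (a : ℝ) (ha : a ∈ Icc 0 T) (b : ℝ) (hb : b ∈ Icc 0 T) (y : Pth d a) (z : Pth d b),
    ‖V a y - V b z‖ ≤ L * ‖stopped T ha.1 y - stopped T hb.1 z‖

/-- Supremum of the norm over all paths `y_{[0,a]}`, `0 ≤ a ≤ T`. The target may depend on `a`. -/
def supNorm {d : ℕ} (T : ℝ) {H : ℝ → Type} [∀ a, NormedAddCommGroup (H a)]
    (F : (a : ℝ) → Pth d a → H a) : ℝ≥0∞ :=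
  ⨆ a ∈ Icc (0 : ℝ) T, ⨆ y : Pth d a, ‖F a y‖ₑ

/-- The norm `‖F‖_{C^k}`: sum of the sup norms of the Fréchet derivatives of order at most `k`;
it is `∞` if `F` is not `C^k` on some `C([0,a], ℝ^d)`. -/
def frechetNorm {d : ℕ} (T : ℝ) (k : ℕ) {H : ℝ → Type} [∀ a, NormedAddCommGroup (H a)]
    [∀ a, NormedSpace ℝ (H a)] (F : (a : ℝ) → Pth d a → H a) : ℝ≥0∞ :=
  ⨅ _ : ∀ a ∈ Icc (0 : ℝ) T, ContDiff ℝ k (F a),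
    ∑ i ∈ Finset.range (k + 1), supNorm T (fun a y => iteratedFDeriv ℝ i (F a) y)

/-- `F'` is a fine derivative of `F`: `(y_{[0,a]}, z_{[0,a]}) ↦ F'(y_{[0,a]}; z_{[0,a]})` is
linear in `z` and continuous for the metric `|b - a| + ‖ȳ - z̄‖_∞` on paths, and
`F(y_{[0,a]}) = F(y_{[0,0]}) + ∫_0^a F'(y_{[0,r]}; ẏ_{[0,r]}) dr` for every `C^1` path. -/
structure IsFineDeriv {d : ℕ} (T : ℝ) {G : Type} [NormedAddCommGroup G] [NormedSpace ℝ G]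
    (F : (a : ℝ) → Pth d a → G) (F' : (a : ℝ) → Pth d a → Pth d a →L[ℝ] G) : Prop where
  cont : ∀ (a : ℝ) (ha : a ∈ Icc 0 T) (y z : Pth d a), ∀ ε > 0, ∃ δ > 0,
    ∀ (b : ℝ) (hb : b ∈ Icc 0 T) (y₁ z₁ : Pth d b),
      |b - a| + ‖stopped T ha.1 y - stopped T hb.1 y₁‖ < δ →
      ‖stopped T ha.1 z - stopped T hb.1 z₁‖ < δ →
      ‖F' a y z - F' b y₁ z₁‖ < ε
  ftc : ∀ a ∈ Icc (0 : ℝ) T, ∀ y z : C(ℝ, E d),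
    (∀ t ∈ Icc 0 a, HasDerivWithinAt y (z t) (Icc 0 a) t) →
    F a (seg y a) = F 0 (seg y 0) + ∫ r in (0 : ℝ)..a, F' r (seg y r) (seg z r)

/-- Restriction of a fine derivative to constant directions `v̄_{[0,a]}`, `v ∈ ℝ^d`; its values
lie in the fixed space `L(ℝ^d, G)`. -/
def alongConst {d : ℕ} {G : Type} [NormedAddCommGroup G] [NormedSpace ℝ G]
    (F' : (a : ℝ) → Pth d a → Pth d a →L[ℝ] G) : (a : ℝ) → Pth d a → E d →L[ℝ] G :=
  fun a y => (F' a y).comp (cstL d a)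

/-- For a map `F`, with restriction `Fc` to constant directions,
`fineTail m F Fc = |F^{1}| + ⋯ + |F^{m+1}| + ‖F^{m}‖_{C^1}`, the infimum being over the
choices of the successive fine derivatives. -/
def fineTail {d : ℕ} (T : ℝ) : (m : ℕ) → {H : ℝ → Type} → [∀ a, NormedAddCommGroup (H a)] →
    [∀ a, NormedSpace ℝ (H a)] → {G : Type} → [NormedAddCommGroup G] → [NormedSpace ℝ G] →
    (F : (a : ℝ) → Pth d a → H a) → (Fc : (a : ℝ) → Pth d a → G) → ℝ≥0∞
  | 0, _, _, _, _, _, _, F, Fc =>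
      frechetNorm T 1 F + ⨅ (F' : _) (_ : IsFineDeriv T Fc F'), supNorm T F'
  | m + 1, _, _, _, _, _, _, _, Fc =>
      ⨅ (F' : _) (_ : IsFineDeriv T Fc F'), (supNorm T F' + fineTail T m F' (alongConst F'))

/-- The `k`-th Fréchet derivative `V^{(k)}`. -/
abbrev frechet {d : ℕ} (V : PField d) (k : ℕ) (a : ℝ) (y : Pth d a) :
    ContinuousMultilinearMap ℝ (fun _ : Fin k => Pth d a) (E d) :=
  iteratedFDeriv ℝ k (V a) y

/-- `V^{(k)}` restricted to constant directions. -/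
def frechetConst {d : ℕ} (V : PField d) (k : ℕ) (a : ℝ) (y : Pth d a) :
    ContinuousMultilinearMap ℝ (fun _ : Fin k => E d) (E d) :=
  (frechet V k a y).compContinuousLinearMap (fun _ => cstL d a)

/-- The norm `⦅V⦆ = ∑_{k=0}^2 ( |V^{(k)}|_{C^{3-k}} + ‖(V^{(k)})^{2-k}‖_{C^1} )`, where `|·|_{C^j}`
is the fine `C^j` norm and `‖·‖_{C^1}` the Fréchet `C^1` norm. -/
def mixedNorm {d : ℕ} (T : ℝ) (V : PField d) : ℝ≥0∞ :=
  ⨅ _ : ∀ a ∈ Icc (0 : ℝ) T, ContDiff ℝ 2 (V a),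
    ∑ k ∈ Finset.range 3,
      (supNorm T (frechet V k) + fineTail T (2 - k) (frechet V k) (frechetConst V k))

/-- The regularity assumptions on the drift field `V` and the fields `V_1, …, V_ℓ`. -/
structure Regular {d ℓ : ℕ} (T : ℝ) (V : PField d) (F : Fin ℓ → PField d) : Prop where
  drift_lip : StronglyLipschitz T V
  drift_norm : frechetNorm T 2 V < ∞
  field_lip : ∀ i, StronglyLipschitz T (F i)
  field_norm : ∀ i, mixedNorm T (F i) < ∞

/-- At paths of length `0`, identified with points of `ℝ^d`, fine and usual derivatives
coincide: `V'(x; w) = D_x V (w)`. -/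
def FineAgreesAtZero {d : ℕ} (T : ℝ) (V : PField d) : Prop :=
  ∀ V' : (a : ℝ) → Pth d a → Pth d a →L[ℝ] E d, IsFineDeriv T V V' →
    ∀ x w : E d, V' 0 (cst 0 x) (cst 0 w) = fderiv ℝ (V 0) (cst 0 x) (cst 0 w)

/-- `V(y_{[0,u]})` depends only on `y_u`, for all `0 ≤ u ≤ T`. -/
def DependsOnlyOnEndpoint {d : ℕ} (T : ℝ) (V : PField d) : Prop :=
  ∀ (u : ℝ) (hu : u ∈ Icc 0 T) (y z : Pth d u),
    y ⟨u, hu.1, le_rfl⟩ = z ⟨u, hu.1, le_rfl⟩ → V u y = V u z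

/-- The vector field on `ℝ^d` given by the restriction of `V` to paths of length `0`. -/
def classicalField {d : ℕ} (V : PField d) : E d → E d := fun x => V 0 (cst 0 x)

/-- `(VW)(y_{[0,a]}) = d/dε|_{ε=0} W(y_• + ε V(y_{[0,a]}))`. -/
def along {d : ℕ} (V W : PField d) : PField d :=
  fun a y => deriv (fun ε : ℝ => W a (y + ε • cst a (V a y))) 0

/-- `[V,W] = VW - WV`. -/
def bracket {d : ℕ} (V W : PField d) : PField d := fun a y => along V W a y - along W V a y

/-- Hölder weak geometric `p`-rough paths over `ℝ^ℓ` on `[0,T]`, for `2 ≤ p < 3`.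
The increments are written `X_{ts}` and `𝕏_{ts}`, for `s ≤ t`. -/
structure RoughPath (ℓ : ℕ) (p T : ℝ) where
  X : ℝ → ℝ → Fin ℓ → ℝ
  XX : ℝ → ℝ → Fin ℓ → Fin ℓ → ℝ
  chen₁ : ∀ s u t, 0 ≤ s → s ≤ u → u ≤ t → t ≤ T → ∀ i, X t s i = X u s i + X t u i
  chen₂ : ∀ s u t, 0 ≤ s → s ≤ u → u ≤ t → t ≤ T → ∀ j k,
    XX t s j k = XX u s j k + XX t u j k + X u s j * X t u k
  weakGeometric : ∀ s t, 0 ≤ s → s ≤ t → t ≤ T → ∀ j k,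
    XX t s j k + XX t s k j = X t s j * X t s k
  holder : ∃ C : ℝ, ∀ s t, 0 ≤ s → s ≤ t → t ≤ T →
    (∀ i, |X t s i| ≤ C * (t - s) ^ (1 / p)) ∧ ∀ j k, |XX t s j k| ≤ C * (t - s) ^ (2 / p)

/-- The right-hand side
`(h_t - h_s) V + X^i_{ts} V_i + ½ 𝕏^{jk}_{ts} [V_j, V_k]` of the path-dependent equation. -/
def drivenField {d ℓ : ℕ} {p T : ℝ} (h : ℝ → ℝ) (XR : RoughPath ℓ p T) (V : PField d)
    (F : Fin ℓ → PField d) (s t : ℝ) : PField d := fun a y =>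
  (h t - h s) • V a y + ∑ i, XR.X t s i • F i a y
    + (1 / 2 : ℝ) • ∑ j, ∑ k, XR.XX t s j k • bracket (F j) (F k) a y

/-- The same right-hand side for vector fields on `ℝ^d`, with their usual Lie bracket. -/
def drivenClassical {d ℓ : ℕ} {p T : ℝ} (h : ℝ → ℝ) (XR : RoughPath ℓ p T) (v : E d → E d)
    (f : Fin ℓ → E d → E d) (s t : ℝ) : E d → E d := fun x =>
  (h t - h s) • v x + ∑ i, XR.X t s i • f i x
    + (1 / 2 : ℝ) • ∑ j, ∑ k, XR.XX t s j k • VectorField.lieBracket ℝ (f j) (f k) x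

/-- `x'` is the value at time `1` of a solution of `ẏ_u = W(y_{[0,u]})`, `0 ≤ u ≤ 1`, `y_0 = x`. -/
def TimeOne {d : ℕ} (W : PField d) (x x' : E d) : Prop :=
  ∃ y : C(ℝ, E d), y 0 = x ∧ y 1 = x' ∧
    ∀ u ∈ Icc (0 : ℝ) 1, HasDerivWithinAt y (W u (seg y u)) (Icc 0 1) u

/-- `x'` is the value at time `1` of a solution of `ẏ_u = w(y_u)`, `0 ≤ u ≤ 1`, `y_0 = x`. -/
def TimeOneClassical {d : ℕ} (w : E d → E d) (x x' : E d) : Prop :=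
  ∃ y : C(ℝ, E d), y 0 = x ∧ y 1 = x' ∧
    ∀ u ∈ Icc (0 : ℝ) 1, HasDerivWithinAt y (w (y u)) (Icc 0 1) u

/-- Flows on `ℝ^d`, written `φ t s = φ_{ts}` for `0 ≤ s ≤ t ≤ T`. -/
def IsFlow {d : ℕ} (T : ℝ) (φ : ℝ → ℝ → E d → E d) : Prop :=
  ∀ s u t, 0 ≤ s → s ≤ u → u ≤ t → t ≤ T → ∀ x, φ t u (φ u s x) = φ t s x

/-- `φ` is a flow, and for some `c, δ > 0` one has `‖φ_{ts} - μ_{ts}‖_∞ ≤ c |t-s|^γ` whenever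
`t - s ≤ δ`; the maps `μ_{ts}` are given by the relation `μ s t x x'`, i.e. `x' = μ_{ts}(x)`. -/
def FlowCloseTo {d : ℕ} (T γ : ℝ) (μ : ℝ → ℝ → E d → E d → Prop)
    (φ : ℝ → ℝ → E d → E d) : Prop :=
  IsFlow T φ ∧ ∃ c > 0, ∃ δ > 0, ∀ s t, 0 ≤ s → s ≤ t → t ≤ T → t - s ≤ δ →
    ∀ x, ∃ x', μ s t x x' ∧ ‖φ t s x - x'‖ ≤ c * (t - s) ^ γ

/-- `φ` is the solution flow: it solves the equation with the exponent `γ`, and every flow that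
solves it, with whatever exponent larger than `1`, coincides with `φ`. -/
def IsTheFlowCloseTo {d : ℕ} (T γ : ℝ) (μ : ℝ → ℝ → E d → E d → Prop)
    (φ : ℝ → ℝ → E d → E d) : Prop :=
  FlowCloseTo T γ μ φ ∧ ∀ γ' > 1, ∀ ψ, FlowCloseTo T γ' μ ψ →
    ∀ s t, 0 ≤ s → s ≤ t → t ≤ T → ψ t s = φ t s

/-- `φ` is the solution flow of the path-dependent rough differential equation
`dφ = V h(dt) + F XR(dt)`. -/
def IsTheSolutionFlow {d ℓ : ℕ} {p T : ℝ} (γ : ℝ) (h : ℝ → ℝ) (XR : RoughPath ℓ p T)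
    (V : PField d) (F : Fin ℓ → PField d) (φ : ℝ → ℝ → E d → E d) : Prop :=
  IsTheFlowCloseTo T γ (fun s t => TimeOne (drivenField h XR V F s t)) φ

/-- `φ` is the solution flow of the classical rough differential equation
`dφ = v h(dt) + f XR(dt)`, for vector fields `v, f_1, …, f_ℓ` on `ℝ^d`. -/
def IsTheClassicalSolutionFlow {d ℓ : ℕ} {p T : ℝ} (γ : ℝ) (h : ℝ → ℝ) (XR : RoughPath ℓ p T)
    (v : E d → E d) (f : Fin ℓ → E d → E d) (φ : ℝ → ℝ → E d → E d) : Prop :=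
  IsTheFlowCloseTo T γ (fun s t => TimeOneClassical (drivenClassical h XR v f s t)) φ

end PathRDE

end

/-! Every flow is compared with one object on `ℝ^d` that does not see the past: the second order
Euler scheme `x ↦ x + (h_t - h_s) v(x) + X^i f_i(x) + 𝕏^{jk} Df_k(x) f_j(x)`, where `v, f_i` are the
restrictions of the fields to paths of length `0`.

By Chen's relations and Taylor's formula the scheme is a flow up to an error of order `|t-s|^γ`,
also in Lipschitz norm. Sewing turns it into a Lipschitz flow at distance at most `C|t-s|^γ` from it
(`AlmostFlow.exists_flow`, `exists_flow_euler`), where `C` and the admissible length of intervals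
depend only on bounds for the fields and drivers.

The time one maps `μ_{ts}` are close to the same scheme (`exists_timeOne_close`). Along a solution,
`V_i` varies at first order by its fine derivative in the direction of the velocity, which is `X^j
V_j` to leading order. At length `0` the fine and usual derivatives agree, so this gives `½ X^j X^k
Df_k f_j`; together with `½ 𝕏^{jk}[f_j, f_k]` it is `𝕏^{jk} Df_k f_j`, because `𝕏` is weakly
geometric. So the sewn flow solves the equation. Telescoping over `n` pieces costs `n · n^{-γ'} → 0`
with some `γ' > 1`, hence uniqueness (`isTheFlowCloseTo_of_euler`).

The solution flow is thus determined by the restrictions `v, f_i`, and these converge with their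
derivatives. Telescoping over `n` pieces bounds the distance of two flows by `O(n^{1-γ}) + n O(ε)`,
with `ε` the distance of the fields (`norm_flow_sub_le`): fix `n` first, then let `ε → 0`. For the
limit fields, dependence on the endpoint alone turns the path-dependent equation into the classical
one and forces the two derivatives to agree at length `0`. -/

namespace PathRDE

/-! ### Almost flows and their compositions along finite sets of times -/

section Sewing

variable {X Y : Type*} [NormedAddCommGroup X] [NormedAddCommGroup Y]

/-- `D` is bounded by `c` and Lipschitz with constant `c`. -/
structure BoundedLip (c : ℝ) (D : X → Y) : Prop where
  bound : ∀ x, ‖D x‖ ≤ c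
  lip : ∀ x y, ‖D x - D y‖ ≤ c * ‖x - y‖

/-- Bound on the second differences of `N`. -/
def SecondDiff (c : ℝ) (N : X → Y) : Prop :=
  ∀ x y w, ‖N (x + w) - N x - (N (y + w) - N y)‖ ≤ c * ‖x - y‖ * ‖w‖

/-- A family of maps close to the identity that is a flow up to an error of order `|t-s|^γ` on
intervals of length at most `δ`. -/
structure AlmostFlow (T δ κ c γ : ℝ) (E : ℝ → ℝ → X → X) : Prop where
  refl : ∀ s, 0 ≤ s → s ≤ T → ∀ x, E s s x = x
  lip : ∀ s t, 0 ≤ s → s ≤ t → t ≤ T → t - s ≤ δ →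
    ∀ x y, ‖(E t s x - E t s y) - (x - y)‖ ≤ κ * ‖x - y‖
  second : ∀ s t, 0 ≤ s → s ≤ t → t ≤ T → t - s ≤ δ → SecondDiff κ (E t s)
  defect : ∀ s u t, 0 ≤ s → s ≤ u → u ≤ t → t ≤ T → t - s ≤ δ →
    BoundedLip (c * (t - s) ^ γ) (fun x => E t u (E u s x) - E t s x)

/-- Composition of the maps `E` along a list of intermediate times. -/
def composeList {X : Type*} (E : ℝ → ℝ → X → X) : ℝ → List ℝ → ℝ → X → X
  | s, [], t => E t s
  | s, u :: L, t => fun x => composeList E u L t (E u s x)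

/-- Composition of the maps `E` along the points of `P` between `s` and `t`. -/
noncomputable def composeAlong {X : Type*} (E : ℝ → ℝ → X → X) (P : Finset ℝ) (t s : ℝ) : X → X :=
  composeList E s ((P.filter (fun u => s < u ∧ u < t)).sort (· ≤ ·)) t

theorem composeList_append {X : Type*} (E : ℝ → ℝ → X → X) (L L' : List ℝ) (s u t : ℝ) (x : X) :
    composeList E s (L ++ u :: L') t x = composeList E u L' t (composeList E s L u x) := by
  induction L generalizing s x with
  | nil => rfl
  | cons a L ih => exact ih a (E a s x)

theorem sort_filter_split (P : Finset ℝ) {s u t : ℝ} (hu : u ∈ P) (hsu : s < u) (hut : u < t) :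
    (P.filter (fun r => s < r ∧ r < t)).sort (· ≤ ·) =
      (P.filter (fun r => s < r ∧ r < u)).sort (· ≤ ·) ++
        u :: (P.filter (fun r => u < r ∧ r < t)).sort (· ≤ ·) := by
  set A := P.filter (fun r => s < r ∧ r < u) with hA
  set B := P.filter (fun r => u < r ∧ r < t) with hB
  have hAm : ∀ r ∈ A.sort (· ≤ ·), r < u := fun r hr =>
    (Finset.mem_filter.1 ((Finset.mem_sort _).1 hr)).2.2
  have hBm : ∀ r ∈ B.sort (· ≤ ·), u < r := fun r hr =>
    (Finset.mem_filter.1 ((Finset.mem_sort _).1 hr)).2.1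
  have hlist : P.filter (fun r => s < r ∧ r < t) =
      (A.sort (· ≤ ·) ++ u :: B.sort (· ≤ ·)).toFinset := by
    ext r
    simp only [List.toFinset_append, List.toFinset_cons, Finset.mem_union, Finset.mem_insert,
      List.mem_toFinset, Finset.mem_sort, hA, hB, Finset.mem_filter]
    constructor
    · rintro ⟨h1, h2, h3⟩
      rcases lt_trichotomy r u with h | h | h
      · exact Or.inl ⟨h1, h2, h⟩
      · exact Or.inr (Or.inl h)
      · exact Or.inr (Or.inr ⟨h1, h, h3⟩)
    · rintro (⟨h1, h2, h3⟩ | rfl | ⟨h1, h2, h3⟩)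
      · exact ⟨h1, h2, h3.trans hut⟩
      · exact ⟨hu, hsu, hut⟩
      · exact ⟨h1, hsu.trans h2, h3⟩
  have hnd : (A.sort (· ≤ ·) ++ u :: B.sort (· ≤ ·)).Nodup := by
    refine List.nodup_append.2 ⟨Finset.sort_nodup _ _, List.nodup_cons.2
      ⟨fun h => (hBm u h).false, Finset.sort_nodup _ _⟩, fun a ha b hb => ?_⟩
    rcases List.mem_cons.1 hb with rfl | hb
    · exact (hAm a ha).ne
    · exact ((hAm a ha).trans (hBm b hb)).ne
  rw [hlist]
  refine (List.toFinset_sort (· ≤ ·) hnd).2 ?_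
  refine List.pairwise_append.2 ⟨Finset.pairwise_sort _ _, List.pairwise_cons.2
    ⟨fun b hb => (hBm b hb).le, Finset.pairwise_sort _ _⟩, fun a ha b hb => ?_⟩
  rcases List.mem_cons.1 hb with rfl | hb
  · exact (hAm a ha).le
  · exact ((hAm a ha).trans (hBm b hb)).le

theorem composeAlong_of_filter_eq_empty {X : Type*} (E : ℝ → ℝ → X → X) (P : Finset ℝ) {s t : ℝ}
    (h : P.filter (fun u => s < u ∧ u < t) = ∅) : composeAlong E P t s = E t s := by
  simp [composeAlong, h, composeList]

theorem composeAlong_self {X : Type*} (E : ℝ → ℝ → X → X) (P : Finset ℝ) (s : ℝ) :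
    composeAlong E P s s = E s s :=
  composeAlong_of_filter_eq_empty E P
    (Finset.filter_eq_empty_iff.2 fun _ _ h => (h.1.trans h.2).false)

/-- Splitting the sorted list of times at `u` makes the composition an exact flow at the times of
`P`, so a limit over growing `P` is a flow at all times. When `u` is an endpoint, `E s s = id` is
used instead. -/
theorem composeAlong_comp {T δ κ c γ : ℝ} {E : ℝ → ℝ → X → X} (hE : AlmostFlow T δ κ c γ E)
    (P : Finset ℝ) {s u t : ℝ} (hs : 0 ≤ s) (hsu : s ≤ u) (hut : u ≤ t) (ht : t ≤ T)
    (hu : u ∈ P ∨ u = s ∨ u = t) (x : X) :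
    composeAlong E P t u (composeAlong E P u s x) = composeAlong E P t s x := by
  rcases hsu.eq_or_lt with rfl | hsu'
  · rw [composeAlong_self, hE.refl s hs (hut.trans ht)]
  rcases hut.eq_or_lt with rfl | hut'
  · rw [composeAlong_self, hE.refl u (hs.trans hsu) ht]
  have hu : u ∈ P := by
    rcases hu with h | h | h
    · exact h
    · exact absurd h hsu'.ne'
    · exact absurd h hut'.ne
  simp only [composeAlong]
  rw [sort_filter_split P hu hsu' hut', composeList_append]

theorem AlmostFlow.lipschitz {T δ κ c γ : ℝ} {E : ℝ → ℝ → X → X} (hE : AlmostFlow T δ κ c γ E)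
    {s t : ℝ} (hs : 0 ≤ s) (hst : s ≤ t) (ht : t ≤ T) (hδ : t - s ≤ δ) (x y : X) :
    ‖E t s x - E t s y‖ ≤ (1 + κ) * ‖x - y‖ := by
  have h1 := hE.lip s t hs hst ht hδ x y
  have h2 : ‖E t s x - E t s y‖ ≤ ‖(E t s x - E t s y) - (x - y)‖ + ‖x - y‖ := by
    simpa using norm_add_le ((E t s x - E t s y) - (x - y)) (x - y)
  linarith

/-- Composition of two perturbed maps. -/
theorem AlmostFlow.comp_bound {T δ κ c γ : ℝ} {E : ℝ → ℝ → X → X} (hE : AlmostFlow T δ κ c γ E)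
    (hκ0 : 0 ≤ κ) (hκ : κ ≤ 1) {s u t : ℝ} (hs : 0 ≤ s) (hsu : s ≤ u) (hut : u ≤ t)
    (ht : t ≤ T) (hδ : t - s ≤ δ) {Ψ₁ Ψ₂ : X → X} {A₁ A₂ : ℝ} (hA₁ : A₁ ≤ κ)
    (h₁0 : 0 ≤ A₁) (h₂0 : 0 ≤ A₂)
    (h₁ : BoundedLip A₁ (fun x => Ψ₁ x - E u s x)) (h₂ : BoundedLip A₂ (fun x => Ψ₂ x - E t u x)) :
    BoundedLip ((1 + 3 * κ) * (A₁ + A₂) + c * (t - s) ^ γ)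
      (fun x => Ψ₂ (Ψ₁ x) - E t s x) := by
  have hD := hE.defect s u t hs hsu hut ht hδ
  have hu0 : 0 ≤ u := hs.trans hsu
  have huT : u ≤ T := hut.trans ht
  have hδ1 : u - s ≤ δ := by linarith
  have hδ2 : t - u ≤ δ := by linarith
  constructor
  · intro x
    have e : Ψ₂ (Ψ₁ x) - E t s x = (Ψ₂ (Ψ₁ x) - E t u (Ψ₁ x))
        + (E t u (Ψ₁ x) - E t u (E u s x)) + (E t u (E u s x) - E t s x) := by abel
    have b1 := h₂.bound (Ψ₁ x)
    have b2 := hE.lipschitz hu0 hut ht hδ2 (Ψ₁ x) (E u s x)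
    have b3 := hD.bound x
    have b4 := h₁.bound x
    have b5 : (1 + κ) * ‖Ψ₁ x - E u s x‖ ≤ (1 + κ) * A₁ := by gcongr
    rw [e]
    refine (norm_add₃_le).trans ?_
    nlinarith [mul_nonneg hκ0 h₁0, mul_nonneg hκ0 h₂0]
  · intro x y
    -- The increment `Ψ₁ x - E u s x` is first carried over to the base point `E u s y`, which costs
    -- a second difference of `E t u`; only then is it replaced by the increment at `y`. This is why
    -- almost flows include a bound on second differences.
    have e : (Ψ₂ (Ψ₁ x) - E t s x) - (Ψ₂ (Ψ₁ y) - E t s y) =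
        ((Ψ₂ (Ψ₁ x) - E t u (Ψ₁ x)) - (Ψ₂ (Ψ₁ y) - E t u (Ψ₁ y)))
        + ((E t u (E u s x + (Ψ₁ x - E u s x)) - E t u (E u s x))
            - (E t u (E u s y + (Ψ₁ x - E u s x)) - E t u (E u s y)))
        + (E t u (E u s y + (Ψ₁ x - E u s x)) - E t u (Ψ₁ y))
        + ((E t u (E u s x) - E t s x) - (E t u (E u s y) - E t s y)) := by
      rw [add_sub_cancel]; abel
    have b1 := h₂.lip (Ψ₁ x) (Ψ₁ y)
    have b2 := hE.second u t hu0 hut ht hδ2 (E u s x) (E u s y) (Ψ₁ x - E u s x)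
    have b3 := hE.lipschitz hu0 hut ht hδ2 (E u s y + (Ψ₁ x - E u s x)) (Ψ₁ y)
    have b4 := hD.lip x y
    have b5 := h₁.lip x y
    have b6 := h₁.bound x
    have b7 := hE.lipschitz hs hsu huT hδ1 x y
    have e2 : E u s y + (Ψ₁ x - E u s x) - Ψ₁ y = (Ψ₁ x - E u s x) - (Ψ₁ y - E u s y) := by abel
    rw [e2] at b3
    set r := ‖x - y‖ with hr
    have hr0 : 0 ≤ r := norm_nonneg _
    -- Here `A₁ ≤ κ` enters: the Lipschitz constant is at most `A₁ + (1 + κ)`.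
    have b8 : ‖Ψ₁ x - Ψ₁ y‖ ≤ (1 + 2 * κ) * r := by
      have : Ψ₁ x - Ψ₁ y = ((Ψ₁ x - E u s x) - (Ψ₁ y - E u s y)) + (E u s x - E u s y) := by abel
      rw [this]
      refine (norm_add_le _ _).trans ?_
      nlinarith
    have c1 : A₂ * ‖Ψ₁ x - Ψ₁ y‖ ≤ A₂ * ((1 + 2 * κ) * r) := by gcongr
    have c2 : κ * ‖E u s x - E u s y‖ * ‖Ψ₁ x - E u s x‖ ≤ κ * ((1 + κ) * r) * A₁ := by gcongr
    have c3 : (1 + κ) * ‖(Ψ₁ x - E u s x) - (Ψ₁ y - E u s y)‖ ≤ (1 + κ) * (A₁ * r) := by gcongr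
    rw [e]
    refine ((norm_add_le _ _).trans (add_le_add_left (norm_add₃_le) _)).trans ?_
    have d1 : 0 ≤ A₁ * r := mul_nonneg h₁0 hr0
    have d2 : 0 ≤ κ * (A₂ * r) := mul_nonneg hκ0 (mul_nonneg h₂0 hr0)
    have d3 : 0 ≤ (1 - κ) * (κ * (A₁ * r)) :=
      mul_nonneg (by linarith) (mul_nonneg hκ0 d1)
    nlinarith

/-- Keeps the error after the first composition of the halving step below `κ`, as the second one
requires; `5` is `1 + 3κ ≤ 4` plus `1`. -/
theorem halving_small {κ A q B : ℝ} (hκ : κ ≤ 1) (hA0 : 0 ≤ A) (hA : A ≤ q)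
    (hB : B ≤ q) : (1 + 3 * κ) * A + B ≤ 5 * q := by
  have h1 : κ * A ≤ 1 * A := mul_le_mul_of_nonneg_right hκ hA0
  linarith

/-- With `h = 2^{-γ}`, each half contributes `h C`, amplified at most twice by `1 + 3κ`; the two
defects contribute `(1 + 3κ) c + c ≤ 5 c`. Condition `hC` therefore reproduces the constant `C`. -/
theorem halving_close {κ h C c Q B : ℝ} (hκ0 : 0 ≤ κ) (hκ : κ ≤ 1) (hcQ : 0 ≤ c * Q)
    (hB : B ≤ c * Q) (hC : (1 + 3 * κ) ^ 2 * 2 * h * C + 5 * c ≤ C) (hQ : 0 ≤ Q)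
    (hA : 0 ≤ h * (C * Q)) :
    (1 + 3 * κ) * ((1 + 3 * κ) * (h * (C * Q)) + B + h * (C * Q)) + c * Q ≤ C * Q := by
  have h1 := mul_le_mul_of_nonneg_right hC hQ
  have h2 : (1 + 3 * κ) * B ≤ (1 + 3 * κ) * (c * Q) :=
    mul_le_mul_of_nonneg_left hB (by linarith)
  have h3 : κ * (c * Q) ≤ 1 * (c * Q) := mul_le_mul_of_nonneg_right hκ hcQ
  have h4 : (1 + 3 * κ) * (h * (C * Q)) ≤ (1 + 3 * κ) ^ 2 * (h * (C * Q)) :=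
    mul_le_mul_of_nonneg_right (by nlinarith) hA
  linarith

/-- Uniform bound on the compositions along partitions of a short interval. -/
theorem AlmostFlow.composeAlong_bound {T δ κ c γ C : ℝ} {E : ℝ → ℝ → X → X}
    (hE : AlmostFlow T δ κ c γ E) (hκ0 : 0 ≤ κ) (hκ : κ ≤ 1) (hc : 0 ≤ c) (hcC : c ≤ C)
    (hγ : 0 < γ) (hC : (1 + 3 * κ) ^ 2 * 2 * (1 / 2) ^ γ * C + 5 * c ≤ C)
    (hδκ : 5 * C * δ ^ γ ≤ κ) (P : Finset ℝ) :
    ∀ s t, 0 ≤ s → s ≤ t → t ≤ T → t - s ≤ δ →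
      BoundedLip (C * (t - s) ^ γ) (fun x => composeAlong E P t s x - E t s x) := by
  have hC0 : 0 ≤ C := hc.trans hcC
  -- Induction on the number of points of `P` strictly inside `(s, t)`.
  have main : ∀ n : ℕ, ∀ s t, 0 ≤ s → s ≤ t → t ≤ T → t - s ≤ δ →
      (P.filter (fun u => s < u ∧ u < t)).card = n →
      BoundedLip (C * (t - s) ^ γ) (fun x => composeAlong E P t s x - E t s x) := by
    intro n
    induction n using Nat.strong_induction_on with
    | _ n ih =>
    intro s t hs hst ht hδ hn
    have hτ : 0 ≤ C * (t - s) ^ γ := mul_nonneg hC0 (Real.rpow_nonneg (by linarith) _)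
    by_cases hne : P.filter (fun u => s < u ∧ u < t) = ∅
    · rw [composeAlong_of_filter_eq_empty E P hne]
      constructor
      · intro x; simpa using hτ
      · intro x y; simpa using mul_nonneg hτ (norm_nonneg (x - y))
    set m := (s + t) / 2 with hm
    -- `u` is the last point of `P` up to the midpoint and `w` the first one after it, with `s` and
    -- `t` as defaults. Between them the composition is the single map `E w u`, and both outer
    -- intervals have at most half the length.
    obtain ⟨u, hsu, hum, huP, hugap⟩ : ∃ u, s ≤ u ∧ u ≤ m ∧ (u ∈ P ∨ u = s) ∧
        ∀ r ∈ P, s < r → r ≤ m → r ≤ u := by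
      by_cases hA : (P.filter (fun u => s < u ∧ u ≤ m)).Nonempty
      · have hmem := Finset.max'_mem _ hA
        rw [Finset.mem_filter] at hmem
        exact ⟨_, hmem.2.1.le, hmem.2.2, Or.inl hmem.1, fun r hr h1 h2 =>
          Finset.le_max' _ _ (Finset.mem_filter.2 ⟨hr, h1, h2⟩)⟩
      · rw [Finset.not_nonempty_iff_eq_empty, Finset.filter_eq_empty_iff] at hA
        exact ⟨s, le_rfl, by rw [hm]; linarith, Or.inr rfl, fun r hr h1 h2 =>
          absurd ⟨h1, h2⟩ (hA hr)⟩
    obtain ⟨w, hwt, hmw, hwP, hwgap⟩ : ∃ w, w ≤ t ∧ m ≤ w ∧ (w ∈ P ∨ w = t) ∧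
        ∀ r ∈ P, m < r → r < t → w ≤ r := by
      by_cases hA : (P.filter (fun u => m < u ∧ u < t)).Nonempty
      · have hmem := Finset.min'_mem _ hA
        rw [Finset.mem_filter] at hmem
        exact ⟨_, hmem.2.2.le, hmem.2.1.le, Or.inl hmem.1, fun r hr h1 h2 =>
          Finset.min'_le _ _ (Finset.mem_filter.2 ⟨hr, h1, h2⟩)⟩
      · rw [Finset.not_nonempty_iff_eq_empty, Finset.filter_eq_empty_iff] at hA
        exact ⟨t, le_rfl, by rw [hm]; linarith, Or.inr rfl, fun r hr h1 h2 =>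
          absurd ⟨h1, h2⟩ (hA hr)⟩
    have huw : u ≤ w := hum.trans hmw
    have hgap : P.filter (fun r => u < r ∧ r < w) = ∅ := by
      refine Finset.filter_eq_empty_iff.2 fun r hr h => ?_
      rcases le_or_gt r m with h' | h'
      · exact absurd (hugap r hr (hsu.trans_lt h.1) h') (not_le.2 h.1)
      · exact absurd (hwgap r hr h' (h.2.trans_le hwt)) (not_le.2 h.2)
    obtain ⟨r₀, hr₀⟩ := Finset.nonempty_iff_ne_empty.2 hne
    have hr₀' := Finset.mem_filter.1 hr₀
    -- The count drops: `u` itself is lost, or, if `u = s`, any interior point is.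
    have hn1 : (P.filter (fun r => s < r ∧ r < u)).card < n := by
      rw [← hn]
      refine Finset.card_lt_card ((Finset.ssubset_iff_of_subset ?_).2 ?_)
      · intro r hr
        have := Finset.mem_filter.1 hr
        exact Finset.mem_filter.2 ⟨this.1, this.2.1, by linarith [this.2.2]⟩
      · rcases huP with h | h
        · rcases hsu.eq_or_lt with h' | h'
          · exact ⟨r₀, hr₀, fun h'' => by
              have := (Finset.mem_filter.1 h'').2; linarith [this.1, this.2]⟩
          · rcases (huw.trans hwt).eq_or_lt with h3 | h3
            · exfalso
              rw [h3] at hum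
              rw [hm] at hum
              linarith
            · exact ⟨u, Finset.mem_filter.2 ⟨h, h', h3⟩, fun h'' =>
                ((Finset.mem_filter.1 h'').2.2).false⟩
        · exact ⟨r₀, hr₀, fun h'' => by
            have := (Finset.mem_filter.1 h'').2; linarith [this.1, this.2]⟩
    have hn2 : (P.filter (fun r => w < r ∧ r < t)).card < n := by
      rw [← hn]
      refine Finset.card_lt_card ((Finset.ssubset_iff_of_subset ?_).2 ?_)
      · intro r hr
        have := Finset.mem_filter.1 hr
        exact Finset.mem_filter.2 ⟨this.1, by linarith [this.2.1], this.2.2⟩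
      · rcases hwP with h | h
        · rcases hwt.eq_or_lt with h' | h'
          · exact ⟨r₀, hr₀, fun h'' => by
              have := (Finset.mem_filter.1 h'').2; linarith [this.1, this.2]⟩
          · rcases (hsu.trans huw).eq_or_lt with h3 | h3
            · exfalso
              rw [← h3] at hmw
              rw [hm] at hmw
              linarith
            · exact ⟨w, Finset.mem_filter.2 ⟨h, h3, h'⟩, fun h'' =>
                ((Finset.mem_filter.1 h'').2.1).false⟩
        · exact ⟨r₀, hr₀, fun h'' => by
            have := (Finset.mem_filter.1 h'').2; linarith [this.1, this.2]⟩
    have hlen1 : u - s ≤ (t - s) / 2 := by rw [hm] at hum; linarith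
    have hlen2 : t - w ≤ (t - s) / 2 := by rw [hm] at hmw; linarith
    have i1 := ih _ hn1 s u hs hsu (by linarith) (by linarith) rfl
    have i2 := ih _ hn2 w t (by linarith) hwt ht (by linarith) rfl
    set A := C * ((t - s) / 2) ^ γ with hA
    have hA0 : 0 ≤ A := mul_nonneg hC0 (Real.rpow_nonneg (by linarith) _)
    have hmono : ∀ {b : ℝ} {D : X → X}, b ≤ A → BoundedLip b D → BoundedLip A D := by
      intro b D hb hD
      exact ⟨fun x => (hD.bound x).trans hb, fun x y => (hD.lip x y).trans (by gcongr)⟩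
    have j1 : BoundedLip A (fun x => composeAlong E P u s x - E u s x) :=
      hmono (mul_le_mul_of_nonneg_left
        (Real.rpow_le_rpow (by linarith) hlen1 hγ.le) hC0) i1
    have j2 : BoundedLip A (fun x => composeAlong E P t w x - E t w x) :=
      hmono (mul_le_mul_of_nonneg_left
        (Real.rpow_le_rpow (by linarith) hlen2 hγ.le) hC0) i2
    have hAval : A = (1 / 2) ^ γ * (C * (t - s) ^ γ) := by
      rw [hA, div_eq_mul_one_div, Real.mul_rpow (by linarith) (by norm_num)]; ring
    have hAle : A ≤ C * (t - s) ^ γ := by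
      rw [hA]
      exact mul_le_mul_of_nonneg_left (Real.rpow_le_rpow (by linarith) (by linarith) hγ.le) hC0
    have hτδ : C * (t - s) ^ γ ≤ C * δ ^ γ :=
      mul_le_mul_of_nonneg_left (Real.rpow_le_rpow (by linarith) hδ hγ.le) hC0
    have hCδ : 0 ≤ C * δ ^ γ := hτ.trans hτδ
    have hcτ : c * (t - s) ^ γ ≤ C * (t - s) ^ γ :=
      mul_le_mul_of_nonneg_right hcC (Real.rpow_nonneg (by linarith) _)
    have hcτ0 : 0 ≤ c * (t - s) ^ γ := mul_nonneg hc (Real.rpow_nonneg (by linarith) _)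
    have hA' : A ≤ κ := by linarith
    -- The middle piece is `E w u` itself, so it carries no error: `A₂ = 0`.
    have k1 := hE.comp_bound hκ0 hκ hs hsu huw (by linarith) (by linarith) (A₂ := 0)
      (Ψ₂ := E w u) hA' hA0 le_rfl j1 ⟨fun x => by simp, fun x y => by simp⟩
    set A' := (1 + 3 * κ) * (A + 0) + c * (w - s) ^ γ with hA'def
    have hcw : c * (w - s) ^ γ ≤ c * (t - s) ^ γ :=
      mul_le_mul_of_nonneg_left (Real.rpow_le_rpow (by linarith) (by linarith) hγ.le) hc
    have hcw0 : 0 ≤ c * (w - s) ^ γ := mul_nonneg hc (Real.rpow_nonneg (by linarith) _)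
    have hA'0 : 0 ≤ A' := by rw [hA'def]; positivity
    have hA'κ : A' ≤ κ := by
      rw [hA'def, add_zero]
      exact (halving_small hκ hA0 hAle (hcw.trans hcτ)).trans (by linarith)
    have k2 := hE.comp_bound hκ0 hκ hs (hsu.trans huw) hwt ht hδ hA'κ hA'0 hA0 k1 j2
    have key : (1 + 3 * κ) * (A' + A) + c * (t - s) ^ γ ≤ C * (t - s) ^ γ := by
      rw [hA'def, hAval, add_zero]
      exact halving_close hκ0 hκ hcτ0 hcw hC (Real.rpow_nonneg (sub_nonneg.2 hst) γ)
        (hAval ▸ hA0)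
    have hcomp : ∀ x, composeAlong E P t s x =
        composeAlong E P t w (E w u (composeAlong E P u s x)) := by
      intro x
      rw [← composeAlong_of_filter_eq_empty E P hgap,
        composeAlong_comp hE P hs hsu huw (hwt.trans ht) (by tauto),
        composeAlong_comp hE P hs (hsu.trans huw) hwt ht (by tauto)]
    simp only [hcomp]
    exact ⟨fun x => (k2.bound x).trans key, fun x y => (k2.lip x y).trans (by gcongr)⟩
  intro s t hs hst ht hδ
  exact main _ s t hs hst ht hδ rfl

/-- Comparison of two families of maps along a subdivision `u 0, …, u n` of `[s,t]`. -/
theorem telescope {φ ψ : ℝ → ℝ → X → X} {s t K e : ℝ} (n : ℕ) (u : ℕ → ℝ) (h0 : u 0 = s)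
    (hn : u n = t) (hφt : ∀ x, φ t t x = x) (hψs : ∀ x, ψ s s x = x)
    (hφ : ∀ i < n, ∀ x, φ t (u (i + 1)) (φ (u (i + 1)) (u i) x) = φ t (u i) x)
    (hψ : ∀ i < n, ∀ x, ψ (u (i + 1)) (u i) (ψ (u i) s x) = ψ (u (i + 1)) s x)
    (hK : ∀ i < n, ∀ x y, ‖φ t (u (i + 1)) x - φ t (u (i + 1)) y‖ ≤ K * ‖x - y‖) (hK0 : 0 ≤ K)
    (he : ∀ i < n, ∀ x, ‖ψ (u (i + 1)) (u i) x - φ (u (i + 1)) (u i) x‖ ≤ e) (x : X) :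
    ‖ψ t s x - φ t s x‖ ≤ n * (K * e) := by
  -- Interpolation by following `ψ` up to `u i` and `φ` afterwards; each step replaces one piece of
  -- `φ` by a piece of `ψ`.
  have step : ∀ i ≤ n, ‖φ t (u i) (ψ (u i) s x) - φ t s x‖ ≤ i * (K * e) := by
    intro i
    induction i with
    | zero => intro _; rw [h0, hψs]; simp
    | succ i ih =>
      intro hi
      have h1 := ih (by omega)
      have h2 := hK i hi (ψ (u (i + 1)) (u i) (ψ (u i) s x)) (φ (u (i + 1)) (u i) (ψ (u i) s x))
      rw [hψ i hi, hφ i hi] at h2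
      have h3 := he i hi (ψ (u i) s x)
      rw [hψ i hi] at h3
      have h4 := mul_le_mul_of_nonneg_left h3 hK0
      have h5 := norm_sub_le_norm_sub_add_norm_sub (φ t (u (i + 1)) (ψ (u (i + 1)) s x))
        (φ t (u i) (ψ (u i) s x)) (φ t s x)
      push_cast
      linarith
  have := step n le_rfl
  rwa [hn, hφt] at this

end Sewing
-- The sewing limit and the comparison of flows
section Sewing

variable {X : Type*} [NormedAddCommGroup X]

theorem BoundedLip.lipschitz_of_sub {Ψ E : X → X} {A κ : ℝ}
    (h : BoundedLip A (fun x => Ψ x - E x)) (hE : ∀ x y, ‖E x - E y‖ ≤ κ * ‖x - y‖) (x y : X) :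
    ‖Ψ x - Ψ y‖ ≤ (A + κ) * ‖x - y‖ := by
  have h1 := h.lip x y
  have h2 := hE x y
  have : Ψ x - Ψ y = ((Ψ x - E x) - (Ψ y - E y)) + (E x - E y) := by abel
  rw [this]
  refine (norm_add_le _ _).trans ?_
  linarith

/-- Values close to `0` for the sum of the errors along a fine uniform subdivision. -/
theorem tendsto_nat_mul_div_rpow {γ : ℝ} (hγ : 1 < γ) (a b : ℝ) (hb : 0 ≤ b) :
    Tendsto (fun n : ℕ => (n : ℝ) * (a * (b / n) ^ γ)) atTop (𝓝 0) := by
  have h1 : Tendsto (fun n : ℕ => (n : ℝ) ^ (-(γ - 1))) atTop (𝓝 0) :=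
    (tendsto_rpow_neg_atTop (by linarith)).comp tendsto_natCast_atTop_atTop
  have h2 := h1.const_mul (a * b ^ γ)
  rw [mul_zero] at h2
  refine h2.congr' ?_
  filter_upwards [eventually_gt_atTop 0] with n hn
  have hn' : (0 : ℝ) < n := by exact_mod_cast hn
  have h3 : (n : ℝ) ^ γ = (n : ℝ) ^ (γ - 1) * n := by
    rw [← Real.rpow_add_one hn'.ne']; congr 1; ring
  have h4 : (0 : ℝ) < (n : ℝ) ^ (γ - 1) := Real.rpow_pos_of_pos hn' _
  rw [Real.div_rpow hb hn'.le, Real.rpow_neg hn'.le, h3]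
  field_simp

/-- The points of the subdivision of `[s,t]` into `n` equal pieces. -/
noncomputable def unifPt (s t : ℝ) (n : ℕ) (i : ℕ) : ℝ := s + i * ((t - s) / n)

theorem unifPt_zero (s t : ℝ) (n : ℕ) : unifPt s t n 0 = s := by simp [unifPt]

theorem unifPt_last (s t : ℝ) {n : ℕ} (hn : 0 < n) : unifPt s t n n = t := by
  have : (n : ℝ) ≠ 0 := by positivity
  simp only [unifPt]; field_simp; ring

theorem unifPt_mono {s t : ℝ} (hst : s ≤ t) (n : ℕ) {i j : ℕ} (h : i ≤ j) :
    unifPt s t n i ≤ unifPt s t n j := by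
  have h1 : 0 ≤ (t - s) / n := div_nonneg (sub_nonneg.2 hst) n.cast_nonneg
  have h2 : (i : ℝ) ≤ j := by exact_mod_cast h
  simp only [unifPt]
  nlinarith

theorem unifPt_succ_sub (s t : ℝ) (n i : ℕ) :
    unifPt s t n (i + 1) - unifPt s t n i = (t - s) / n := by
  simp only [unifPt]; push_cast; ring

theorem unifPt_mem {s t : ℝ} (hst : s ≤ t) {n i : ℕ} (hn : 0 < n) (hi : i ≤ n) :
    s ≤ unifPt s t n i ∧ unifPt s t n i ≤ t := by
  have h1 := unifPt_mono hst n (Nat.zero_le i)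
  have h2 := unifPt_mono hst n hi
  rw [unifPt_zero] at h1
  rw [unifPt_last s t hn] at h2
  exact ⟨h1, h2⟩

/-- The sewing lemma for flows. -/
theorem AlmostFlow.exists_flow [CompleteSpace X] {T δ κ c γ C : ℝ} {E : ℝ → ℝ → X → X}
    (hE : AlmostFlow T δ κ c γ E) (hκ0 : 0 ≤ κ) (hκ : κ ≤ 1) (hc : 0 ≤ c) (hcC : c ≤ C)
    (hγ : 1 < γ) (hC : (1 + 3 * κ) ^ 2 * 2 * (1 / 2) ^ γ * C + 5 * c ≤ C)
    (hδ0 : 0 < δ) (hδκ : 5 * C * δ ^ γ ≤ κ) :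
    ∃ φ : ℝ → ℝ → X → X,
      (∀ s u t, 0 ≤ s → s ≤ u → u ≤ t → t ≤ T → ∀ x, φ t u (φ u s x) = φ t s x) ∧
      (∀ s t, 0 ≤ s → s ≤ t → t ≤ T → t - s ≤ δ →
        ∀ x, ‖φ t s x - E t s x‖ ≤ C * (t - s) ^ γ) ∧
      ∃ K, 0 ≤ K ∧ ∀ s t, 0 ≤ s → s ≤ t → t ≤ T → ∀ x y,
        ‖φ t s x - φ t s y‖ ≤ K * ‖x - y‖ := by
  have hbd := fun P => hE.composeAlong_bound hκ0 hκ hc hcC (by linarith) hC hδκ P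
  have hC0 : 0 ≤ C := hc.trans hcC
  -- The constant is `C δ^γ + 1 + κ ≤ 3`, since `5 C δ^γ ≤ κ ≤ 1`.
  have hlip : ∀ P s t, 0 ≤ s → s ≤ t → t ≤ T → t - s ≤ δ → ∀ x y,
      ‖composeAlong E P t s x - composeAlong E P t s y‖ ≤ 3 * ‖x - y‖ := by
    intro P s t hs hst ht hδ x y
    refine ((hbd P s t hs hst ht hδ).lipschitz_of_sub
      (hE.lipschitz hs hst ht hδ) x y).trans ?_
    have h1 : (t - s) ^ γ ≤ δ ^ γ := Real.rpow_le_rpow (by linarith) hδ (by linarith)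
    have h2 : C * (t - s) ^ γ ≤ C * δ ^ γ := mul_le_mul_of_nonneg_left h1 hC0
    have h3 : 0 ≤ C * δ ^ γ := mul_nonneg hC0 (Real.rpow_nonneg hδ0.le _)
    refine mul_le_mul_of_nonneg_right ?_ (norm_nonneg _)
    linarith
  -- The net over finite sets ordered by inclusion is Cauchy. If `P` contains the uniform
  -- subdivision `P₀`, both compositions split along it, each piece differs by at most `2 C
  -- ((t-s)/n)^γ`, and telescoping gives a total that vanishes as `n` grows.
  have hloc : ∀ s t, 0 ≤ s → s ≤ t → t ≤ T → t - s ≤ δ → ∀ x,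
      ∃ z, Tendsto (fun P => composeAlong E P t s x) atTop (𝓝 z) := by
    intro s t hs hst ht hδ x
    refine cauchySeq_tendsto_of_complete (Metric.cauchySeq_iff'.2 fun ε hε => ?_)
    have hlim := tendsto_nat_mul_div_rpow hγ (3 * (2 * C)) (t - s) (by linarith)
    obtain ⟨n, hn, hn0⟩ := ((hlim.eventually (gt_mem_nhds hε)).and (eventually_gt_atTop 0)).exists
    let P₀ : Finset ℝ := (Finset.range (n + 1)).image (unifPt s t n)
    have hP₀ : ∀ i ≤ n, unifPt s t n i ∈ P₀ := fun i hi =>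
      Finset.mem_image_of_mem _ (Finset.mem_range.2 (by omega))
    refine ⟨P₀, fun P hP => ?_⟩
    rw [dist_eq_norm]
    have hmem := fun i (hi : i ≤ n) => unifPt_mem hst hn0 hi
    refine (telescope (K := 3) (e := 2 * C * ((t - s) / n) ^ γ) n (unifPt s t n)
      (unifPt_zero s t n) (unifPt_last s t hn0) (φ := composeAlong E P₀)
      (ψ := composeAlong E P) ?_ ?_ ?_ ?_ ?_ (by norm_num) ?_ x).trans_lt ?_
    · intro x; rw [composeAlong_self, hE.refl t (hs.trans hst) ht]
    · intro x; rw [composeAlong_self, hE.refl s hs (hst.trans ht)]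
    · intro i hi x
      exact composeAlong_comp hE P₀ (hs.trans (hmem i hi.le).1)
        (unifPt_mono hst n (by omega)) (hmem (i + 1) hi).2 ht (Or.inl (hP₀ _ hi)) x
    · intro i hi x
      exact composeAlong_comp hE P hs (hmem i hi.le).1 (unifPt_mono hst n (by omega))
        ((hmem (i + 1) hi).2.trans ht) (Or.inl (hP (hP₀ _ hi.le))) x
    · intro i hi
      have := hmem (i + 1) hi
      exact hlip P₀ _ _ (hs.trans this.1) this.2 ht (by linarith)
    · intro i hi y
      have h1 := (hmem i hi.le)
      have h2 := (hmem (i + 1) hi)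
      have h3 := unifPt_succ_sub s t n i
      have h4 := fun P => (hbd P (unifPt s t n i) (unifPt s t n (i + 1)) (hs.trans h1.1)
        (unifPt_mono hst n (by omega)) (h2.2.trans ht) (by linarith)).bound y
      rw [h3] at h4
      have h5 := norm_sub_le_norm_sub_add_norm_sub
        (composeAlong E P (unifPt s t n (i + 1)) (unifPt s t n i) y)
        (E (unifPt s t n (i + 1)) (unifPt s t n i) y)
        (composeAlong E P₀ (unifPt s t n (i + 1)) (unifPt s t n i) y)
      rw [norm_sub_rev (E _ _ y)] at h5
      linarith [h4 P, h4 P₀]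
    · calc _ = (n : ℝ) * (3 * (2 * C) * ((t - s) / n) ^ γ) := by ring
        _ < ε := hn
  -- Long intervals are cut into pieces of length at most `δ`. Splitting a composition requires the
  -- cut point to be in `P`, so the Lipschitz bound holds only eventually in `P`.
  have hglob : ∀ k : ℕ, ∀ s t, 0 ≤ s → s ≤ t → t ≤ T → t - s ≤ k * δ →
      (∀ᶠ P in atTop, ∀ x y,
        ‖composeAlong E P t s x - composeAlong E P t s y‖ ≤ 3 ^ k * ‖x - y‖) ∧
      ∀ x, ∃ z, Tendsto (fun P => composeAlong E P t s x) atTop (𝓝 z) := by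
    intro k
    induction k with
    | zero =>
      intro s t hs hst ht hk
      have : t = s := le_antisymm (by simpa using hk) hst
      subst this
      simp only [composeAlong_self, hE.refl t hs ht]
      exact ⟨Eventually.of_forall fun P x y => by simp, fun x => ⟨x, tendsto_const_nhds⟩⟩
    | succ k ih =>
      intro s t hs hst ht hk
      push_cast at hk
      set u := max s (t - δ) with hu
      have hsu : s ≤ u := le_max_left _ _
      have hut : u ≤ t := max_le hst (by linarith)
      have htu : t - u ≤ δ := by linarith [le_max_right s (t - δ)]
      have hus : u - s ≤ k * δ := by
        rcases max_choice s (t - δ) with h | h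
        · rw [hu, h, sub_self]; positivity
        · rw [hu, h]; linarith
      obtain ⟨i1, i2⟩ := ih s u hs hsu (hut.trans ht) hus
      have hmem : ∀ᶠ P : Finset ℝ in atTop, u ∈ P := by
        filter_upwards [eventually_ge_atTop ({u} : Finset ℝ)] with P hP
        exact hP (Finset.mem_singleton_self u)
      have hcomp : ∀ᶠ P : Finset ℝ in atTop, ∀ x,
          composeAlong E P t u (composeAlong E P u s x) = composeAlong E P t s x := by
        filter_upwards [hmem] with P hP x
        exact composeAlong_comp hE P hs hsu hut ht (Or.inl hP) x
      constructor
      · filter_upwards [hcomp, i1] with P hP hP1 x y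
        rw [← hP, ← hP]
        refine (hlip P u t (hs.trans hsu) hut ht htu _ _).trans ?_
        rw [pow_succ]
        linarith [hP1 x y]
      · intro x
        obtain ⟨z, hz⟩ := i2 x
        obtain ⟨w, hw⟩ := hloc u t (hs.trans hsu) hut ht htu z
        refine ⟨w, Tendsto.congr' (hcomp.mono fun P hP => hP x) ?_⟩
        refine tendsto_of_tendsto_of_dist hw ?_
        have h0 : Tendsto (fun P => 3 * dist z (composeAlong E P u s x)) atTop (𝓝 0) := by
          have := (tendsto_const_nhds (x := z)).dist hz
          rw [dist_self] at this
          simpa using this.const_mul 3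
        refine squeeze_zero (fun _ => dist_nonneg) (fun P => ?_) h0
        rw [dist_eq_norm, dist_eq_norm]
        exact hlip P u t (hs.trans hsu) hut ht htu _ _
  obtain ⟨k, hk⟩ := exists_nat_gt (T / δ)
  have hkT : ∀ s t, 0 ≤ s → t ≤ T → t - s ≤ k * δ := by
    intro s t hs ht
    rw [div_lt_iff₀ hδ0] at hk
    linarith
  let φ : ℝ → ℝ → X → X := fun t s x => limUnder atTop (fun P => composeAlong E P t s x)
  have hφ : ∀ s t, 0 ≤ s → s ≤ t → t ≤ T → ∀ x,
      Tendsto (fun P => composeAlong E P t s x) atTop (𝓝 (φ t s x)) := by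
    intro s t hs hst ht x
    exact tendsto_nhds_limUnder ((hglob k s t hs hst ht (hkT s t hs ht)).2 x)
  refine ⟨φ, ?_, ?_, 3 ^ k, by positivity, ?_⟩
  · intro s u t hs hsu hut ht x
    have h1 := hφ s u hs hsu (hut.trans ht) x
    have h2 := hφ u t (hs.trans hsu) hut ht (φ u s x)
    have h3 := hφ s t hs (hsu.trans hut) ht x
    refine tendsto_nhds_unique ?_ h3
    have hcomp : ∀ᶠ P : Finset ℝ in atTop,
        composeAlong E P t u (composeAlong E P u s x) = composeAlong E P t s x := by
      filter_upwards [eventually_ge_atTop ({u} : Finset ℝ)] with P hP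
      exact composeAlong_comp hE P hs hsu hut ht
        (Or.inl (hP (Finset.mem_singleton_self u))) x
    -- The inner argument moves with `P`; the Lipschitz bound for the outer map, uniform in `P`,
    -- absorbs this.
    refine Tendsto.congr' hcomp (tendsto_of_tendsto_of_dist h2 ?_)
    have h0 : Tendsto (fun P => 3 ^ k * dist (φ u s x) (composeAlong E P u s x)) atTop (𝓝 0) := by
      have := (tendsto_const_nhds (x := φ u s x)).dist h1
      rw [dist_self] at this
      simpa using this.const_mul (3 ^ k)
    refine squeeze_zero' (Eventually.of_forall fun _ => dist_nonneg) ?_ h0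
    filter_upwards [(hglob k u t (hs.trans hsu) hut ht (hkT u t (hs.trans hsu) ht)).1] with P hP
    rw [dist_eq_norm, dist_eq_norm]
    exact hP _ _
  · intro s t hs hst ht hδ x
    exact le_of_tendsto ((hφ s t hs hst ht x).sub_const _).norm
      (Eventually.of_forall fun P => (hbd P s t hs hst ht hδ).bound x)
  · intro s t hs hst ht x y
    exact le_of_tendsto ((hφ s t hs hst ht x).sub (hφ s t hs hst ht y)).norm
      ((hglob k s t hs hst ht (hkT s t hs ht)).1.mono fun P hP => hP x y)

/-- Two flows that are close on short intervals, one of which is Lipschitz, are close. -/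
theorem flow_dist_le {T K e : ℝ} {φ ψ : ℝ → ℝ → X → X}
    (hφ : ∀ s u t, 0 ≤ s → s ≤ u → u ≤ t → t ≤ T → ∀ x, φ t u (φ u s x) = φ t s x)
    (hψ : ∀ s u t, 0 ≤ s → s ≤ u → u ≤ t → t ≤ T → ∀ x, ψ t u (ψ u s x) = ψ t s x)
    (hφ0 : ∀ s, 0 ≤ s → s ≤ T → ∀ x, φ s s x = x) (hψ0 : ∀ s, 0 ≤ s → s ≤ T → ∀ x, ψ s s x = x)
    (hK0 : 0 ≤ K) (hK : ∀ s t, 0 ≤ s → s ≤ t → t ≤ T → ∀ x y,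
      ‖φ t s x - φ t s y‖ ≤ K * ‖x - y‖) {n : ℕ} (hn : 0 < n)
    (he : ∀ s t, 0 ≤ s → s ≤ t → t ≤ T → t - s ≤ T / n → ∀ x, ‖ψ t s x - φ t s x‖ ≤ e)
    {s t : ℝ} (hs : 0 ≤ s) (hst : s ≤ t) (ht : t ≤ T) (x : X) :
    ‖ψ t s x - φ t s x‖ ≤ n * (K * e) := by
  -- Only `φ` has to be Lipschitz: it is the flow applied after each local error. Uniqueness can
  -- thus be proved among flows with no regularity.
  have hmem := fun i (hi : i ≤ n) => unifPt_mem hst hn hi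
  refine telescope n (unifPt s t n) (unifPt_zero s t n) (unifPt_last s t hn)
    (hφ0 t (hs.trans hst) ht) (hψ0 s hs (hst.trans ht)) ?_ ?_ ?_ hK0 ?_ x
  · intro i hi x
    exact hφ _ _ _ (hs.trans (hmem i hi.le).1) (unifPt_mono hst n (by omega))
      (hmem (i + 1) hi).2 ht x
  · intro i hi x
    exact hψ _ _ _ hs (hmem i hi.le).1 (unifPt_mono hst n (by omega))
      ((hmem (i + 1) hi).2.trans ht) x
  · intro i hi
    exact hK _ _ (hs.trans (hmem (i + 1) hi).1) (hmem (i + 1) hi).2 ht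
  · intro i hi
    refine he _ _ (hs.trans (hmem i hi.le).1) (unifPt_mono hst n (by omega))
      ((hmem (i + 1) hi).2.trans ht) ?_
    rw [unifPt_succ_sub]
    exact div_le_div_of_nonneg_right (by linarith) n.cast_nonneg

end Sewing
-- Estimates for bounded Lipschitz maps with bounded second differences
section Calculus

variable {X Y Z : Type*} [NormedAddCommGroup X] [NormedAddCommGroup Y] [NormedAddCommGroup Z]

theorem BoundedLip.mono {a b : ℝ} {D : X → Y} (h : BoundedLip a D) (hab : a ≤ b) :
    BoundedLip b D :=
  ⟨fun x => (h.bound x).trans hab, fun x y => (h.lip x y).trans (by gcongr)⟩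

theorem BoundedLip.nonneg {a : ℝ} {D : X → Y} (h : BoundedLip a D) : 0 ≤ a :=
  (norm_nonneg _).trans (h.bound 0)

theorem BoundedLip.add {a b : ℝ} {D D' : X → Y} (h : BoundedLip a D) (h' : BoundedLip b D') :
    BoundedLip (a + b) (fun x => D x + D' x) := by
  refine ⟨fun x => (norm_add_le _ _).trans (add_le_add (h.bound x) (h'.bound x)),
    fun x y => ?_⟩
  rw [add_sub_add_comm, add_mul]
  exact (norm_add_le _ _).trans (add_le_add (h.lip x y) (h'.lip x y))

theorem BoundedLip.sum {ι : Type*} (s : Finset ι) {c : ι → ℝ} {D : ι → X → Y}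
    (h : ∀ i ∈ s, BoundedLip (c i) (D i)) :
    BoundedLip (∑ i ∈ s, c i) (fun x => ∑ i ∈ s, D i x) := by
  refine ⟨fun x => norm_sum_le_of_le _ fun i hi => (h i hi).bound x, fun x y => ?_⟩
  rw [← Finset.sum_sub_distrib, Finset.sum_mul]
  exact norm_sum_le_of_le _ fun i hi => (h i hi).lip x y

theorem SecondDiff.mono {a b : ℝ} {D : X → Y} (h : SecondDiff a D) (hab : a ≤ b) :
    SecondDiff b D := fun x y w => (h x y w).trans (by gcongr)

theorem SecondDiff.add {a b : ℝ} {D D' : X → Y} (h : SecondDiff a D) (h' : SecondDiff b D') :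
    SecondDiff (a + b) (fun x => D x + D' x) := by
  intro x y w
  have e : D (x + w) + D' (x + w) - (D x + D' x) - (D (y + w) + D' (y + w) - (D y + D' y)) =
      (D (x + w) - D x - (D (y + w) - D y)) + (D' (x + w) - D' x - (D' (y + w) - D' y)) := by abel
  rw [e, add_mul, add_mul]
  exact (norm_add_le _ _).trans (add_le_add (h x y w) (h' x y w))

theorem SecondDiff.sum {ι : Type*} (s : Finset ι) {c : ι → ℝ} {D : ι → X → Y}
    (h : ∀ i ∈ s, SecondDiff (c i) (D i)) :
    SecondDiff (∑ i ∈ s, c i) (fun x => ∑ i ∈ s, D i x) := by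
  intro x y w
  simp only [← Finset.sum_sub_distrib, Finset.sum_mul]
  exact norm_sum_le_of_le _ fun i hi => h i hi x y w

/-- Bounded and Lipschitz maps with bounded second differences. -/
structure BoundedLip2 (c : ℝ) (D : X → Y) : Prop extends BoundedLip c D where
  second : SecondDiff c D

theorem BoundedLip2.mono {a b : ℝ} {D : X → Y} (h : BoundedLip2 a D) (hab : a ≤ b) :
    BoundedLip2 b D := ⟨h.toBoundedLip.mono hab, h.second.mono hab⟩

/-- Equal displacements at two base points are compared by the second difference, then two
displacements at one base point by the Lipschitz bound. The size `b` of the displacement survives as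
a factor, which is the order gained. -/
theorem BoundedLip2.comp_add_sub {a b : ℝ} {u : X → Y} {n : X → X} (hu : BoundedLip2 a u)
    (hn : BoundedLip b n) : BoundedLip (2 * a * b) (fun x => u (x + n x) - u x) := by
  have ha := hu.nonneg
  have hb := hn.nonneg
  constructor
  · intro x
    have h1 := hu.lip (x + n x) x
    rw [add_sub_cancel_left] at h1
    have := mul_le_mul_of_nonneg_left (hn.bound x) ha
    linarith [mul_nonneg ha hb]
  · intro x y
    have e : u (x + n x) - u x - (u (y + n y) - u y) =
        (u (x + n x) - u x - (u (y + n x) - u y)) + (u (y + n x) - u (y + n y)) := by abel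
    have h1 := hu.second x y (n x)
    have h2 := hu.lip (y + n x) (y + n y)
    rw [add_sub_add_left_eq_sub] at h2
    have h3 := mul_le_mul_of_nonneg_left (hn.bound x) (mul_nonneg ha (norm_nonneg (x - y)))
    have h4 := mul_le_mul_of_nonneg_left (hn.lip x y) ha
    rw [e]
    refine (norm_add_le _ _).trans ?_
    linarith

variable [NormedSpace ℝ Y] [NormedSpace ℝ Z]

theorem BoundedLip.smul {a c r : ℝ} {D : X → Y} (h : BoundedLip c D) (ha : |a| ≤ r) :
    BoundedLip (r * c) (fun x => a • D x) := by
  have hr : 0 ≤ r := (abs_nonneg a).trans ha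
  refine ⟨fun x => ?_, fun x y => ?_⟩
  · rw [norm_smul, Real.norm_eq_abs]
    exact mul_le_mul ha (h.bound x) (norm_nonneg _) hr
  · rw [← smul_sub, norm_smul, Real.norm_eq_abs, mul_assoc]
    exact mul_le_mul ha (h.lip x y) (norm_nonneg _) hr

theorem SecondDiff.smul {a c r : ℝ} {D : X → Y} (h : SecondDiff c D) (ha : |a| ≤ r) :
    SecondDiff (r * c) (fun x => a • D x) := by
  have hr : 0 ≤ r := (abs_nonneg a).trans ha
  intro x y w
  rw [← smul_sub, ← smul_sub, ← smul_sub, norm_smul, Real.norm_eq_abs, mul_assoc, mul_assoc,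
    ← mul_assoc c]
  exact mul_le_mul ha (h x y w) (norm_nonneg _) hr

theorem BoundedLip.clm_apply {a b : ℝ} {A : X → Y →L[ℝ] Z} {u : X → Y} (hA : BoundedLip a A)
    (hu : BoundedLip b u) : BoundedLip (2 * a * b) (fun x => A x (u x)) := by
  have ha := hA.nonneg
  have hb := hu.nonneg
  have bA : ∀ x z, ‖A x z‖ ≤ a * ‖z‖ := fun x z => (A x).le_of_opNorm_le (hA.bound x) z
  constructor
  · intro x
    have := mul_le_mul_of_nonneg_left (hu.bound x) ha
    linarith [bA x (u x), mul_nonneg ha hb]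
  · intro x y
    have e : A x (u x) - A y (u y) = A x (u x - u y) + (A x - A y) (u y) := by
      simp
    rw [e]
    refine (norm_add_le _ _).trans ?_
    have h1 := (bA x (u x - u y)).trans (mul_le_mul_of_nonneg_left (hu.lip x y) ha)
    have h2 : ‖(A x - A y) (u y)‖ ≤ a * ‖x - y‖ * b :=
      ((A x - A y).le_opNorm _).trans (mul_le_mul (hA.lip x y) (hu.bound y) (norm_nonneg _)
        (by positivity))
    linarith

/-- Leibniz rule for second differences: either one factor takes the second difference, or each
takes one first difference, which gives four terms. -/
theorem BoundedLip2.clm_apply {a b : ℝ} {A : X → Y →L[ℝ] Z} {u : X → Y} (hA : BoundedLip2 a A)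
    (hu : BoundedLip2 b u) : BoundedLip2 (4 * a * b) (fun x => A x (u x)) := by
  have ha := hA.nonneg
  have hb := hu.nonneg
  have bA : ∀ x z, ‖A x z‖ ≤ a * ‖z‖ := fun x z => (A x).le_of_opNorm_le (hA.bound x) z
  refine ⟨(hA.toBoundedLip.clm_apply hu.toBoundedLip).mono
    (by nlinarith [mul_nonneg ha hb]), fun x y w => ?_⟩
  have e : A (x + w) (u (x + w)) - A x (u x) - (A (y + w) (u (y + w)) - A y (u y)) =
      (A (x + w) - A x - (A (y + w) - A y)) (u (x + w))
      + (A (y + w) - A y) (u (x + w) - u (y + w))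
      + A x (u (x + w) - u x - (u (y + w) - u y))
      + (A x - A y) (u (y + w) - u y) := by
    simp only [FunLike.coe_sub, Pi.sub_apply, map_sub]
    abel
  have h1 : ‖(A (x + w) - A x - (A (y + w) - A y)) (u (x + w))‖ ≤ a * ‖x - y‖ * ‖w‖ * b :=
    (ContinuousLinearMap.le_opNorm _ _).trans (mul_le_mul (hA.second x y w) (hu.bound _)
      (norm_nonneg _) (by positivity))
  have h2 : ‖(A (y + w) - A y) (u (x + w) - u (y + w))‖ ≤ a * ‖w‖ * (b * ‖x - y‖) := by
    refine (ContinuousLinearMap.le_opNorm _ _).trans (mul_le_mul ?_ ?_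
      (norm_nonneg _) (by positivity))
    · simpa using hA.lip (y + w) y
    · simpa using hu.lip (x + w) (y + w)
  have h3 : ‖A x (u (x + w) - u x - (u (y + w) - u y))‖ ≤ a * (b * ‖x - y‖ * ‖w‖) :=
    (bA _ _).trans (mul_le_mul_of_nonneg_left (hu.second x y w) ha)
  have h4 : ‖(A x - A y) (u (y + w) - u y)‖ ≤ a * ‖x - y‖ * (b * ‖w‖) := by
    refine (ContinuousLinearMap.le_opNorm _ _).trans (mul_le_mul (hA.lip x y) ?_
      (norm_nonneg _) (by positivity))
    simpa using hu.lip (y + w) y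
  rw [e]
  refine ((norm_add_le _ _).trans (add_le_add_left (norm_add₃_le) _)).trans ?_
  linarith

variable [NormedSpace ℝ X]

theorem norm_fderiv_eq (u : X → Y) (x : X) :
    ‖fderiv ℝ u x‖ = ‖iteratedFDeriv ℝ 1 u x‖ := by
  have := norm_iteratedFDeriv_fderiv (𝕜 := ℝ) (f := u) (n := 0) (x := x)
  rwa [norm_iteratedFDeriv_zero] at this

theorem norm_fderiv_sub_le {M : ℝ} {u : X → Y} (hu : ContDiff ℝ 2 u)
    (h2 : ∀ x, ‖iteratedFDeriv ℝ 2 u x‖ ≤ M) (x y : X) :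
    ‖fderiv ℝ u x - fderiv ℝ u y‖ ≤ M * ‖x - y‖ := by
  refine convex_univ.norm_image_sub_le_of_norm_fderiv_le
    (fun z _ => (hu.fderiv_right (m := 1) (by norm_num)).differentiable (by norm_num) z)
    (fun z _ => ?_) (mem_univ y) (mem_univ x)
  rw [norm_fderiv_eq, norm_iteratedFDeriv_fderiv]
  exact h2 z

/-- For the second difference, the mean value inequality applies to `z ↦ u (z + w) - u z`, whose
derivative is at most `M ‖w‖`. -/
theorem boundedLip2_of_contDiff {M : ℝ} {u : X → Y} (hu : ContDiff ℝ 2 u)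
    (h0 : ∀ x, ‖u x‖ ≤ M) (h1 : ∀ x, ‖iteratedFDeriv ℝ 1 u x‖ ≤ M)
    (h2 : ∀ x, ‖iteratedFDeriv ℝ 2 u x‖ ≤ M) : BoundedLip2 M u := by
  have hd : Differentiable ℝ u := hu.differentiable (by norm_num)
  have l1 : ∀ x y, ‖u x - u y‖ ≤ M * ‖x - y‖ := fun x y =>
    convex_univ.norm_image_sub_le_of_norm_fderiv_le (fun z _ => hd z)
      (fun z _ => (norm_fderiv_eq u z).trans_le (h1 z)) (mem_univ y) (mem_univ x)
  have l2 := norm_fderiv_sub_le hu h2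
  refine ⟨⟨h0, l1⟩, fun x y w => ?_⟩
  have hg : ∀ z, HasFDerivAt (fun z => u (z + w) - u z) (fderiv ℝ u (z + w) - fderiv ℝ u z) z := by
    intro z
    exact ((hasFDerivAt_comp_add_right w).2 (hd (z + w)).hasFDerivAt).sub (hd z).hasFDerivAt
  have := convex_univ.norm_image_sub_le_of_norm_hasFDerivWithin_le (C := M * ‖w‖)
    (fun z _ => (hg z).hasFDerivWithinAt) (fun z _ => by simpa using l2 (z + w) z)
    (mem_univ y) (mem_univ x)
  calc _ ≤ M * ‖w‖ * ‖x - y‖ := this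
    _ = M * ‖x - y‖ * ‖w‖ := by ring

/-- First order Taylor remainder along a Lipschitz displacement. -/
theorem BoundedLip2.taylor {a b : ℝ} {f : X → Y} {n : X → X} (hf : Differentiable ℝ f)
    (hDf : BoundedLip2 a (fderiv ℝ f)) (hn : BoundedLip b n) :
    BoundedLip (3 * a * b ^ 2) (fun x => f (x + n x) - f x - fderiv ℝ f x (n x)) := by
  have ha := hDf.nonneg
  have hb := hn.nonneg
  have hpath : ∀ x (θ : ℝ), HasDerivAt (fun θ : ℝ => f (x + θ • n x))
      (fderiv ℝ f (x + θ • n x) (n x)) θ := by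
    intro x θ
    have h1 : HasDerivAt (fun θ : ℝ => x + θ • n x) (n x) θ := by
      simpa using ((hasDerivAt_id θ).smul_const (n x)).const_add x
    exact (hf _).hasFDerivAt.comp_hasDerivAt θ h1
  have hnorm : ∀ x (θ : ℝ), θ ∈ Ico (0 : ℝ) 1 → ‖θ • n x‖ ≤ b := by
    intro x θ hθ
    rw [norm_smul, Real.norm_eq_abs, abs_of_nonneg hθ.1]
    calc θ * ‖n x‖ ≤ 1 * ‖n x‖ := by gcongr; exact hθ.2.le
      _ ≤ b := by rw [one_mul]; exact hn.bound x
  have hD : ∀ x (θ : ℝ), θ ∈ Ico (0 : ℝ) 1 →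
      ‖fderiv ℝ f (x + θ • n x) - fderiv ℝ f x‖ ≤ a * b := by
    intro x θ hθ
    have h1 := hDf.lip (x + θ • n x) x
    rw [add_sub_cancel_left] at h1
    exact h1.trans (mul_le_mul_of_nonneg_left (hnorm x θ hθ) ha)
  constructor
  · intro x
    have := norm_image_sub_le_of_norm_deriv_le_segment_01'
      (f := fun θ : ℝ => f (x + θ • n x) - θ • fderiv ℝ f x (n x))
      (f' := fun θ => fderiv ℝ f (x + θ • n x) (n x) - fderiv ℝ f x (n x)) (C := a * b * b)
      (fun θ _ => ((hpath x θ).sub (by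
        simpa using (hasDerivAt_id θ).smul_const (fderiv ℝ f x (n x)))).hasDerivWithinAt)
      (fun θ hθ => by
        exact ((fderiv ℝ f (x + θ • n x) - fderiv ℝ f x).le_opNorm (n x)).trans
          (mul_le_mul (hD x θ hθ) (hn.bound x) (norm_nonneg _) (by positivity)))
    simp only [one_smul, zero_smul, add_zero, sub_zero] at this
    rw [sub_right_comm] at this
    nlinarith [mul_nonneg (mul_nonneg ha hb) hb]
  · intro x y
    -- The difference of the remainders is an increment over `θ ∈ [0,1]`. Its derivative in `θ`
    -- splits into three terms, each at most `a b² ‖x - y‖`; hence the factor `3`.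
    have := norm_image_sub_le_of_norm_deriv_le_segment_01'
      (f := fun θ : ℝ => f (x + θ • n x) - f (y + θ • n y)
        - θ • (fderiv ℝ f x (n x) - fderiv ℝ f y (n y)))
      (f' := fun θ => fderiv ℝ f (x + θ • n x) (n x) - fderiv ℝ f (y + θ • n y) (n y)
        - (fderiv ℝ f x (n x) - fderiv ℝ f y (n y))) (C := 3 * a * b ^ 2 * ‖x - y‖)
      (fun θ _ => (((hpath x θ).sub (hpath y θ)).sub (by
        simpa using (hasDerivAt_id θ).smul_const
          (fderiv ℝ f x (n x) - fderiv ℝ f y (n y)))).hasDerivWithinAt)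
      (fun θ hθ => by
        have e : fderiv ℝ f (x + θ • n x) (n x) - fderiv ℝ f (y + θ • n y) (n y)
            - (fderiv ℝ f x (n x) - fderiv ℝ f y (n y)) =
            (fderiv ℝ f (x + θ • n x) - fderiv ℝ f x) (n x - n y)
            + (fderiv ℝ f (x + θ • n x) - fderiv ℝ f x
                - (fderiv ℝ f (y + θ • n x) - fderiv ℝ f y)) (n y)
            + (fderiv ℝ f (y + θ • n x) - fderiv ℝ f (y + θ • n y)) (n y) := by
          simp only [FunLike.coe_sub, Pi.sub_apply, map_sub]
          abel
        have h1 : ‖(fderiv ℝ f (x + θ • n x) - fderiv ℝ f x) (n x - n y)‖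
            ≤ a * b * (b * ‖x - y‖) :=
          (ContinuousLinearMap.le_opNorm _ _).trans
            (mul_le_mul (hD x θ hθ) (hn.lip x y) (norm_nonneg _) (by positivity))
        have h2 : ‖(fderiv ℝ f (x + θ • n x) - fderiv ℝ f x
                - (fderiv ℝ f (y + θ • n x) - fderiv ℝ f y)) (n y)‖ ≤ a * ‖x - y‖ * b * b :=
          (ContinuousLinearMap.le_opNorm _ _).trans
            (mul_le_mul ((hDf.second x y (θ • n x)).trans
              (mul_le_mul_of_nonneg_left (hnorm x θ hθ) (by positivity))) (hn.bound y)
              (norm_nonneg _) (by positivity))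
        have h3 : ‖(fderiv ℝ f (y + θ • n x) - fderiv ℝ f (y + θ • n y)) (n y)‖
            ≤ a * (b * ‖x - y‖) * b := by
          refine (ContinuousLinearMap.le_opNorm _ _).trans
            (mul_le_mul ((hDf.lip _ _).trans (mul_le_mul_of_nonneg_left ?_ ha)) (hn.bound y)
              (norm_nonneg _) (by positivity))
          rw [add_sub_add_left_eq_sub, ← smul_sub, norm_smul, Real.norm_eq_abs,
            abs_of_nonneg hθ.1]
          calc θ * ‖n x - n y‖ ≤ 1 * ‖n x - n y‖ := by gcongr; exact hθ.2.le
            _ ≤ b * ‖x - y‖ := by rw [one_mul]; exact hn.lip x y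
        rw [e]
        refine norm_add₃_le.trans ?_
        linarith)
    simp only [one_smul, zero_smul, add_zero, sub_zero] at this
    convert this using 2
    abel

end Calculus
-- The second order Euler scheme as an almost flow
section Euler

/-- Bounds on vector fields on `ℝ^d`: drift with two derivatives, driving fields with three. -/
structure SmoothFields {d ℓ : ℕ} (G : ℝ) (v : E d → E d) (f : Fin ℓ → E d → E d) : Prop where
  drift : BoundedLip2 G v
  field : ∀ i, BoundedLip2 G (f i)
  diff : ∀ i, Differentiable ℝ (f i)
  deriv : ∀ i, BoundedLip2 G (fderiv ℝ (f i))

/-- `H` bounds the Hölder constants of the drivers. -/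
def DriverBound {ℓ : ℕ} {p T : ℝ} (α : ℝ) (h : ℝ → ℝ) (XR : RoughPath ℓ p T) (H : ℝ) : Prop :=
  ∀ s t, 0 ≤ s → s ≤ t → t ≤ T → |h t - h s| ≤ H * (t - s) ^ α ∧
    (∀ i, |XR.X t s i| ≤ H * (t - s) ^ (1 / p)) ∧
    ∀ j k, |XR.XX t s j k| ≤ H * (t - s) ^ (2 / p)

/-- The increment `(h_t - h_s) v + X^i_{ts} f_i + 𝕏^{jk}_{ts} f_j f_k` of the second order Euler
scheme. -/
noncomputable def eulerIncr {d ℓ : ℕ} {p T : ℝ} (h : ℝ → ℝ) (XR : RoughPath ℓ p T)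
    (v : E d → E d) (f : Fin ℓ → E d → E d) (t s : ℝ) (x : E d) : E d :=
  (h t - h s) • v x + ∑ i, XR.X t s i • f i x
    + ∑ j, ∑ k, XR.XX t s j k • fderiv ℝ (f k) x (f j x)

/-- The second order Euler scheme. -/
noncomputable def eulerMap {d ℓ : ℕ} {p T : ℝ} (h : ℝ → ℝ) (XR : RoughPath ℓ p T)
    (v : E d → E d) (f : Fin ℓ → E d → E d) (t s : ℝ) (x : E d) : E d :=
  x + eulerIncr h XR v f t s x

variable {d ℓ : ℕ} {T p α : ℝ} {h : ℝ → ℝ} {XR : RoughPath ℓ p T}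

theorem exists_driverBound
    (hh : ∃ C : ℝ, ∀ s t, 0 ≤ s → s ≤ t → t ≤ T → |h t - h s| ≤ C * (t - s) ^ α)
    (XR : RoughPath ℓ p T) : ∃ H, 0 ≤ H ∧ DriverBound α h XR H := by
  obtain ⟨C, hC⟩ := hh
  obtain ⟨C', hC'⟩ := XR.holder
  refine ⟨max 0 (max C C'), le_max_left _ _, fun s t hs hst ht => ?_⟩
  have h1 : C ≤ max 0 (max C C') := (le_max_left _ _).trans (le_max_right _ _)
  have h2 : C' ≤ max 0 (max C C') := (le_max_right _ _).trans (le_max_right _ _)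
  have h0 : 0 ≤ t - s := sub_nonneg.2 hst
  exact ⟨(hC s t hs hst ht).trans (by gcongr),
    fun i => ((hC' s t hs hst ht).1 i).trans (by gcongr),
    fun j k => ((hC' s t hs hst ht).2 j k).trans (by gcongr)⟩

theorem RoughPath.X_self (XR : RoughPath ℓ p T) {s : ℝ} (hs : 0 ≤ s) (hT : s ≤ T) (i : Fin ℓ) :
    XR.X s s i = 0 := by
  have := XR.chen₁ s s s hs le_rfl le_rfl hT i
  linarith

theorem RoughPath.XX_self (XR : RoughPath ℓ p T) {s : ℝ} (hs : 0 ≤ s) (hT : s ≤ T)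
    (j k : Fin ℓ) : XR.XX s s j k = 0 := by
  have := XR.chen₂ s s s hs le_rfl le_rfl hT j k
  rw [XR.X_self hs hT] at this
  linarith

/-- The exponents of the drivers on short intervals: with `r = τ^{1/p}` and
`e = τ^α + τ^{2/p}`. -/
structure Scales (γ τ e r : ℝ) : Prop where
  e_nonneg : 0 ≤ e
  r_nonneg : 0 ≤ r
  r_le : r ≤ 1
  r_sq : r ^ 2 ≤ e
  e_le : e ≤ 2 * r
  mul_le : e * r ≤ 2 * τ ^ γ

theorem scales (hp : 2 ≤ p) (hα : 1 < α + 1 / p) {τ : ℝ} (h0 : 0 ≤ τ) (h1 : τ ≤ 1) :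
    Scales (min (3 / p) (α + 1 / p)) τ (τ ^ α + τ ^ (2 / p)) (τ ^ (1 / p)) := by
  have hp0 : 0 < p := by linarith
  have hq : 0 < 1 / p := by positivity
  have hq2 : 1 / p ≤ 1 / 2 := one_div_le_one_div_of_le (by norm_num) hp
  have e2 : 2 / p = 1 / p + 1 / p := by ring
  have e3 : 3 / p = 2 / p + 1 / p := by ring
  -- Since `1/p ≤ 1/2`, the condition `α + 1/p > 1` forces `α > 1/2`.
  have hα' : 1 / p ≤ α := by linarith
  have a1 : τ ^ α ≤ τ ^ (1 / p) :=
    Real.rpow_le_rpow_of_exponent_ge_of_imp h0 h1 hα' (fun _ h => absurd h (by linarith))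
  have a2 : τ ^ (2 / p) ≤ τ ^ (1 / p) :=
    Real.rpow_le_rpow_of_exponent_ge_of_imp h0 h1 (by linarith) (fun _ h => absurd h (by linarith))
  have n1 : 0 ≤ τ ^ α := Real.rpow_nonneg h0 _
  have n2 : 0 ≤ τ ^ (2 / p) := Real.rpow_nonneg h0 _
  refine ⟨by positivity, by positivity, Real.rpow_le_one h0 h1 hq.le, ?_, by linarith, ?_⟩
  · rw [pow_two, ← Real.rpow_add_of_nonneg h0 hq.le hq.le, ← e2]
    linarith
  · rw [add_mul, ← Real.rpow_add_of_nonneg h0 (by linarith) hq.le,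
      ← Real.rpow_add_of_nonneg h0 (by linarith) hq.le, ← e3]
    have b1 : τ ^ (α + 1 / p) ≤ τ ^ min (3 / p) (α + 1 / p) :=
      Real.rpow_le_rpow_of_exponent_ge_of_imp h0 h1 (min_le_right _ _)
        (fun _ h => absurd h (by linarith))
    have b2 : τ ^ (3 / p) ≤ τ ^ min (3 / p) (α + 1 / p) :=
      Real.rpow_le_rpow_of_exponent_ge_of_imp h0 h1 (min_le_left _ _)
        (fun _ h => absurd h (by linarith))
    linarith

/-- The drivers' increments over `[s,t]` are bounded by `H e`, `H r`, `H e`. -/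
structure IncrBound (h : ℝ → ℝ) (XR : RoughPath ℓ p T) (H e r s t : ℝ) : Prop where
  drift : |h t - h s| ≤ H * e
  first : ∀ i, |XR.X t s i| ≤ H * r
  second : ∀ j k, |XR.XX t s j k| ≤ H * e

theorem DriverBound.incr {H : ℝ} (hH : 0 ≤ H) (hb : DriverBound α h XR H) (hp : 2 ≤ p)
    (hα : 1 < α + 1 / p) {s t τ : ℝ} (hs : 0 ≤ s) (hst : s ≤ t) (ht : t ≤ T) (hτ : t - s ≤ τ) :
    IncrBound h XR H (τ ^ α + τ ^ (2 / p)) (τ ^ (1 / p)) s t := by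
  obtain ⟨h1, h2, h3⟩ := hb s t hs hst ht
  have h0 : 0 ≤ t - s := sub_nonneg.2 hst
  have hp0 : 0 < p := by linarith
  have hq2 : 1 / p ≤ 1 / 2 := one_div_le_one_div_of_le (by norm_num) hp
  have c1 : (t - s) ^ α ≤ τ ^ α := Real.rpow_le_rpow h0 hτ (by linarith)
  have c2 : (t - s) ^ (1 / p) ≤ τ ^ (1 / p) := Real.rpow_le_rpow h0 hτ (by positivity)
  have c3 : (t - s) ^ (2 / p) ≤ τ ^ (2 / p) := Real.rpow_le_rpow h0 hτ (by positivity)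
  have n1 : 0 ≤ τ ^ α := Real.rpow_nonneg (h0.trans hτ) _
  have n2 : 0 ≤ τ ^ (2 / p) := Real.rpow_nonneg (h0.trans hτ) _
  exact ⟨h1.trans (mul_le_mul_of_nonneg_left (by linarith) hH),
    fun i => (h2 i).trans (mul_le_mul_of_nonneg_left c2 hH),
    fun j k => (h3 j k).trans (mul_le_mul_of_nonneg_left (by linarith) hH)⟩

theorem SmoothFields.lie {G : ℝ} {v : E d → E d} {f : Fin ℓ → E d → E d}
    (hS : SmoothFields G v f) (j k : Fin ℓ) :
    BoundedLip2 (4 * G * G) (fun x => fderiv ℝ (f k) x (f j x)) :=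
  (hS.deriv k).clm_apply (hS.field j)

/-- Terms of order `e` are absorbed through `e ≤ 2 r`. The factor `r` makes the scheme close to the
identity on short intervals. -/
theorem eulerIncr_bound {G H e r s t : ℝ} {v : E d → E d} {f : Fin ℓ → E d → E d}
    (hG : 0 ≤ G) (hH : 0 ≤ H) (hS : SmoothFields G v f) (he : e ≤ 2 * r) (hr : 0 ≤ r)
    (he0 : 0 ≤ e) (hI : IncrBound h XR H e r s t) :
    BoundedLip (H * (G + 4 * G * G) * (2 + ℓ + 2 * ℓ ^ 2) * r) (eulerIncr h XR v f t s) ∧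
    SecondDiff (H * (G + 4 * G * G) * (2 + ℓ + 2 * ℓ ^ 2) * r) (eulerIncr h XR v f t s) := by
  have key : H * e * G + ∑ _i : Fin ℓ, H * r * G +
      ∑ _j : Fin ℓ, ∑ _k : Fin ℓ, H * e * (4 * G * G) ≤
      H * (G + 4 * G * G) * (2 + ℓ + 2 * ℓ ^ 2) * r := by
    simp only [Finset.sum_const, Finset.card_univ, Fintype.card_fin, nsmul_eq_mul]
    have h1 : H * e * G ≤ H * (2 * r) * (G + 4 * G * G) := by gcongr; nlinarith
    have h2 : H * r * G ≤ H * r * (G + 4 * G * G) := by gcongr; nlinarith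
    have h3 : H * e * (4 * G * G) ≤ H * (2 * r) * (G + 4 * G * G) := by gcongr; nlinarith
    have h2' := mul_le_mul_of_nonneg_left h2 (Nat.cast_nonneg (α := ℝ) ℓ)
    have h3' := mul_le_mul_of_nonneg_left h3 (sq_nonneg (ℓ : ℝ))
    linarith
  refine ⟨BoundedLip.mono (((hS.drift.toBoundedLip.smul hI.drift).add
      (BoundedLip.sum _ fun i _ => (hS.field i).toBoundedLip.smul (hI.first i))).add
      (BoundedLip.sum _ fun j _ => BoundedLip.sum _ fun k _ =>
        (hS.lie j k).toBoundedLip.smul (hI.second j k))) key,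
    SecondDiff.mono (((hS.drift.second.smul hI.drift).add
      (SecondDiff.sum _ fun i _ => (hS.field i).second.smul (hI.first i))).add
      (SecondDiff.sum _ fun j _ => SecondDiff.sum _ fun k _ =>
        (hS.lie j k).second.smul (hI.second j k))) key⟩

theorem eulerMap_self {v : E d → E d} {f : Fin ℓ → E d → E d} {s : ℝ} (hs : 0 ≤ s) (hT : s ≤ T)
    (x : E d) : eulerMap h XR v f s s x = x := by
  simp [eulerMap, eulerIncr, XR.X_self hs hT, XR.XX_self hs hT]

/-- Chen's relations for the Euler scheme. -/
theorem eulerMap_comp {v : E d → E d} {f : Fin ℓ → E d → E d} {s u t : ℝ} (hs : 0 ≤ s)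
    (hsu : s ≤ u) (hut : u ≤ t) (ht : t ≤ T) (x : E d) :
    eulerMap h XR v f t u (eulerMap h XR v f u s x) - eulerMap h XR v f t s x =
      (h t - h u) • (v (x + eulerIncr h XR v f u s x) - v x)
      + ∑ k, XR.X t u k • (((f k) (x + eulerIncr h XR v f u s x) - f k x
            - fderiv ℝ (f k) x (eulerIncr h XR v f u s x))
          + fderiv ℝ (f k) x ((h u - h s) • v x
            + ∑ i, ∑ j, XR.XX u s i j • fderiv ℝ (f j) x (f i x)))
      + ∑ j, ∑ k, XR.XX t u j k •
          (fderiv ℝ (f k) (x + eulerIncr h XR v f u s x) (f j (x + eulerIncr h XR v f u s x))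
            - fderiv ℝ (f k) x (f j x)) := by
  -- Only the part `X^j_{us} f_j` of the increment produces, against `X_{tu}`, the cross term of
  -- Chen's relation for `𝕏`. The rest is already of order `e` and stays in the remainder.
  have hk : ∀ k, fderiv ℝ (f k) x (eulerIncr h XR v f u s x) =
      fderiv ℝ (f k) x ((h u - h s) • v x
        + ∑ i, ∑ j, XR.XX u s i j • fderiv ℝ (f j) x (f i x))
      + ∑ j, XR.X u s j • fderiv ℝ (f k) x (f j x) := by
    intro k
    simp only [eulerIncr, map_add, map_sum, map_smul]
    abel
  simp only [hk]
  set n := eulerIncr h XR v f u s x with hn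
  have e1 : ∑ k, XR.X t u k • (((f k) (x + n) - f k x - (fderiv ℝ (f k) x ((h u - h s) • v x
        + ∑ i, ∑ j, XR.XX u s i j • fderiv ℝ (f j) x (f i x))
      + ∑ j, XR.X u s j • fderiv ℝ (f k) x (f j x))) + fderiv ℝ (f k) x ((h u - h s) • v x
            + ∑ i, ∑ j, XR.XX u s i j • fderiv ℝ (f j) x (f i x))) =
      ∑ k, XR.X t u k • f k (x + n) - ∑ k, XR.X t u k • f k x
        - ∑ j, ∑ k, (XR.X u s j * XR.X t u k) • fderiv ℝ (f k) x (f j x) := by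
    have swap : ∑ j, ∑ k, (XR.X u s j * XR.X t u k) • fderiv ℝ (f k) x (f j x) =
        ∑ k, ∑ j, (XR.X u s j * XR.X t u k) • fderiv ℝ (f k) x (f j x) := Finset.sum_comm
    rw [swap, ← Finset.sum_sub_distrib, ← Finset.sum_sub_distrib]
    refine Finset.sum_congr rfl fun k _ => ?_
    have : ∑ j, (XR.X u s j * XR.X t u k) • fderiv ℝ (f k) x (f j x) =
        XR.X t u k • ∑ j, XR.X u s j • fderiv ℝ (f k) x (f j x) := by
      rw [Finset.smul_sum]
      exact Finset.sum_congr rfl fun j _ => by rw [smul_smul, mul_comm]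
    rw [this, ← smul_sub, ← smul_sub]
    congr 1
    abel
  rw [e1]
  have e2 : eulerIncr h XR v f t s x = n + (h t - h u) • v x + ∑ k, XR.X t u k • f k x
      + ∑ j, ∑ k, XR.XX t u j k • fderiv ℝ (f k) x (f j x)
      + ∑ j, ∑ k, (XR.X u s j * XR.X t u k) • fderiv ℝ (f k) x (f j x) := by
    have hX : ∑ k, XR.X t s k • f k x = ∑ k, XR.X u s k • f k x + ∑ k, XR.X t u k • f k x := by
      rw [← Finset.sum_add_distrib]
      exact Finset.sum_congr rfl fun k _ => by rw [XR.chen₁ s u t hs hsu hut ht, add_smul]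
    have hXX : ∑ j, ∑ k, XR.XX t s j k • fderiv ℝ (f k) x (f j x) =
        ∑ j, ∑ k, XR.XX u s j k • fderiv ℝ (f k) x (f j x)
        + ∑ j, ∑ k, XR.XX t u j k • fderiv ℝ (f k) x (f j x)
        + ∑ j, ∑ k, (XR.X u s j * XR.X t u k) • fderiv ℝ (f k) x (f j x) := by
      simp only [← Finset.sum_add_distrib]
      exact Finset.sum_congr rfl fun j _ => Finset.sum_congr rfl fun k _ => by
        rw [XR.chen₂ s u t hs hsu hut ht, add_smul, add_smul]
    have hh : h t - h s = (h u - h s) + (h t - h u) := by ring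
    rw [hn, eulerIncr, eulerIncr, hX, hXX, hh, add_smul]
    abel
  have e3 : eulerMap h XR v f t u (eulerMap h XR v f u s x) = x + n + ((h t - h u) • v (x + n)
      + ∑ k, XR.X t u k • f k (x + n)
      + ∑ j, ∑ k, XR.XX t u j k • fderiv ℝ (f k) (x + n) (f j (x + n))) := rfl
  have e4 : eulerMap h XR v f t s x = x + eulerIncr h XR v f t s x := rfl
  rw [e3, e4, e2]
  simp only [smul_sub, Finset.sum_sub_distrib]
  abel

theorem eulerMap_defect {G H e r s u t : ℝ} {v : E d → E d} {f : Fin ℓ → E d → E d}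
    (hG : 0 ≤ G) (hH : 0 ≤ H) (hS : SmoothFields G v f) (he : e ≤ 2 * r) (hr : 0 ≤ r)
    (he0 : 0 ≤ e) (hre : r ^ 2 ≤ e) (hs : 0 ≤ s) (hsu : s ≤ u) (hut : u ≤ t) (ht : t ≤ T)
    (hI : IncrBound h XR H e r s u) (hI' : IncrBound h XR H e r u t) {A : ℝ}
    (hA : A = H * (G + 4 * G * G) * (2 + ℓ + 2 * ℓ ^ 2)) :
    BoundedLip ((H * (2 * G * A) + ℓ * (H * (3 * G * A ^ 2
        + 2 * G * (H * G + ℓ * (ℓ * (H * (4 * G * G))))))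
        + ℓ * (ℓ * (H * (2 * (4 * G * G) * A)))) * (e * r))
      (fun x => eulerMap h XR v f t u (eulerMap h XR v f u s x) - eulerMap h XR v f t s x) := by
  have hn := (eulerIncr_bound hG hH hS he hr he0 hI).1
  rw [← hA] at hn
  have hA0 : 0 ≤ A := by rw [hA]; positivity
  simp only [eulerMap_comp hs hsu hut ht]
  have hrem : BoundedLip (H * e * G + ∑ _i : Fin ℓ, ∑ _j : Fin ℓ, H * e * (4 * G * G))
      (fun x => (h u - h s) • v x + ∑ i, ∑ j, XR.XX u s i j • fderiv ℝ (f j) x (f i x)) :=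
    (hS.drift.toBoundedLip.smul hI.drift).add (BoundedLip.sum _ fun j _ => BoundedLip.sum _
      fun k _ => (hS.lie j k).toBoundedLip.smul (hI.second j k))
  -- All terms have order `e r`: drift and `𝕏` terms are `e` times a displacement of order `r`, the
  -- terms with `X` are `r` times either a Taylor remainder of order `r² ≤ e` or the second order
  -- part of the increment.
  refine BoundedLip.mono ((((hS.drift.comp_add_sub hn).smul hI'.drift).add
    (BoundedLip.sum _ fun k _ => (((hS.deriv k).taylor (hS.diff k) hn).add
      ((hS.deriv k).toBoundedLip.clm_apply hrem)).smul (hI'.first k))).add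
    (BoundedLip.sum _ fun j _ => BoundedLip.sum _ fun k _ =>
      ((hS.lie j k).comp_add_sub hn).smul (hI'.second j k))) ?_
  simp only [Finset.sum_const, Finset.card_univ, Fintype.card_fin, nsmul_eq_mul]
  have h1 : (ℓ : ℝ) * (H * r * (3 * G * (A * r) ^ 2)) ≤
      ℓ * (H * (3 * G * A ^ 2) * (e * r)) := by
    have : r * r ^ 2 ≤ r * e := mul_le_mul_of_nonneg_left hre hr
    have h2 : 0 ≤ (ℓ : ℝ) * (H * (3 * G * A ^ 2)) := by positivity
    calc _ = (ℓ : ℝ) * (H * (3 * G * A ^ 2)) * (r * r ^ 2) := by ring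
      _ ≤ (ℓ : ℝ) * (H * (3 * G * A ^ 2)) * (r * e) := mul_le_mul_of_nonneg_left this h2
      _ = _ := by ring
  linarith

/-- The Euler scheme is an almost flow, with constants depending only on the bounds of the
fields and of the drivers. -/
theorem exists_almostFlow_euler {G H : ℝ} (hp : 2 ≤ p) (hα : 1 < α + 1 / p) (hG : 0 ≤ G)
    (hH : 0 ≤ H) (hb : DriverBound α h XR H) :
    ∃ A c, 0 ≤ A ∧ 0 ≤ c ∧ ∀ δ κ : ℝ, 0 ≤ δ → δ ≤ 1 → A * δ ^ (1 / p) ≤ κ →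
      ∀ (v : E d → E d) (f : Fin ℓ → E d → E d), SmoothFields G v f →
        AlmostFlow T δ κ c (min (3 / p) (α + 1 / p)) (eulerMap h XR v f) := by
  set A := H * (G + 4 * G * G) * (2 + ℓ + 2 * ℓ ^ 2) with hA
  set c := (H * (2 * G * A) + ℓ * (H * (3 * G * A ^ 2
        + 2 * G * (H * G + ℓ * (ℓ * (H * (4 * G * G))))))
        + ℓ * (ℓ * (H * (2 * (4 * G * G) * A)))) with hc
  have hA0 : 0 ≤ A := by positivity
  have hc0 : 0 ≤ c := by positivity
  -- The `2` comes from `e r ≤ 2 τ^γ`.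
  refine ⟨A, c * 2, hA0, by positivity, fun δ κ hδ0 hδ1 hκ v f hS => ?_⟩
  have hincr : ∀ s t, 0 ≤ s → s ≤ t → t ≤ T → t - s ≤ δ →
      BoundedLip κ (eulerIncr h XR v f t s) ∧ SecondDiff κ (eulerIncr h XR v f t s) := by
    intro s t hs hst ht hτ
    have sc := scales (τ := δ) hp hα hδ0 hδ1
    have := eulerIncr_bound hG hH hS sc.e_le sc.r_nonneg sc.e_nonneg
      (hb.incr hH hp hα hs hst ht hτ)
    exact ⟨this.1.mono hκ, this.2.mono hκ⟩
  refine ⟨fun s hs ht x => eulerMap_self hs ht x, ?_, ?_, ?_⟩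
  · intro s t hs hst ht hτ x y
    have := (hincr s t hs hst ht hτ).1.lip x y
    simp only [eulerMap]
    convert this using 2
    abel
  · intro s t hs hst ht hτ x y w
    have := (hincr s t hs hst ht hτ).2 x y w
    simp only [eulerMap]
    convert this using 2
    abel
  · intro s u t hs hsu hut ht hτ
    have sc := scales (τ := t - s) hp hα (by linarith) (by linarith)
    refine BoundedLip.mono (eulerMap_defect hG hH hS sc.e_le sc.r_nonneg sc.e_nonneg sc.r_sq
      hs hsu hut ht (hb.incr hH hp hα hs hsu (hut.trans ht) (by linarith))
      (hb.incr hH hp hα (hs.trans hsu) hut ht (by linarith)) hA) ?_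
    rw [mul_assoc c]
    exact mul_le_mul_of_nonneg_left sc.mul_le hc0

theorem exists_pos_mul_rpow_le (B : ℝ) {a κ : ℝ} (ha : 0 < a) (hκ : 0 < κ) :
    ∀ᶠ δ in 𝓝[>] (0 : ℝ), B * δ ^ a ≤ κ := by
  have h1 : Tendsto (fun δ : ℝ => B * δ ^ a) (𝓝 0) (𝓝 (B * 0 ^ a)) :=
    ((Real.continuousAt_rpow_const 0 a (Or.inr ha.le)).tendsto).const_mul B
  rw [Real.zero_rpow ha.ne', mul_zero] at h1
  exact ((h1.mono_left nhdsWithin_le_nhds).eventually (gt_mem_nhds hκ)).mono fun _ h => h.le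

/-- Flows close to the Euler scheme exist, with constants depending only on the bounds of the
fields and of the drivers. -/
theorem exists_flow_euler {G H : ℝ} (hp : 2 ≤ p) (hp3 : p < 3) (hα : 1 < α + 1 / p) (hG : 0 ≤ G)
    (hH : 0 ≤ H) (hb : DriverBound α h XR H) :
    ∃ C δ, 0 ≤ C ∧ 0 < δ ∧ ∀ (v : E d → E d) (f : Fin ℓ → E d → E d), SmoothFields G v f →
      ∃ φ : ℝ → ℝ → E d → E d, IsFlow T φ ∧
      (∀ s t, 0 ≤ s → s ≤ t → t ≤ T → t - s ≤ δ →
        ∀ x, ‖φ t s x - eulerMap h XR v f t s x‖ ≤ C * (t - s) ^ (min (3 / p) (α + 1 / p))) ∧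
      ∃ K, 0 ≤ K ∧ ∀ s t, 0 ≤ s → s ≤ t → t ≤ T → ∀ x y,
        ‖φ t s x - φ t s y‖ ≤ K * ‖x - y‖ := by
  obtain ⟨A, c, hA0, hc0, hAF⟩ := exists_almostFlow_euler (d := d) hp hα hG hH hb
  set γ := min (3 / p) (α + 1 / p) with hγdef
  have hp0 : 0 < p := by linarith
  have hγ : 1 < γ := lt_min ((one_lt_div hp0).2 hp3) hα
  have hhalf : 2 * (1 / 2 : ℝ) ^ γ < 1 := by
    have : (1 / 2 : ℝ) ^ γ < (1 / 2) ^ (1 : ℝ) :=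
      Real.rpow_lt_rpow_of_exponent_gt (by norm_num) (by norm_num) hγ
    rw [Real.rpow_one] at this
    linarith
  -- At `κ = 0` the halving factor is `2 · 2^{-γ} < 1`, because `γ > 1`; it stays below `1` for
  -- small `κ`.
  obtain ⟨κ, ⟨hκlt, hκ1⟩, hκ0⟩ : ∃ κ : ℝ, ((1 + 3 * κ) ^ 2 * 2 * (1 / 2) ^ γ < 1 ∧ κ ≤ 1) ∧
      0 < κ := by
    have h1 : Tendsto (fun κ : ℝ => (1 + 3 * κ) ^ 2 * 2 * (1 / 2 : ℝ) ^ γ) (𝓝[>] 0)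
        (𝓝 ((1 + 3 * 0) ^ 2 * 2 * (1 / 2) ^ γ)) :=
      (Continuous.tendsto (by fun_prop) 0).mono_left nhdsWithin_le_nhds
    have h2 : ∀ᶠ κ in 𝓝[>] (0 : ℝ), (1 + 3 * κ) ^ 2 * 2 * (1 / 2 : ℝ) ^ γ < 1 :=
      h1.eventually (gt_mem_nhds (by simpa using hhalf))
    have h3 : ∀ᶠ κ in 𝓝[>] (0 : ℝ), κ ≤ 1 :=
      mem_nhdsWithin_of_mem_nhds (Iic_mem_nhds one_pos)
    exact ((h2.and h3).and self_mem_nhdsWithin).exists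
  set θ := (1 + 3 * κ) ^ 2 * 2 * (1 / 2 : ℝ) ^ γ with hθ
  have hθ0 : 0 ≤ θ := by positivity
  have hθ1 : 0 < 1 - θ := by linarith
  -- Equality case of the halving condition `θ C + 5 c ≤ C`. Neither `C` nor `δ` depends on the
  -- individual fields, which later gives uniformity along the filter.
  set C := 5 * c / (1 - θ) with hC
  have hCeq : C * (1 - θ) = 5 * c := div_mul_cancel₀ _ hθ1.ne'
  have hC0 : 0 ≤ C := by positivity
  have hcC : c ≤ C := by nlinarith [mul_nonneg hC0 hθ0]
  obtain ⟨δ, ⟨⟨hδ1, hδ2⟩, hδ3⟩, hδ0⟩ : ∃ δ : ℝ,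
      ((A * δ ^ (1 / p) ≤ κ ∧ 5 * C * δ ^ γ ≤ κ) ∧ δ ≤ 1) ∧ 0 < δ :=
    ((((exists_pos_mul_rpow_le A (by positivity) hκ0).and
      (exists_pos_mul_rpow_le (5 * C) (by linarith) hκ0)).and
      (mem_nhdsWithin_of_mem_nhds (Iic_mem_nhds one_pos))).and self_mem_nhdsWithin).exists
  refine ⟨C, δ, hC0, hδ0, fun v f hS => ?_⟩
  exact (hAF δ κ hδ0.le hδ3 hδ1 v f hS).exists_flow hκ0.le hκ1 hc0 hcC hγ (by linarith) hδ0 hδ2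

end Euler
-- Continuity of path-dependent fields and Picard iteration
section Paths

variable {d : ℕ} {T : ℝ}

theorem stopped_apply {a : ℝ} (ha : 0 ≤ a) (y : Pth d a) (t : Icc (0 : ℝ) T) :
    stopped T ha y t = y (projIcc 0 a ha t) := rfl

theorem seg_zero (y : C(ℝ, E d)) : seg y 0 = cst 0 (y 0) := by
  ext1 t
  have : (t : ℝ) = 0 := le_antisymm t.2.2 t.2.1
  simp [this]

theorem norm_cst_le (a : ℝ) (x : E d) : ‖(cst a x : Pth d a)‖ ≤ ‖x‖ :=
  (ContinuousMap.norm_le _ (norm_nonneg x)).2 (fun _ => le_rfl)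

theorem norm_cstL_le (a : ℝ) : ‖cstL d a‖ ≤ 1 :=
  LinearMap.mkContinuous_norm_le _ zero_le_one _

theorem norm_stopped_sub_le {a : ℝ} (ha : 0 ≤ a) (y z : Pth d a) :
    ‖stopped T ha y - stopped T ha z‖ ≤ ‖y - z‖ :=
  (ContinuousMap.norm_le _ (norm_nonneg _)).2 fun t =>
    ContinuousMap.norm_coe_le_norm (y - z) (projIcc 0 a ha t)

theorem norm_stopped_add_cst_sub_le {a b : ℝ} (ha : 0 ≤ a) (hb : 0 ≤ b) (y : Pth d a)
    (z : Pth d b) (v w : E d) :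
    ‖stopped T ha (y + cst a v) - stopped T hb (z + cst b w)‖ ≤
      ‖stopped T ha y - stopped T hb z‖ + ‖v - w‖ := by
  refine (ContinuousMap.norm_le _ (by positivity)).2 fun t => ?_
  have e : (stopped T ha (y + cst a v) - stopped T hb (z + cst b w)) t =
      (stopped T ha y - stopped T hb z) t + (v - w) := by
    simp only [ContinuousMap.sub_apply, stopped_apply, ContinuousMap.add_apply,
      ContinuousMap.const_apply]
    abel
  rw [e]
  exact (norm_add_le _ _).trans (add_le_add_left (ContinuousMap.norm_coe_le_norm _ t) _)

theorem norm_stopped_seg_sub_le {u ρ : ℝ} (hu : 0 ≤ u) (hρ : 0 ≤ ρ) (y : C(ℝ, E d))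
    (h : ∀ r ∈ Icc 0 u, ‖y r - y 0‖ ≤ ρ) :
    ‖stopped T hu (seg y u) - stopped T le_rfl (seg y 0)‖ ≤ ρ := by
  refine (ContinuousMap.norm_le _ hρ).2 fun t => ?_
  rw [seg_zero]
  exact h _ (projIcc 0 u hu t).2

theorem abs_projIcc_sub_le {a b : ℝ} (ha : 0 ≤ a) (hb : 0 ≤ b) (t : ℝ) :
    |(projIcc 0 a ha t : ℝ) - projIcc 0 b hb t| ≤ |a - b| := by
  simp only [coe_projIcc]
  refine (abs_max_sub_max_le_max _ _ _ _).trans ?_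
  rw [sub_self, abs_zero]
  refine max_le (abs_nonneg _) ((abs_min_sub_min_le_max _ _ _ _).trans ?_)
  rw [sub_self, abs_zero]
  exact max_le le_rfl (abs_nonneg _)

theorem exists_stopped_seg_lt (y : C(ℝ, E d)) {ε : ℝ} (hε : 0 < ε) :
    ∃ δ > 0, ∀ (a : ℝ) (ha : a ∈ Icc 0 T) (b : ℝ) (hb : b ∈ Icc 0 T), |b - a| < δ →
      ‖stopped T ha.1 (seg y a) - stopped T hb.1 (seg y b)‖ < ε := by
  have huc := (isCompact_Icc (a := (0 : ℝ)) (b := T)).uniformContinuousOn_of_continuous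
    y.continuous.continuousOn
  obtain ⟨δ, hδ, h⟩ := Metric.uniformContinuousOn_iff.1 huc (ε / 2) (half_pos hε)
  refine ⟨δ, hδ, fun a ha b hb hab => ?_⟩
  refine lt_of_le_of_lt ((ContinuousMap.norm_le _ (half_pos hε).le).2 fun t => ?_)
    (half_lt_self hε)
  have hA := (projIcc 0 a ha.1 (t : ℝ)).2
  have hB := (projIcc 0 b hb.1 (t : ℝ)).2
  have := h _ ⟨hA.1, hA.2.trans ha.2⟩ _ ⟨hB.1, hB.2.trans hb.2⟩
    ((abs_projIcc_sub_le ha.1 hb.1 t).trans_lt (by rwa [abs_sub_comm]))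
  rw [dist_eq_norm] at this
  exact this.le

/-- Strong Lipschitz continuity with constant `M` and boundedness by `M`. -/
structure PathDrift (T M : ℝ) (V : PField d) : Prop where
  lip : ∀ (a : ℝ) (ha : a ∈ Icc 0 T) (b : ℝ) (hb : b ∈ Icc 0 T) (y : Pth d a) (z : Pth d b),
    ‖V a y - V b z‖ ≤ M * ‖stopped T ha.1 y - stopped T hb.1 z‖
  bound : ∀ a ∈ Icc 0 T, ∀ y, ‖V a y‖ ≤ M

theorem PathDrift.lip_same {M : ℝ} {V : PField d} (hV : PathDrift T M V) (hM : 0 ≤ M) {a : ℝ}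
    (ha : a ∈ Icc 0 T) (y z : Pth d a) : ‖V a y - V a z‖ ≤ M * ‖y - z‖ :=
  (hV.lip a ha a ha y z).trans (mul_le_mul_of_nonneg_left (norm_stopped_sub_le ha.1 y z) hM)

/-- The shift by the constant path `c u` is there for the difference quotients that approximate
Fréchet derivatives. -/
theorem PathDrift.continuousOn {M : ℝ} {V : PField d} (hV : PathDrift T M V) (y : C(ℝ, E d))
    {c : ℝ → E d} (hc : ContinuousOn c (Icc 0 T)) :
    ContinuousOn (fun u => V u (seg y u + cst u (c u))) (Icc 0 T) := by
  rw [Metric.continuousOn_iff]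
  intro b hb ε hε
  obtain ⟨η, hη, hηε⟩ : ∃ η > 0, M * (η + η) < ε := by
    refine ⟨ε / (4 * (|M| + 1)), by positivity, ?_⟩
    have h1 : M * (ε / (4 * (|M| + 1)) + ε / (4 * (|M| + 1))) ≤
        |M| * (ε / (4 * (|M| + 1)) + ε / (4 * (|M| + 1))) :=
      mul_le_mul_of_nonneg_right (le_abs_self M) (by positivity)
    refine h1.trans_lt ?_
    have h2 : |M| / (|M| + 1) ≤ 1 := (div_le_one (by positivity)).2 (by linarith)
    calc _ = |M| / (|M| + 1) * (ε / 2) := by field_simp; ring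
      _ ≤ 1 * (ε / 2) := by gcongr
      _ < ε := by linarith
  obtain ⟨δ₁, hδ₁, h1⟩ := exists_stopped_seg_lt (T := T) y hη
  obtain ⟨δ₂, hδ₂, h2⟩ := Metric.continuousOn_iff.1 hc b hb η hη
  refine ⟨min δ₁ δ₂, lt_min hδ₁ hδ₂, fun a ha hab => ?_⟩
  have k1 := h1 a ha b hb (by
    rw [abs_sub_comm, ← Real.dist_eq]; exact hab.trans_le (min_le_left _ _))
  have k2 := h2 a ha (hab.trans_le (min_le_right _ _))
  rw [dist_eq_norm] at k2 ⊢
  have k3 := norm_stopped_add_cst_sub_le (T := T) ha.1 hb.1 (seg y a) (seg y b) (c a) (c b)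
  have k4 := hV.lip a ha b hb (seg y a + cst a (c a)) (seg y b + cst b (c b))
  by_cases hM : 0 ≤ M
  · exact k4.trans_lt ((mul_le_mul_of_nonneg_left (by linarith) hM).trans_lt hηε)
  · exact (k4.trans (mul_nonpos_of_nonpos_of_nonneg (by linarith) (norm_nonneg _))).trans_lt hε

theorem PathDrift.continuousOn_seg {M : ℝ} {V : PField d} (hV : PathDrift T M V)
    (y : C(ℝ, E d)) : ContinuousOn (fun u => V u (seg y u)) (Icc 0 T) := by
  have := hV.continuousOn y (c := fun _ => 0) continuousOn_const
  refine this.congr fun u _ => ?_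
  congr 1
  ext1 t
  simp

/-- A field with a bounded Lipschitz Fréchet derivative. -/
structure PathField (T M : ℝ) (V : PField d) : Prop extends PathDrift T M V where
  diff : ∀ a ∈ Icc 0 T, Differentiable ℝ (V a)
  dbound : ∀ a ∈ Icc 0 T, ∀ y, ‖fderiv ℝ (V a) y‖ ≤ M
  dlip : ∀ a ∈ Icc 0 T, ∀ y z, ‖fderiv ℝ (V a) y - fderiv ℝ (V a) z‖ ≤ M * ‖y - z‖

theorem hasDerivAt_along {V : PField d} {a : ℝ} {y : Pth d a}
    (hV : DifferentiableAt ℝ (V a) y) (w : Pth d a) :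
    HasDerivAt (fun ε : ℝ => V a (y + ε • w)) (fderiv ℝ (V a) y w) 0 := by
  have h1 : HasDerivAt (fun ε : ℝ => y + ε • w) w 0 := by
    simpa using ((hasDerivAt_id (0 : ℝ)).smul_const w).const_add y
  refine HasFDerivAt.comp_hasDerivAt (0 : ℝ) ?_ h1
  have e : y + (0 : ℝ) • w = y := by ext1 t; simp
  rw [e]
  exact hV.hasFDerivAt

theorem along_eq {V W : PField d} {a : ℝ} {y : Pth d a} (hW : DifferentiableAt ℝ (W a) y) :
    along V W a y = fderiv ℝ (W a) y (cst a (V a y)) :=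
  (hasDerivAt_along hW _).deriv

/-- A quadratic remainder whose constant does not depend on the length `a`, so that difference
quotients converge uniformly in `a`. -/
theorem PathField.quotient_le {M : ℝ} {V : PField d} (hV : PathField T M V) (hM : 0 ≤ M) {a : ℝ}
    (ha : a ∈ Icc 0 T) (y w : Pth d a) :
    ‖V a (y + w) - V a y - fderiv ℝ (V a) y w‖ ≤ M * ‖w‖ * ‖w‖ := by
  have := (convex_segment y (y + w)).norm_image_sub_le_of_norm_fderiv_le'
    (φ := fderiv ℝ (V a) y) (C := M * ‖w‖) (fun z _ => hV.diff a ha z) (fun z hz => ?_)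
    (left_mem_segment ℝ y (y + w)) (right_mem_segment ℝ y (y + w))
  · simpa using this
  · refine (hV.dlip a ha z y).trans (mul_le_mul_of_nonneg_left ?_ hM)
    rw [segment_eq_image'] at hz
    obtain ⟨θ, hθ, rfl⟩ := hz
    simp only [add_sub_cancel_left, norm_smul, Real.norm_eq_abs, abs_of_nonneg hθ.1]
    exact mul_le_of_le_one_left (norm_nonneg _) hθ.2

/-- The derivatives at different `u` live on different spaces, so their continuity in `u` is not
part of the Fréchet regularity. They are uniform limits of difference quotients, which are
continuous in `u` by strong Lipschitz continuity. -/
theorem PathField.continuousOn_fderiv {M : ℝ} {V : PField d} (hV : PathField T M V)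
    (hM : 0 ≤ M) (y : C(ℝ, E d)) {c : ℝ → E d} (hc : ContinuousOn c (Icc 0 T)) {B : ℝ}
    (hB : ∀ u ∈ Icc 0 T, ‖c u‖ ≤ B) :
    ContinuousOn (fun u => fderiv ℝ (V u) (seg y u) (cst u (c u))) (Icc 0 T) := by
  have hlim : TendstoUniformlyOn
      (fun (ε : ℝ) u => ε⁻¹ • (V u (seg y u + cst u (ε • c u)) - V u (seg y u)))
      (fun u => fderiv ℝ (V u) (seg y u) (cst u (c u))) (𝓝[>] 0) (Icc 0 T) := by
    rw [Metric.tendstoUniformlyOn_iff]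
    intro η hη
    have h1 : Tendsto (fun ε : ℝ => ε * (M * B * B)) (𝓝[>] 0) (𝓝 (0 * (M * B * B))) :=
      (Continuous.tendsto (by fun_prop) 0).mono_left nhdsWithin_le_nhds
    rw [zero_mul] at h1
    filter_upwards [h1.eventually (gt_mem_nhds hη), self_mem_nhdsWithin] with ε hε hε0 u hu
    have hε0 : 0 < ε := hε0
    refine lt_of_le_of_lt ?_ hε
    have k := hV.quotient_le hM hu (seg y u) (cst u (ε • c u))
    have k2 : ‖(cst u (ε • c u) : Pth d u)‖ ≤ ε * B := by
      refine (norm_cst_le _ _).trans ?_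
      rw [norm_smul, Real.norm_eq_abs, abs_of_pos hε0]
      exact mul_le_mul_of_nonneg_left (hB u hu) hε0.le
    have e : (cst u (ε • c u) : Pth d u) = ε • cst u (c u) := rfl
    rw [dist_comm, dist_eq_norm]
    have e2 : ε⁻¹ • (V u (seg y u + cst u (ε • c u)) - V u (seg y u))
        - fderiv ℝ (V u) (seg y u) (cst u (c u)) =
        ε⁻¹ • (V u (seg y u + cst u (ε • c u)) - V u (seg y u)
          - fderiv ℝ (V u) (seg y u) (cst u (ε • c u))) := by
      rw [e, map_smul, smul_sub ε⁻¹ _ (ε • _), smul_smul, inv_mul_cancel₀ hε0.ne', one_smul]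
    rw [e2, norm_smul, norm_inv, Real.norm_eq_abs, abs_of_pos hε0, inv_mul_le_iff₀ hε0]
    refine k.trans ?_
    have hn := norm_nonneg (cst u (ε • c u) : Pth d u)
    calc M * ‖(cst u (ε • c u) : Pth d u)‖ * ‖(cst u (ε • c u) : Pth d u)‖
        ≤ M * (ε * B) * (ε * B) :=
          mul_le_mul (mul_le_mul_of_nonneg_left k2 hM) k2 hn (mul_nonneg hM (hn.trans k2))
      _ = ε * (ε * (M * B * B)) := by ring
  refine hlim.continuousOn (Eventually.frequently (Eventually.of_forall fun ε => ?_))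
  exact ((hV.continuousOn y (hc.const_smul ε)).sub (hV.continuousOn_seg y)).const_smul ε⁻¹

theorem PathField.continuousOn_bracket {M : ℝ} {V W : PField d} (hV : PathField T M V)
    (hW : PathField T M W) (hM : 0 ≤ M) (y : C(ℝ, E d)) :
    ContinuousOn (fun u => bracket V W u (seg y u)) (Icc 0 T) := by
  have h1 := hW.continuousOn_fderiv hM y (hV.continuousOn_seg y) (fun u hu => hV.bound u hu _)
  have h2 := hV.continuousOn_fderiv hM y (hW.continuousOn_seg y) (fun u hu => hW.bound u hu _)
  refine (h1.sub h2).congr fun u hu => ?_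
  simp only [bracket]
  rw [along_eq (hW.diff u hu _), along_eq (hV.diff u hu _)]
  rfl

theorem PathField.norm_along_le {M : ℝ} {V W : PField d} (hV : PathField T M V)
    (hW : PathField T M W) (hM : 0 ≤ M) {a : ℝ} (ha : a ∈ Icc 0 T) (y : Pth d a) :
    ‖along V W a y‖ ≤ M * M := by
  rw [along_eq (hW.diff a ha y)]
  exact (ContinuousLinearMap.le_opNorm _ _).trans (mul_le_mul (hW.dbound a ha y)
    ((norm_cst_le _ _).trans (hV.bound a ha y)) (norm_nonneg _) hM)

theorem PathField.along_lip {M : ℝ} {V W : PField d} (hV : PathField T M V)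
    (hW : PathField T M W) (hM : 0 ≤ M) {a : ℝ} (ha : a ∈ Icc 0 T) (y z : Pth d a) :
    ‖along V W a y - along V W a z‖ ≤ 2 * M * M * ‖y - z‖ := by
  rw [along_eq (hW.diff a ha y), along_eq (hW.diff a ha z)]
  have e : fderiv ℝ (W a) y (cst a (V a y)) - fderiv ℝ (W a) z (cst a (V a z)) =
      (fderiv ℝ (W a) y - fderiv ℝ (W a) z) (cst a (V a y))
      + fderiv ℝ (W a) z (cst a (V a y - V a z)) := by
    have : (cst a (V a y - V a z) : Pth d a) = cst a (V a y) - cst a (V a z) := rfl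
    rw [this, map_sub]
    simp
  rw [e]
  have h1 : ‖(fderiv ℝ (W a) y - fderiv ℝ (W a) z) (cst a (V a y))‖ ≤ M * ‖y - z‖ * M :=
    (ContinuousLinearMap.le_opNorm _ _).trans (mul_le_mul (hW.dlip a ha y z)
      ((norm_cst_le _ _).trans (hV.bound a ha y)) (norm_nonneg _) (by positivity))
  have h2 : ‖fderiv ℝ (W a) z (cst a (V a y - V a z))‖ ≤ M * (M * ‖y - z‖) :=
    (ContinuousLinearMap.le_opNorm _ _).trans (mul_le_mul (hW.dbound a ha z)
      ((norm_cst_le _ _).trans (hV.lip_same hM ha y z)) (norm_nonneg _) hM)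
  refine (norm_add_le _ _).trans ?_
  linarith

theorem PathField.norm_bracket_le {M : ℝ} {V W : PField d} (hV : PathField T M V)
    (hW : PathField T M W) (hM : 0 ≤ M) {a : ℝ} (ha : a ∈ Icc 0 T) (y : Pth d a) :
    ‖bracket V W a y‖ ≤ 2 * M * M := by
  refine (norm_sub_le _ _).trans ?_
  linarith [hV.norm_along_le hW hM ha y, hW.norm_along_le hV hM ha y]

theorem PathField.bracket_lip {M : ℝ} {V W : PField d} (hV : PathField T M V)
    (hW : PathField T M W) (hM : 0 ≤ M) {a : ℝ} (ha : a ∈ Icc 0 T) (y z : Pth d a) :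
    ‖bracket V W a y - bracket V W a z‖ ≤ 4 * M * M * ‖y - z‖ := by
  have e : bracket V W a y - bracket V W a z =
      (along V W a y - along V W a z) - (along W V a y - along W V a z) := by
    simp only [bracket]; abel
  rw [e]
  refine (norm_sub_le _ _).trans ?_
  linarith [hV.along_lip hW hM ha y z, hW.along_lip hV hM ha y z]

/-- Picard iteration for path-dependent equations with a small Lipschitz constant. -/
theorem exists_timeOne {W : PField d}
    (hc : ∀ y : C(ℝ, E d), ContinuousOn (fun u => W u (seg y u)) (Icc 0 1))
    (hL : ∀ u ∈ Icc (0 : ℝ) 1, ∀ p q : Pth d u, ‖W u p - W u q‖ ≤ 1 / 2 * ‖p - q‖) (x : E d) :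
    ∃ x', TimeOne W x x' := by
  -- Paths and the integrand are frozen outside `[0,1]`: the integrand `g` is then continuous on
  -- `ℝ`, and its primitive is differentiable at the endpoints too.
  let ext : Pth d 1 → C(ℝ, E d) := fun y =>
    y.comp ⟨projIcc (0 : ℝ) 1 zero_le_one, continuous_projIcc⟩
  let g : Pth d 1 → ℝ → E d := fun y u =>
    (fun v => W v (seg (ext y) v)) (projIcc (0 : ℝ) 1 zero_le_one u)
  have hg : ∀ y, Continuous (g y) := fun y =>
    (hc (ext y)).comp_continuous (continuous_subtype_val.comp continuous_projIcc)
      (fun u => (projIcc (0 : ℝ) 1 zero_le_one u).2)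
  have hgL : ∀ y z u, ‖g y u - g z u‖ ≤ 1 / 2 * ‖y - z‖ := by
    intro y z u
    refine (hL _ (projIcc (0 : ℝ) 1 zero_le_one u).2 _ _).trans
      (mul_le_mul_of_nonneg_left ?_ (by norm_num))
    exact (ContinuousMap.norm_le _ (norm_nonneg _)).2 fun t =>
      ContinuousMap.norm_coe_le_norm (y - z) _
  let Φ : Pth d 1 → Pth d 1 := fun y =>
    ⟨fun u => x + ∫ r in (0 : ℝ)..u, g y r, (continuous_const.add
      (intervalIntegral.continuous_primitive (fun _ _ => (hg y).intervalIntegrable _ _) 0)).comp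
      continuous_subtype_val⟩
  have hΦ : ContractingWith (1 / 2 : NNReal) Φ := by
    refine ⟨by rw [← NNReal.coe_lt_coe]; norm_num, LipschitzWith.of_dist_le_mul fun y z => ?_⟩
    rw [dist_eq_norm y z]
    have hK : ((1 / 2 : NNReal) : ℝ) = 1 / 2 := by norm_num
    rw [hK]
    refine (ContinuousMap.dist_le (by positivity)).2 fun u => ?_
    have : dist (Φ y u) (Φ z u) = ‖∫ r in (0 : ℝ)..u, (g y r - g z r)‖ := by
      rw [dist_eq_norm, intervalIntegral.integral_sub ((hg y).intervalIntegrable _ _)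
        ((hg z).intervalIntegrable _ _)]
      simp [Φ]
    rw [this]
    refine (intervalIntegral.norm_integral_le_of_norm_le_const (fun r _ => hgL y z r)).trans ?_
    rw [sub_zero, abs_of_nonneg u.2.1]
    exact mul_le_of_le_one_right (by positivity) u.2.2
  obtain ⟨y, hy⟩ : ∃ y, Φ y = y := ⟨_, hΦ.fixedPoint_isFixedPt⟩
  have hval : ∀ u ∈ Icc (0 : ℝ) 1, ext y u = x + ∫ r in (0 : ℝ)..u, g y r := by
    intro u hu
    have h1 : ext y u = y ⟨u, hu⟩ := by
      simp only [ext, ContinuousMap.comp_apply, ContinuousMap.coe_mk]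
      rw [projIcc_of_mem _ hu]
    rw [h1, ← DFunLike.congr_fun hy ⟨u, hu⟩]
    rfl
  refine ⟨ext y 1, ext y, ?_, rfl, fun u hu => ?_⟩
  · rw [hval 0 ⟨le_rfl, zero_le_one⟩]; simp
  · have h1 : HasDerivAt (fun u => x + ∫ r in (0 : ℝ)..u, g y r) (g y u) u :=
      (intervalIntegral.integral_hasDerivAt_right ((hg y).intervalIntegrable _ _)
        ((hg y).stronglyMeasurableAtFilter _ _) (hg y).continuousAt).const_add x
    have h2 : g y u = W u (seg (ext y) u) := by
      simp only [g]
      rw [projIcc_of_mem _ hu]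
    rw [← h2]
    exact h1.hasDerivWithinAt.congr (fun v hv => hval v hv) (hval u hu)

end Paths
-- Fine derivatives and bounds on the driven field
section Fine

variable {d : ℕ} {T : ℝ} {G : Type} [NormedAddCommGroup G] [NormedSpace ℝ G]

theorem IsFineDeriv.continuousOn {F : (a : ℝ) → Pth d a → G}
    {F' : (a : ℝ) → Pth d a → Pth d a →L[ℝ] G} (h : IsFineDeriv T F F') (y z : C(ℝ, E d)) :
    ContinuousOn (fun r => F' r (seg y r) (seg z r)) (Icc 0 T) := by
  rw [Metric.continuousOn_iff]
  intro a ha ε hε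
  obtain ⟨δ, hδ, hc⟩ := h.cont a ha (seg y a) (seg z a) ε hε
  obtain ⟨δ₁, hδ₁, h1⟩ := exists_stopped_seg_lt (T := T) y (half_pos hδ)
  obtain ⟨δ₂, hδ₂, h2⟩ := exists_stopped_seg_lt (T := T) z hδ
  refine ⟨min (δ / 2) (min δ₁ δ₂), by positivity, fun b hb hab => ?_⟩
  rw [Real.dist_eq] at hab
  have k1 : |b - a| < δ / 2 := hab.trans_le (min_le_left _ _)
  have k2 : |b - a| < δ₁ := hab.trans_le ((min_le_right _ _).trans (min_le_left _ _))
  have k3 : |b - a| < δ₂ := hab.trans_le ((min_le_right _ _).trans (min_le_right _ _))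
  rw [dist_comm, dist_eq_norm]
  exact hc b hb _ _ (by linarith [h1 a ha b hb k2]) (h2 a ha b hb k3)

/-- Mean value inequality for fine derivatives. -/
theorem IsFineDeriv.norm_sub_le {F : (a : ℝ) → Pth d a → G}
    {F' : (a : ℝ) → Pth d a → Pth d a →L[ℝ] G} (h : IsFineDeriv T F F') {M ρ : ℝ} (hM0 : 0 ≤ M)
    (hρ0 : 0 ≤ ρ) (hM : ∀ a ∈ Icc 0 T, ∀ y, ‖F' a y‖ ≤ M) {u : ℝ} (hu : u ∈ Icc 0 T)
    (y z : C(ℝ, E d)) (hyz : ∀ t ∈ Icc 0 u, HasDerivWithinAt y (z t) (Icc 0 u) t)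
    (hz : ∀ t ∈ Icc 0 u, ‖z t‖ ≤ ρ) :
    ‖F u (seg y u) - F 0 (seg y 0)‖ ≤ M * ρ * u := by
  rw [h.ftc u hu y z hyz, add_sub_cancel_left]
  refine (intervalIntegral.norm_integral_le_of_norm_le_const (C := M * ρ) fun r hr => ?_).trans ?_
  · rw [uIoc_of_le hu.1] at hr
    have hr' : r ∈ Icc 0 T := ⟨hr.1.le, hr.2.trans hu.2⟩
    refine (ContinuousLinearMap.le_opNorm _ _).trans (mul_le_mul (hM r hr' _) ?_
      (norm_nonneg _) hM0)
    exact (ContinuousMap.norm_le _ hρ0).2 fun t => hz t ⟨t.2.1, t.2.2.trans hr.2⟩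
  · rw [sub_zero, abs_of_nonneg hu.1]

/-- First order expansion by means of the fine derivative. -/
theorem IsFineDeriv.norm_sub_sub_le [CompleteSpace G] {F : (a : ℝ) → Pth d a → G}
    {F' : (a : ℝ) → Pth d a → Pth d a →L[ℝ] G} (h : IsFineDeriv T F F') {b : ℝ} {D : G} {u : ℝ}
    (hu : u ∈ Icc 0 T) (y z : C(ℝ, E d))
    (hyz : ∀ t ∈ Icc 0 u, HasDerivWithinAt y (z t) (Icc 0 u) t)
    (hb : ∀ r ∈ Icc 0 u, ‖F' r (seg y r) (seg z r) - D‖ ≤ b) :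
    ‖F u (seg y u) - F 0 (seg y 0) - u • D‖ ≤ b * u := by
  have hint : IntervalIntegrable (fun r => F' r (seg y r) (seg z r)) volume 0 u :=
    ((h.continuousOn y z).mono (Icc_subset_Icc_right hu.2)).intervalIntegrable_of_Icc hu.1
  have e : (∫ r in (0 : ℝ)..u, F' r (seg y r) (seg z r)) - u • D =
      ∫ r in (0 : ℝ)..u, (F' r (seg y r) (seg z r) - D) := by
    rw [intervalIntegral.integral_sub hint intervalIntegrable_const]
    rw [intervalIntegral.integral_const, sub_zero]
  rw [h.ftc u hu y z hyz, add_sub_cancel_left, e]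
  refine (intervalIntegral.norm_integral_le_of_norm_le_const (C := b) fun r hr => ?_).trans ?_
  · rw [uIoc_of_le hu.1] at hr
    exact hb r ⟨hr.1.le, hr.2⟩
  · rw [sub_zero, abs_of_nonneg hu.1]

/-- A field with second order fine derivatives that agree with the usual ones at paths of
length `0`. -/
structure FineField (T M : ℝ) (F : PField d) : Prop extends PathField T M F where
  fine : ∃ F' : (a : ℝ) → Pth d a → Pth d a →L[ℝ] E d, IsFineDeriv T F F' ∧
    (∀ a ∈ Icc 0 T, ∀ y, ‖F' a y‖ ≤ M) ∧
    (∀ x w, F' 0 (cst 0 x) (cst 0 w) = fderiv ℝ (F 0) (cst 0 x) (cst 0 w)) ∧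
    ∃ F'' : (a : ℝ) → Pth d a → Pth d a →L[ℝ] (E d →L[ℝ] E d),
      IsFineDeriv T (alongConst F') F'' ∧ ∀ a ∈ Icc 0 T, ∀ y, ‖F'' a y‖ ≤ M
  fine_fderiv : ∃ G' : (a : ℝ) → Pth d a → Pth d a →L[ℝ] (E d →L[ℝ] E d),
    IsFineDeriv T (fun a y => (fderiv ℝ (F a) y).comp (cstL d a)) G' ∧
    ∀ a ∈ Icc 0 T, ∀ y, ‖G' a y‖ ≤ M

theorem fderiv_classicalField {F : PField d} {x : E d}
    (hF : DifferentiableAt ℝ (F 0) (cst 0 x)) (w : E d) :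
    fderiv ℝ (classicalField F) x w = fderiv ℝ (F 0) (cst 0 x) (cst 0 w) := by
  have : HasFDerivAt (classicalField F) ((fderiv ℝ (F 0) (cst 0 x)).comp (cstL d 0)) x :=
    HasFDerivAt.comp x (g := F 0) hF.hasFDerivAt (cstL d 0).hasFDerivAt
  rw [this.fderiv]
  rfl

variable {ℓ : ℕ} {p : ℝ} {h : ℝ → ℝ} {XR : RoughPath ℓ p T}

/-- Arbitrary vectors stand in for the values of the fields, so that the same bound serves for the
driven field, its increments and its expansion remainders. The factor `1/2` is simply dropped. -/
theorem norm_driver_le {H e r s t a b c : ℝ} (hI : IncrBound h XR H e r s t) {x₀ : E d}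
    {x₁ : Fin ℓ → E d} {x₂ : Fin ℓ → Fin ℓ → E d} (hH : 0 ≤ H) (he : 0 ≤ e) (hr : 0 ≤ r)
    (h0 : ‖x₀‖ ≤ a) (h1 : ∀ i, ‖x₁ i‖ ≤ b) (h2 : ∀ j k, ‖x₂ j k‖ ≤ c) :
    ‖(h t - h s) • x₀ + ∑ i, XR.X t s i • x₁ i
      + (1 / 2 : ℝ) • ∑ j, ∑ k, XR.XX t s j k • x₂ j k‖
      ≤ H * e * a + ℓ * (H * r * b) + ℓ ^ 2 * (H * e * c) := by
  have k0 : ‖(h t - h s) • x₀‖ ≤ H * e * a := by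
    rw [norm_smul, Real.norm_eq_abs]
    exact mul_le_mul hI.drift h0 (norm_nonneg _) (by positivity)
  have k1 : ‖∑ i, XR.X t s i • x₁ i‖ ≤ ℓ * (H * r * b) := by
    refine (norm_sum_le_of_le (f := fun i => XR.X t s i • x₁ i) _ fun i _ => ?_).trans
      (b := ∑ _i : Fin ℓ, H * r * b) (le_of_eq (by simp))
    rw [norm_smul, Real.norm_eq_abs]
    exact mul_le_mul (hI.first i) (h1 i) (norm_nonneg _) (by positivity)
  have k2 : ‖∑ j, ∑ k, XR.XX t s j k • x₂ j k‖ ≤ ℓ ^ 2 * (H * e * c) := by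
    refine (norm_sum_le_of_le (f := fun j => ∑ k, XR.XX t s j k • x₂ j k) _ fun j _ =>
      norm_sum_le_of_le (f := fun k => XR.XX t s j k • x₂ j k) _ fun k _ => ?_).trans
      (b := ∑ _j : Fin ℓ, ∑ _k : Fin ℓ, H * e * c) (le_of_eq (by simp; ring))
    rw [norm_smul, Real.norm_eq_abs]
    exact mul_le_mul (hI.second j k) (h2 j k) (norm_nonneg _) (by positivity)
  have k3 : ‖(1 / 2 : ℝ) • ∑ j, ∑ k, XR.XX t s j k • x₂ j k‖ ≤ ℓ ^ 2 * (H * e * c) := by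
    refine le_trans ?_ k2
    rw [norm_smul, Real.norm_of_nonneg (by norm_num)]
    linarith [norm_nonneg (∑ j, ∑ k, XR.XX t s j k • x₂ j k)]
  exact norm_add₃_le.trans (by linarith)

variable {V : PField d} {F : Fin ℓ → PField d} {M H e r s t : ℝ}

theorem norm_drivenField_le (hV : PathDrift T M V) (hF : ∀ i, PathField T M (F i)) (hM : 0 ≤ M)
    (hI : IncrBound h XR H e r s t) (hH : 0 ≤ H) (he0 : 0 ≤ e) (hr : 0 ≤ r)
    {u : ℝ} (hu : u ∈ Icc 0 T) (y : Pth d u) :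
    ‖drivenField h XR V F s t u y‖ ≤ H * e * M + ℓ * (H * r * M) + ℓ ^ 2 * (H * e * (2 * M * M)) :=
  norm_driver_le hI hH he0 hr (hV.bound u hu y) (fun i => (hF i).bound u hu y)
    (fun j k => (hF j).norm_bracket_le (hF k) hM hu y)

theorem drivenField_lip (hV : PathDrift T M V) (hF : ∀ i, PathField T M (F i)) (hM : 0 ≤ M)
    (hI : IncrBound h XR H e r s t) (hH : 0 ≤ H) (he0 : 0 ≤ e) (hr : 0 ≤ r)
    {u : ℝ} (hu : u ∈ Icc 0 T) (y z : Pth d u) :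
    ‖drivenField h XR V F s t u y - drivenField h XR V F s t u z‖ ≤
      (H * e * M + ℓ * (H * r * M) + ℓ ^ 2 * (H * e * (4 * M * M))) * ‖y - z‖ := by
  have := norm_driver_le hI hH he0 hr (hV.lip_same hM hu y z)
    (fun i => (hF i).lip_same hM hu y z)
    (fun j k => (hF j).bracket_lip (hF k) hM hu y z)
  have e1 : drivenField h XR V F s t u y - drivenField h XR V F s t u z =
      (h t - h s) • (V u y - V u z) + ∑ i, XR.X t s i • (F i u y - F i u z)
      + (1 / 2 : ℝ) • ∑ j, ∑ k, XR.XX t s j k •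
        (bracket (F j) (F k) u y - bracket (F j) (F k) u z) := by
    simp only [drivenField, smul_sub, Finset.sum_sub_distrib]
    abel
  rw [e1]
  linarith

theorem continuousOn_drivenField (hV : PathDrift T M V) (hF : ∀ i, PathField T M (F i))
    (hM : 0 ≤ M) (y : C(ℝ, E d)) :
    ContinuousOn (fun u => drivenField h XR V F s t u (seg y u)) (Icc 0 T) := by
  have h0 := (hV.continuousOn_seg y).const_smul (h t - h s)
  have h1 : ContinuousOn (fun u => ∑ i, XR.X t s i • F i u (seg y u)) (Icc 0 T) :=
    continuousOn_finsetSum _ fun i _ => ((hF i).continuousOn_seg y).const_smul (XR.X t s i)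
  have h2 : ContinuousOn (fun u => ∑ j, ∑ k, XR.XX t s j k • bracket (F j) (F k) u (seg y u))
      (Icc 0 T) :=
    continuousOn_finsetSum _ fun j _ => continuousOn_finsetSum _ fun k _ =>
      ((hF j).continuousOn_bracket (hF k) hM y).const_smul (XR.XX t s j k)
  exact (h0.add h1).add (h2.const_smul (1 / 2 : ℝ))

theorem exists_timeOne_drivenField (hT : 1 ≤ T) (hV : PathDrift T M V)
    (hF : ∀ i, PathField T M (F i)) (hM : 0 ≤ M) (hI : IncrBound h XR H e r s t) (hH : 0 ≤ H)
    (he0 : 0 ≤ e) (hr : 0 ≤ r)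
    (hsmall : H * e * M + ℓ * (H * r * M) + ℓ ^ 2 * (H * e * (4 * M * M)) ≤ 1 / 2) (x : E d) :
    ∃ x', TimeOne (drivenField h XR V F s t) x x' := by
  refine exists_timeOne (fun y => (continuousOn_drivenField hV hF hM y).mono
    (Icc_subset_Icc_right hT)) (fun u hu p q => ?_) x
  exact (drivenField_lip hV hF hM hI hH he0 hr ⟨hu.1, hu.2.trans hT⟩ p q).trans
    (mul_le_mul_of_nonneg_right hsmall (norm_nonneg _))

/-- The symmetric part of `𝕏` turns the Lie brackets into second order derivatives. -/
theorem weakGeometric_sum (hs : 0 ≤ s) (hst : s ≤ t) (ht : t ≤ T) (a : Fin ℓ → Fin ℓ → E d) :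
    (1 / 2 : ℝ) • ∑ k, XR.X t s k • ∑ j, XR.X t s j • a j k
      + (1 / 2 : ℝ) • ∑ j, ∑ k, XR.XX t s j k • (a j k - a k j) =
      ∑ j, ∑ k, XR.XX t s j k • a j k := by
  -- By weak geometricity the products `X^j X^k` are `𝕏^{jk} + 𝕏^{kj}`; adding the antisymmetric
  -- half then cancels the transposed sum.
  have h1 : ∑ k, XR.X t s k • ∑ j, XR.X t s j • a j k =
      ∑ j, ∑ k, XR.XX t s j k • a j k + ∑ j, ∑ k, XR.XX t s k j • a j k := by
    have : ∑ k, XR.X t s k • ∑ j, XR.X t s j • a j k =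
        ∑ k, ∑ j, (XR.XX t s j k + XR.XX t s k j) • a j k := by
      refine Finset.sum_congr rfl fun k _ => ?_
      rw [Finset.smul_sum]
      refine Finset.sum_congr rfl fun j _ => ?_
      rw [smul_smul, XR.weakGeometric s t hs hst ht, mul_comm]
    rw [this, Finset.sum_comm]
    simp only [add_smul, Finset.sum_add_distrib]
  have h2 : ∑ j, ∑ k, XR.XX t s j k • a k j = ∑ j, ∑ k, XR.XX t s k j • a j k :=
    Finset.sum_comm
  simp only [smul_sub, Finset.sum_sub_distrib]
  rw [h1, h2]
  module

end Fine
-- Expansion of the time one maps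
section Close

variable {d ℓ : ℕ} {T p : ℝ} {h : ℝ → ℝ} {XR : RoughPath ℓ p T}
variable {V : PField d} {F : Fin ℓ → PField d} {M H e r s t : ℝ}

theorem PathDrift.norm_sub_zero_le {ρ : ℝ} (hV : PathDrift T M V) (hM : 0 ≤ M) (hρ : 0 ≤ ρ)
    (hT : 1 ≤ T) {y : C(ℝ, E d)} (hy : ∀ r ∈ Icc (0 : ℝ) 1, ‖y r - y 0‖ ≤ ρ) {u : ℝ}
    (hu : u ∈ Icc (0 : ℝ) 1) : ‖V u (seg y u) - V 0 (cst 0 (y 0))‖ ≤ M * ρ := by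
  have h0 : (0 : ℝ) ∈ Icc 0 T := ⟨le_rfl, by linarith⟩
  have huT : u ∈ Icc 0 T := ⟨hu.1, hu.2.trans hT⟩
  have := hV.lip u huT 0 h0 (seg y u) (seg y 0)
  rw [seg_zero] at this
  refine this.trans (mul_le_mul_of_nonneg_left ?_ hM)
  have := norm_stopped_seg_sub_le (T := T) hu.1 hρ y fun r hr => hy r ⟨hr.1, hr.2.trans hu.2⟩
  rwa [seg_zero] at this

/-- Restricted to constant directions, the Fréchet derivatives of `W` take values in one fixed
space; the bounded fine derivative there controls their variation along the path. -/
theorem FineField.norm_along_sub_zero_le {ρ : ℝ} {V W : PField d} (hV : FineField T M V)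
    (hW : FineField T M W) (hM : 0 ≤ M) (hρ : 0 ≤ ρ) (hT : 1 ≤ T) {y z : C(ℝ, E d)}
    (hyz : ∀ u ∈ Icc (0 : ℝ) 1, HasDerivWithinAt y (z u) (Icc 0 1) u)
    (hz : ∀ u ∈ Icc (0 : ℝ) 1, ‖z u‖ ≤ ρ)
    (hy : ∀ r ∈ Icc (0 : ℝ) 1, ‖y r - y 0‖ ≤ ρ) {u : ℝ} (hu : u ∈ Icc (0 : ℝ) 1) :
    ‖along V W u (seg y u) - along V W 0 (seg y 0)‖ ≤ 2 * M * M * ρ := by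
  have h0 : (0 : ℝ) ∈ Icc 0 T := ⟨le_rfl, by linarith⟩
  have huT : u ∈ Icc 0 T := ⟨hu.1, hu.2.trans hT⟩
  obtain ⟨G', hG, hGM⟩ := hW.fine_fderiv
  have k1 := hG.norm_sub_le hM hρ hGM huT y z
    (fun t ht => (hyz t ⟨ht.1, ht.2.trans hu.2⟩).mono (Icc_subset_Icc_right hu.2))
    (fun t ht => hz t ⟨ht.1, ht.2.trans hu.2⟩)
  have k2 : ‖V u (seg y u) - V 0 (seg y 0)‖ ≤ M * ρ := by
    rw [seg_zero]
    exact hV.norm_sub_zero_le hM hρ hT hy hu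
  have k3 : ‖(fderiv ℝ (W 0) (seg y 0)).comp (cstL d 0)‖ ≤ M := by
    refine ContinuousLinearMap.opNorm_le_bound _ hM fun x => ?_
    exact (ContinuousLinearMap.le_opNorm (fderiv ℝ (W 0) (seg y 0)) (cst 0 x)).trans
      (mul_le_mul (hW.dbound 0 h0 _) (norm_cst_le 0 x) (norm_nonneg _) hM)
  have k4 : M * ρ * u ≤ M * ρ := mul_le_of_le_one_right (mul_nonneg hM hρ) hu.2
  rw [along_eq (hW.diff u huT _), along_eq (hW.diff 0 h0 _)]
  have e : fderiv ℝ (W u) (seg y u) (cst u (V u (seg y u)))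
      - fderiv ℝ (W 0) (seg y 0) (cst 0 (V 0 (seg y 0))) =
      ((fderiv ℝ (W u) (seg y u)).comp (cstL d u) - (fderiv ℝ (W 0) (seg y 0)).comp (cstL d 0))
        (V u (seg y u))
      + ((fderiv ℝ (W 0) (seg y 0)).comp (cstL d 0)) (V u (seg y u) - V 0 (seg y 0)) := by
    rw [map_sub]
    simp only [FunLike.coe_sub, Pi.sub_apply]
    rw [sub_add_sub_cancel]
    rfl
  rw [e]
  have j1 := (ContinuousLinearMap.le_opNorm ((fderiv ℝ (W u) (seg y u)).comp (cstL d u)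
    - (fderiv ℝ (W 0) (seg y 0)).comp (cstL d 0)) (V u (seg y u))).trans
    (mul_le_mul (k1.trans k4) (hV.bound u huT _) (norm_nonneg _) (mul_nonneg hM hρ))
  have j2 := (ContinuousLinearMap.le_opNorm ((fderiv ℝ (W 0) (seg y 0)).comp (cstL d 0))
    (V u (seg y u) - V 0 (seg y 0))).trans (mul_le_mul k3 k2 (norm_nonneg _) hM)
  refine (norm_add_le _ _).trans ?_
  linarith

/-- The rate of change is `F'` applied to the velocity. Replacing the velocity by `w` costs `M η`;
going back to time `0` in the constant direction `w` costs `M ρ ‖w‖` by the second fine derivative.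
There `F'` agrees with the usual derivative, the one that appears in the brackets. -/
theorem FineField.expansion {ρ η : ℝ} {V : PField d} (hV : FineField T M V) (hM : 0 ≤ M)
    (hρ : 0 ≤ ρ) (hη : 0 ≤ η) (hT : 1 ≤ T) {y z : C(ℝ, E d)}
    (hyz : ∀ u ∈ Icc (0 : ℝ) 1, HasDerivWithinAt y (z u) (Icc 0 1) u)
    (hz : ∀ u ∈ Icc (0 : ℝ) 1, ‖z u‖ ≤ ρ) {w : E d}
    (hw : ∀ u ∈ Icc (0 : ℝ) 1, ‖z u - w‖ ≤ η) {u : ℝ} (hu : u ∈ Icc (0 : ℝ) 1) :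
    ‖V u (seg y u) - V 0 (cst 0 (y 0)) - u • fderiv ℝ (V 0) (cst 0 (y 0)) (cst 0 w)‖ ≤
      M * η + M * ρ * ‖w‖ := by
  have huT : u ∈ Icc 0 T := ⟨hu.1, hu.2.trans hT⟩
  obtain ⟨F', hF', hM', hag, F'', hF'', hM''⟩ := hV.fine
  have key := hF'.norm_sub_sub_le (b := M * η + M * ρ * ‖w‖)
    (D := fderiv ℝ (V 0) (cst 0 (y 0)) (cst 0 w)) huT y z
    (fun t ht => (hyz t ⟨ht.1, ht.2.trans hu.2⟩).mono (Icc_subset_Icc_right hu.2))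
    (fun r hr => ?_)
  · rw [seg_zero] at key
    exact key.trans (mul_le_of_le_one_right (by positivity) hu.2)
  · have hr1 : r ∈ Icc (0 : ℝ) 1 := ⟨hr.1, hr.2.trans hu.2⟩
    have hrT : r ∈ Icc 0 T := ⟨hr.1, hr1.2.trans hT⟩
    have k1 := hF''.norm_sub_le hM hρ hM'' hrT y z
      (fun t ht => (hyz t ⟨ht.1, ht.2.trans hr1.2⟩).mono (Icc_subset_Icc_right hr1.2))
      (fun t ht => hz t ⟨ht.1, ht.2.trans hr1.2⟩)
    have k4 : M * ρ * r ≤ M * ρ := mul_le_of_le_one_right (mul_nonneg hM hρ) hr1.2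
    rw [← hag]
    have e : F' r (seg y r) (seg z r) - F' 0 (cst 0 (y 0)) (cst 0 w) =
        F' r (seg y r) (seg z r - cst r w)
        + (alongConst F' r (seg y r) - alongConst F' 0 (seg y 0)) w := by
      rw [map_sub, seg_zero]
      simp only [FunLike.coe_sub, Pi.sub_apply]
      have e1 : alongConst F' r (seg y r) w = F' r (seg y r) (cst r w) := rfl
      have e2 : alongConst F' 0 (cst 0 (y 0)) w = F' 0 (cst 0 (y 0)) (cst 0 w) := rfl
      rw [e1, e2]
      abel
    rw [e]
    have j1 : ‖F' r (seg y r) (seg z r - cst r w)‖ ≤ M * η := by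
      refine (ContinuousLinearMap.le_opNorm _ _).trans (mul_le_mul (hM' r hrT _) ?_
        (norm_nonneg _) hM)
      exact (ContinuousMap.norm_le _ hη).2 fun t => hw t ⟨t.2.1, t.2.2.trans hr1.2⟩
    have j2 := (ContinuousLinearMap.le_opNorm (alongConst F' r (seg y r)
      - alongConst F' 0 (seg y 0)) w).trans
      (mul_le_mul_of_nonneg_right (k1.trans k4) (norm_nonneg _))
    exact (norm_add_le _ _).trans (add_le_add j1 j2)

/-- The time one maps agree with the Euler scheme up to an error of the third order. -/
theorem exists_timeOne_close (hT : 1 ≤ T) (hM : 0 ≤ M) (hH : 0 ≤ H) :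
    ∃ C, 0 ≤ C ∧ ∀ (V : PField d) (F : Fin ℓ → PField d), PathDrift T M V →
      (∀ i, FineField T M (F i)) → ∀ e r s t : ℝ, 0 ≤ e → 0 ≤ r → r ^ 2 ≤ e → e ≤ 2 * r →
      0 ≤ s → s ≤ t → t ≤ T → IncrBound h XR H e r s t → ∀ x x',
      TimeOne (drivenField h XR V F s t) x x' →
      ‖x' - eulerMap h XR (classicalField V) (fun i => classicalField (F i)) t s x‖ ≤
        C * (e * r) := by
  -- `A r` bounds the velocity, `B e` its distance to `w = X^j V_j(x)`, `D e` the remainder in the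
  -- expansion of the fields, and `C e r` the remainder of the velocity after its affine part.
  set A := H * 2 * M + ℓ * (H * M) + ℓ ^ 2 * (H * 2 * (2 * M * M)) with hA
  have hA0 : 0 ≤ A := by positivity
  set B := H * M + ℓ * (H * (M * A)) + ℓ ^ 2 * (H * (2 * M * M)) with hB
  have hB0 : 0 ≤ B := by positivity
  set D := M * B + M * A * (ℓ * (H * M)) with hD
  have hD0 : 0 ≤ D := by positivity
  set C := H * (M * A) + ℓ * (H * D) + ℓ ^ 2 * (H * (4 * M * M * A)) with hC
  have hC0 : 0 ≤ C := by positivity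
  refine ⟨C, hC0, fun V F hV hF e r s t he0 hr0 hre her hs hst ht hI x x' hTO => ?_⟩
  obtain ⟨y, rfl, rfl, hy⟩ := hTO
  have hFP := fun i => (hF i).toPathField
  have h0T : (0 : ℝ) ∈ Icc 0 T := ⟨le_rfl, by linarith⟩
  set W := drivenField h XR V F s t with hW
  have hρ0 : 0 ≤ A * r := by positivity
  have hWb : ∀ u ∈ Icc (0 : ℝ) 1, ‖W u (seg y u)‖ ≤ A * r := by
    intro u hu
    refine (norm_drivenField_le hV hFP hM hI hH he0 hr0 ⟨hu.1, hu.2.trans hT⟩ _).trans ?_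
    have h1 : H * e * M ≤ H * (2 * r) * M := by gcongr
    have h2 : ℓ ^ 2 * (H * e * (2 * M * M)) ≤ ℓ ^ 2 * (H * (2 * r) * (2 * M * M)) := by gcongr
    rw [hA]
    linarith
  -- The velocity, frozen outside `[0,1]`: fine derivatives are tested against continuous velocity
  -- paths.
  let z : C(ℝ, E d) := ⟨fun u => (fun v => W v (seg y v)) (projIcc (0 : ℝ) 1 zero_le_one u),
    ((continuousOn_drivenField hV hFP hM y).mono (Icc_subset_Icc_right hT)).comp_continuous
      (continuous_subtype_val.comp continuous_projIcc)
      (fun u => (projIcc (0 : ℝ) 1 zero_le_one u).2)⟩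
  have hzW : ∀ u ∈ Icc (0 : ℝ) 1, z u = W u (seg y u) := by
    intro u hu
    simp only [z, ContinuousMap.coe_mk]
    rw [projIcc_of_mem _ hu]
  have hyz : ∀ u ∈ Icc (0 : ℝ) 1, HasDerivWithinAt y (z u) (Icc 0 1) u := by
    intro u hu
    rw [hzW u hu]
    exact hy u hu
  have hz : ∀ u ∈ Icc (0 : ℝ) 1, ‖z u‖ ≤ A * r := fun u hu => by
    rw [hzW u hu]; exact hWb u hu
  have hyρ : ∀ u ∈ Icc (0 : ℝ) 1, ‖y u - y 0‖ ≤ A * r := by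
    intro u hu
    have := (convex_Icc (0 : ℝ) 1).norm_image_sub_le_of_norm_hasDerivWithin_le hyz hz
      ⟨le_rfl, zero_le_one⟩ hu
    refine this.trans (mul_le_of_le_one_right hρ0 ?_)
    rw [sub_zero, Real.norm_of_nonneg hu.1]
    exact hu.2
  set w := ∑ j, XR.X t s j • F j 0 (cst 0 (y 0)) with hw
  have hwn : ‖w‖ ≤ ℓ * (H * r * M) := by
    have := norm_driver_le hI hH he0 hr0 (x₀ := 0) (x₁ := fun i => F i 0 (cst 0 (y 0)))
      (x₂ := fun _ _ => 0) (a := 0) (b := M) (c := 0) (by simp)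
      (fun i => (hF i).bound 0 h0T _) (fun _ _ => by simp)
    simpa using this
  have hη0 : 0 ≤ B * e := by positivity
  have hzw : ∀ u ∈ Icc (0 : ℝ) 1, ‖z u - w‖ ≤ B * e := by
    intro u hu
    have huT : u ∈ Icc 0 T := ⟨hu.1, hu.2.trans hT⟩
    have := norm_driver_le hI hH he0 hr0 (hV.bound u huT (seg y u))
      (fun i => (hF i).norm_sub_zero_le hM hρ0 hT hyρ hu)
      (fun j k => (hFP j).norm_bracket_le (hFP k) hM huT (seg y u))
    have e1 : z u - w = (h t - h s) • V u (seg y u)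
        + ∑ i, XR.X t s i • (F i u (seg y u) - F i 0 (cst 0 (y 0)))
        + (1 / 2 : ℝ) • ∑ j, ∑ k, XR.XX t s j k • bracket (F j) (F k) u (seg y u) := by
      rw [hzW u hu, hW, hw]
      simp only [drivenField, smul_sub, Finset.sum_sub_distrib]
      abel
    rw [e1]
    refine this.trans ?_
    have h2 : ℓ * (H * (M * A)) * r ^ 2 ≤ ℓ * (H * (M * A)) * e := by gcongr
    rw [hB]
    linarith
  have hexp : ∀ i, ∀ u ∈ Icc (0 : ℝ) 1, ‖F i u (seg y u) - (F i 0 (cst 0 (y 0))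
      + u • fderiv ℝ (F i 0) (cst 0 (y 0)) (cst 0 w))‖ ≤ D * e := by
    intro i u hu
    rw [← sub_sub]
    refine ((hF i).expansion hM hρ0 hη0 hT hyz hz hzw hu).trans ?_
    have h1 : M * (A * r) * ‖w‖ ≤ M * (A * r) * (ℓ * (H * r * M)) := by gcongr
    have h2 : M * A * (ℓ * (H * M)) * r ^ 2 ≤ M * A * (ℓ * (H * M)) * e := by gcongr
    rw [hD]
    linarith
  have hbr : ∀ j k, ∀ u ∈ Icc (0 : ℝ) 1,
      ‖bracket (F j) (F k) u (seg y u) - bracket (F j) (F k) 0 (cst 0 (y 0))‖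
        ≤ 4 * M * M * (A * r) := by
    intro j k u hu
    have h1 := (hF j).norm_along_sub_zero_le (hF k) hM hρ0 hT hyz hz hyρ hu
    have h2 := (hF k).norm_along_sub_zero_le (hF j) hM hρ0 hT hyz hz hyρ hu
    rw [seg_zero] at h1 h2
    have e1 : bracket (F j) (F k) u (seg y u) - bracket (F j) (F k) 0 (cst 0 (y 0)) =
        (along (F j) (F k) u (seg y u) - along (F j) (F k) 0 (cst 0 (y 0)))
        - (along (F k) (F j) u (seg y u) - along (F k) (F j) 0 (cst 0 (y 0))) := by
      simp only [bracket]; abel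
    rw [e1]
    refine (norm_sub_le _ _).trans ?_
    linarith
  set q₀ := (h t - h s) • V 0 (cst 0 (y 0)) + ∑ i, XR.X t s i • F i 0 (cst 0 (y 0))
    + (1 / 2 : ℝ) • ∑ j, ∑ k, XR.XX t s j k • bracket (F j) (F k) 0 (cst 0 (y 0)) with hq₀
  set q₁ := ∑ i, XR.X t s i • fderiv ℝ (F i 0) (cst 0 (y 0)) (cst 0 w) with hq₁
  -- The velocity is `q₀ + u q₁` up to order `e r`; integrating gives `y 1 ≈ y 0 + q₀ + ½ q₁`.
  have hderiv : ∀ u ∈ Icc (0 : ℝ) 1, HasDerivWithinAt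
      (fun u : ℝ => y u - u • q₀ - (u ^ 2 / 2) • q₁) (z u - q₀ - u • q₁) (Icc 0 1) u := by
    intro u hu
    have h1 : HasDerivWithinAt (fun u : ℝ => u • q₀) q₀ (Icc 0 1) u := by
      simpa using ((hasDerivAt_id u).smul_const q₀).hasDerivWithinAt
    have h2 : HasDerivWithinAt (fun u : ℝ => (u ^ 2 / 2) • q₁) (u • q₁) (Icc 0 1) u := by
      have := (((hasDerivAt_id u).pow 2).div_const 2).smul_const q₁
      simpa using this.hasDerivWithinAt
    exact ((hyz u hu).sub h1).sub h2
  have hbound : ∀ u ∈ Icc (0 : ℝ) 1, ‖z u - q₀ - u • q₁‖ ≤ C * (e * r) := by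
    intro u hu
    have := norm_driver_le hI hH he0 hr0 (hV.norm_sub_zero_le hM hρ0 hT hyρ hu)
      (fun i => hexp i u hu) (fun j k => hbr j k u hu)
    have e1 : z u - q₀ - u • q₁ = (h t - h s) • (V u (seg y u) - V 0 (cst 0 (y 0)))
        + ∑ i, XR.X t s i • (F i u (seg y u) - (F i 0 (cst 0 (y 0))
          + u • fderiv ℝ (F i 0) (cst 0 (y 0)) (cst 0 w)))
        + (1 / 2 : ℝ) • ∑ j, ∑ k, XR.XX t s j k •
          (bracket (F j) (F k) u (seg y u) - bracket (F j) (F k) 0 (cst 0 (y 0))) := by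
      have e2 : u • q₁ = ∑ i, XR.X t s i • u • fderiv ℝ (F i 0) (cst 0 (y 0)) (cst 0 w) := by
        rw [hq₁, Finset.smul_sum]
        exact Finset.sum_congr rfl fun i _ => smul_comm _ _ _
      rw [hzW u hu, hW, e2, hq₀]
      simp only [drivenField, smul_sub, smul_add, Finset.sum_sub_distrib, Finset.sum_add_distrib]
      abel
    rw [e1]
    refine this.trans (le_of_eq ?_)
    rw [hC]
    ring
  have hfinal := norm_image_sub_le_of_norm_deriv_le_segment_01' hderiv
    (fun u hu => hbound u ⟨hu.1, hu.2.le⟩)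
  -- `½ q₁` is the symmetric part of the second order term and the brackets in `q₀` the
  -- antisymmetric part; `weakGeometric_sum` joins them.
  have hEuler : eulerMap h XR (classicalField V) (fun i => classicalField (F i)) t s (y 0) =
      y 0 + (q₀ + (1 / 2 : ℝ) • q₁) := by
    have hfd : ∀ k, ∀ v, fderiv ℝ (classicalField (F k)) (y 0) v =
        fderiv ℝ (F k 0) (cst 0 (y 0)) (cst 0 v) := fun k v =>
      fderiv_classicalField ((hF k).diff 0 h0T _) v
    have hbr0 : ∀ j k, bracket (F j) (F k) 0 (cst 0 (y 0)) =
        fderiv ℝ (classicalField (F k)) (y 0) (classicalField (F j) (y 0))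
        - fderiv ℝ (classicalField (F j)) (y 0) (classicalField (F k) (y 0)) := by
      intro j k
      simp only [bracket]
      rw [along_eq ((hF k).diff 0 h0T _), along_eq ((hF j).diff 0 h0T _), hfd, hfd]
      rfl
    have hq1 : q₁ = ∑ k, XR.X t s k • ∑ j, XR.X t s j •
        fderiv ℝ (classicalField (F k)) (y 0) (classicalField (F j) (y 0)) := by
      rw [hq₁]
      refine Finset.sum_congr rfl fun k _ => ?_
      rw [← hfd, hw, map_sum]
      simp only [map_smul]
      rfl
    have := weakGeometric_sum (XR := XR) hs hst ht (fun j k =>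
      fderiv ℝ (classicalField (F k)) (y 0) (classicalField (F j) (y 0)))
    rw [eulerMap, eulerIncr, ← this, hq1, hq₀]
    simp only [hbr0]
    simp only [classicalField]
    abel
  rw [hEuler]
  have e3 : y 1 - (y 0 + (q₀ + (1 / 2 : ℝ) • q₁)) =
      (y 1 - (1 : ℝ) • q₀ - ((1 : ℝ) ^ 2 / 2) • q₁)
        - (y 0 - (0 : ℝ) • q₀ - ((0 : ℝ) ^ 2 / 2) • q₁) := by
    module
  rw [e3]
  exact hfinal

end Close
-- From the norms to explicit bounds
section Norms

variable {d : ℕ} {T : ℝ}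

theorem norm_le_of_supNorm_le {H : ℝ → Type} [∀ a, NormedAddCommGroup (H a)]
    {F : (a : ℝ) → Pth d a → H a} {M : ℝ} (hM : 0 ≤ M) (h : supNorm T F ≤ ENNReal.ofReal M)
    {a : ℝ} (ha : a ∈ Icc 0 T) (y : Pth d a) : ‖F a y‖ ≤ M := by
  have h1 : ‖F a y‖ₑ ≤ ENNReal.ofReal M :=
    (le_iSup (fun y => ‖F a y‖ₑ) y).trans
      ((le_iSup₂ (f := fun a (_ : a ∈ Icc (0 : ℝ) T) => ⨆ y : Pth d a, ‖F a y‖ₑ) a ha).trans h)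
  rw [← ofReal_norm] at h1
  exact (ENNReal.ofReal_le_ofReal_iff hM).1 h1

/-- Bounds are recorded as valid for all large `M`, so that finitely many of them can share one
constant. -/
theorem eventually_le_ofReal {x : ℝ≥0∞} (hx : x < ∞) :
    ∀ᶠ M in atTop, x ≤ ENNReal.ofReal M := by
  filter_upwards [eventually_ge_atTop x.toReal] with M hM
  rw [← ENNReal.ofReal_toReal hx.ne]
  exact ENNReal.ofReal_le_ofReal hM

theorem frechetNorm_spec {k : ℕ} {H : ℝ → Type} [∀ a, NormedAddCommGroup (H a)]
    [∀ a, NormedSpace ℝ (H a)] {F : (a : ℝ) → Pth d a → H a} (h : frechetNorm T k F < ∞) :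
    (∀ a ∈ Icc 0 T, ContDiff ℝ k (F a)) ∧
    ∀ i ≤ k, supNorm T (fun a y => iteratedFDeriv ℝ i (F a) y) ≤ frechetNorm T k F := by
  by_cases hc : ∀ a ∈ Icc (0 : ℝ) T, ContDiff ℝ k (F a)
  · refine ⟨hc, fun i hi => ?_⟩
    rw [frechetNorm, iInf_pos hc]
    exact Finset.single_le_sum
      (f := fun i => supNorm T (fun a y => iteratedFDeriv ℝ i (F a) y))
      (fun _ _ => zero_le) (Finset.mem_range.2 (by omega))
  · rw [frechetNorm, iInf_neg hc] at h
    exact absurd h (lt_irrefl _)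

theorem mixedNorm_spec {V : PField d} (h : mixedNorm T V < ∞) :
    (∀ a ∈ Icc 0 T, ContDiff ℝ 2 (V a)) ∧
    ∀ k ≤ 2, supNorm T (frechet V k) + fineTail T (2 - k) (frechet V k) (frechetConst V k)
      ≤ mixedNorm T V := by
  by_cases hc : ∀ a ∈ Icc (0 : ℝ) T, ContDiff ℝ 2 (V a)
  · refine ⟨hc, fun k hk => ?_⟩
    rw [mixedNorm, iInf_pos hc]
    exact Finset.single_le_sum
      (f := fun k => supNorm T (frechet V k) +
        fineTail T (2 - k) (frechet V k) (frechetConst V k))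
      (fun _ _ => zero_le) (Finset.mem_range.2 (by omega))
  · rw [mixedNorm, iInf_neg hc] at h
    exact absurd h (lt_irrefl _)

theorem frechetNorm_le_fineTail_zero {H : ℝ → Type} [∀ a, NormedAddCommGroup (H a)]
    [∀ a, NormedSpace ℝ (H a)] {G : Type} [NormedAddCommGroup G] [NormedSpace ℝ G]
    (F : (a : ℝ) → Pth d a → H a) (Fc : (a : ℝ) → Pth d a → G) :
    frechetNorm T 1 F ≤ fineTail T 0 F Fc := by
  rw [fineTail]
  exact le_self_add

theorem exists_of_fineTail_succ {m : ℕ} {H : ℝ → Type} [∀ a, NormedAddCommGroup (H a)]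
    [∀ a, NormedSpace ℝ (H a)] {G : Type} [NormedAddCommGroup G] [NormedSpace ℝ G]
    {F : (a : ℝ) → Pth d a → H a} {Fc : (a : ℝ) → Pth d a → G}
    (h : fineTail T (m + 1) F Fc < ∞) :
    ∃ F', IsFineDeriv T Fc F' ∧ supNorm T F' < ∞ ∧ fineTail T m F' (alongConst F') < ∞ := by
  rw [fineTail] at h
  obtain ⟨F', hF'⟩ := iInf_lt_iff.1 h
  obtain ⟨hfd, hlt⟩ := iInf_lt_iff.1 hF'
  exact ⟨F', hfd, lt_of_le_of_lt le_self_add hlt, lt_of_le_of_lt le_add_self hlt⟩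

/-- Bounded linear maps commute with the integral. This carries fine derivatives from spaces of
multilinear maps over to `E d` and its endomorphisms. -/
theorem IsFineDeriv.map {G G' : Type} [NormedAddCommGroup G] [NormedSpace ℝ G]
    [NormedAddCommGroup G'] [NormedSpace ℝ G'] [CompleteSpace G] [CompleteSpace G']
    {F : (a : ℝ) → Pth d a → G} {F' : (a : ℝ) → Pth d a → Pth d a →L[ℝ] G}
    (h : IsFineDeriv T F F') (L : G →L[ℝ] G') :
    IsFineDeriv T (fun a y => L (F a y)) (fun a y => L.comp (F' a y)) := by
  refine ⟨fun a ha y z ε hε => ?_, fun a ha y z hyz => ?_⟩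
  · obtain ⟨δ, hδ, hc⟩ := h.cont a ha y z (ε / (‖L‖ + 1)) (by positivity)
    refine ⟨δ, hδ, fun b hb y₁ z₁ h1 h2 => ?_⟩
    have := hc b hb y₁ z₁ h1 h2
    rw [lt_div_iff₀ (by positivity)] at this
    simp only [ContinuousLinearMap.comp_apply]
    rw [← map_sub]
    refine (L.le_opNorm _).trans_lt (lt_of_le_of_lt ?_ this)
    nlinarith [norm_nonneg (F' a y z - F' b y₁ z₁)]
  · rw [h.ftc a ha y z hyz, map_add]
    congr 1
    exact (L.intervalIntegral_comp_comm (((h.continuousOn y z).mono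
      (Icc_subset_Icc_right ha.2)).intervalIntegrable_of_Icc ha.1)).symm

theorem eventually_pathDrift_of_bound {V : PField d} (hL : StronglyLipschitz T V) {N : ℝ≥0∞}
    (hN : N < ∞) (h0 : supNorm T (fun a y => iteratedFDeriv ℝ 0 (V a) y) ≤ N) :
    ∀ᶠ M in atTop, PathDrift T M V := by
  obtain ⟨L, hL⟩ := hL
  filter_upwards [eventually_ge_atTop L, eventually_ge_atTop 0, eventually_le_ofReal hN]
    with M hM hM0 hMN
  refine ⟨fun a ha b hb y z => (hL a ha b hb y z).trans (by gcongr), fun a ha y => ?_⟩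
  have := norm_le_of_supNorm_le hM0 (h0.trans hMN) ha y
  rwa [norm_iteratedFDeriv_zero] at this

theorem eventually_pathDrift {V : PField d} (hL : StronglyLipschitz T V)
    (hN : frechetNorm T 2 V < ∞) : ∀ᶠ M in atTop, PathDrift T M V :=
  eventually_pathDrift_of_bound hL hN ((frechetNorm_spec hN).2 0 (by norm_num))

theorem mixedNorm_supNorm_le {V : PField d} (h : mixedNorm T V < ∞) {k : ℕ} (hk : k ≤ 2) :
    supNorm T (frechet V k) ≤ mixedNorm T V :=
  le_self_add.trans ((mixedNorm_spec h).2 k hk)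

theorem mixedNorm_fineTail_le {V : PField d} (h : mixedNorm T V < ∞) {k : ℕ} (hk : k ≤ 2) :
    fineTail T (2 - k) (frechet V k) (frechetConst V k) ≤ mixedNorm T V :=
  le_add_self.trans ((mixedNorm_spec h).2 k hk)

theorem eventually_pathField {V : PField d} (hL : StronglyLipschitz T V)
    (hN : mixedNorm T V < ∞) : ∀ᶠ M in atTop, PathField T M V := by
  filter_upwards [eventually_pathDrift_of_bound hL hN (mixedNorm_supNorm_le hN (by norm_num)),
    eventually_ge_atTop 0, eventually_le_ofReal hN] with M hD hM0 hMN
  have hc := (mixedNorm_spec hN).1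
  refine ⟨hD, fun a ha => (hc a ha).differentiable (by norm_num), fun a ha y => ?_,
    fun a ha => norm_fderiv_sub_le (hc a ha) fun y =>
      norm_le_of_supNorm_le hM0 ((mixedNorm_supNorm_le hN le_rfl).trans hMN) ha y⟩
  rw [norm_fderiv_eq]
  exact norm_le_of_supNorm_le hM0 ((mixedNorm_supNorm_le hN (k := 1) (by norm_num)).trans hMN) ha y

theorem norm_clm_comp_le {G G' X : Type*} [NormedAddCommGroup G] [NormedSpace ℝ G]
    [NormedAddCommGroup G'] [NormedSpace ℝ G'] [NormedAddCommGroup X] [NormedSpace ℝ X]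
    {L : G →L[ℝ] G'} {A : X →L[ℝ] G} {K M : ℝ} (hA : ‖A‖ ≤ K) (h : ‖L‖ * K ≤ M) :
    ‖L.comp A‖ ≤ M :=
  ((L.opNorm_comp_le A).trans (mul_le_mul_of_nonneg_left hA (norm_nonneg L))).trans h

theorem curryFin1_frechetConst (V : PField d) (a : ℝ) (y : Pth d a) :
    continuousMultilinearCurryFin1 ℝ (E d) (E d) (frechetConst V 1 a y) =
      (fderiv ℝ (V a) y).comp (cstL d a) := by
  refine ContinuousLinearMap.ext fun w => ?_
  rw [continuousMultilinearCurryFin1_apply, frechetConst,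
    ContinuousMultilinearMap.compContinuousLinearMap_apply, frechet, iteratedFDeriv_one_apply]
  rfl

theorem curryFin0_frechetConst (V : PField d) (a : ℝ) (y : Pth d a) :
    continuousMultilinearCurryFin0 ℝ (E d) (E d) (frechetConst V 0 a y) = V a y := by
  rw [continuousMultilinearCurryFin0_apply, frechetConst,
    ContinuousMultilinearMap.compContinuousLinearMap_apply, frechet, iteratedFDeriv_zero_apply]

theorem eventually_fineField_of_map {V : PField d} {K₀ K₁ : Type} [NormedAddCommGroup K₀]
    [NormedSpace ℝ K₀] [CompleteSpace K₀] [NormedAddCommGroup K₁] [NormedSpace ℝ K₁]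
    [CompleteSpace K₁] (L₀ : K₀ →L[ℝ] E d) (L₁ : K₁ →L[ℝ] (E d →L[ℝ] E d))
    {Q₀ : (a : ℝ) → Pth d a → K₀} {Q₁ : (a : ℝ) → Pth d a → K₁}
    (e₀ : ∀ a y, L₀ (Q₀ a y) = V a y)
    (e₁ : ∀ a y, L₁ (Q₁ a y) = (fderiv ℝ (V a) y).comp (cstL d a))
    {F' : (a : ℝ) → Pth d a → Pth d a →L[ℝ] K₀}
    {F'' : (a : ℝ) → Pth d a → Pth d a →L[ℝ] (E d →L[ℝ] K₀)}
    {G' : (a : ℝ) → Pth d a → Pth d a →L[ℝ] K₁}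
    (hF' : IsFineDeriv T Q₀ F') (hF'b : supNorm T F' < ∞)
    (hF'' : IsFineDeriv T (alongConst F') F'') (hF''b : supNorm T F'' < ∞)
    (hG' : IsFineDeriv T Q₁ G') (hG'b : supNorm T G' < ∞)
    (hP : ∀ᶠ M in atTop, PathField T M V) (hA : FineAgreesAtZero T V) :
    ∀ᶠ M in atTop, FineField T M V := by
  let L₀' : (E d →L[ℝ] K₀) →L[ℝ] (E d →L[ℝ] E d) := ContinuousLinearMap.compL ℝ (E d) _ _ L₀
  have i1 : IsFineDeriv T V (fun a y => L₀.comp (F' a y)) := by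
    have := hF'.map L₀
    rwa [show (fun a y => L₀ (Q₀ a y)) = V from funext₂ e₀] at this
  have i2 : IsFineDeriv T (alongConst (fun a y => L₀.comp (F' a y)))
      (fun a y => L₀'.comp (F'' a y)) := hF''.map L₀'
  have i3 : IsFineDeriv T (fun a y => (fderiv ℝ (V a) y).comp (cstL d a))
      (fun a y => L₁.comp (G' a y)) := by
    have := hG'.map L₁
    rwa [show (fun a y => L₁ (Q₁ a y)) = _ from funext₂ e₁] at this
  obtain ⟨K, ⟨⟨hK1, hK2⟩, hK3⟩, hK0⟩ := (((eventually_le_ofReal hF'b).and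
    (eventually_le_ofReal hF''b)).and (eventually_le_ofReal hG'b)).and
    (eventually_ge_atTop 0) |>.exists
  filter_upwards [hP, eventually_ge_atTop (‖L₀‖ * K),
    eventually_ge_atTop (‖L₀'‖ * K), eventually_ge_atTop (‖L₁‖ * K)] with M hP h1 h2 h3
  exact ⟨hP, ⟨_, i1, fun a ha y => norm_clm_comp_le (norm_le_of_supNorm_le hK0 hK1 ha y) h1,
    hA _ i1, _, i2, fun a ha y => norm_clm_comp_le (norm_le_of_supNorm_le hK0 hK2 ha y) h2⟩,
    _, i3, fun a ha y => norm_clm_comp_le (norm_le_of_supNorm_le hK0 hK3 ha y) h3⟩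

/-- From `⦅V⦆`, the term `k = 0` supplies two successive fine derivatives of `V`, and the term `k =
1` a fine derivative of its Fréchet derivative. -/
theorem eventually_fineField {V : PField d} (hL : StronglyLipschitz T V)
    (hN : mixedNorm T V < ∞) (hA : FineAgreesAtZero T V) :
    ∀ᶠ M in atTop, FineField T M V := by
  obtain ⟨F', hF', hF'b, hF't⟩ := exists_of_fineTail_succ (m := 1)
    ((mixedNorm_fineTail_le hN (k := 0) (by norm_num)).trans_lt hN)
  obtain ⟨F'', hF'', hF''b, -⟩ := exists_of_fineTail_succ (m := 0) hF't
  obtain ⟨G', hG', hG'b, -⟩ := exists_of_fineTail_succ (m := 0)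
    ((mixedNorm_fineTail_le hN (k := 1) (by norm_num)).trans_lt hN)
  exact eventually_fineField_of_map
    (continuousMultilinearCurryFin0 ℝ (E d) (E d)).toContinuousLinearEquiv.toContinuousLinearMap
    (continuousMultilinearCurryFin1 ℝ (E d) (E d)).toContinuousLinearEquiv.toContinuousLinearMap
    (curryFin0_frechetConst V) (curryFin1_frechetConst V) hF' hF'b hF'' hF''b hG' hG'b
    (eventually_pathField hL hN) hA

/-- The restriction to paths of length `0` inherits bounds on the derivatives. -/
theorem norm_iteratedFDeriv_classicalField_le {V : PField d} {n : ℕ} (hV : ContDiff ℝ n (V 0))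
    {i : ℕ} (hi : i ≤ n) {M : ℝ} (hM : ∀ y, ‖iteratedFDeriv ℝ i (V 0) y‖ ≤ M) (x : E d) :
    ‖iteratedFDeriv ℝ i (classicalField V) x‖ ≤ M := by
  have h1 : iteratedFDeriv ℝ i (V 0 ∘ cstL d 0) x =
      (iteratedFDeriv ℝ i (V 0) (cstL d 0 x)).compContinuousLinearMap fun _ => cstL d 0 :=
    (cstL d 0).iteratedFDeriv_comp_right hV x (by exact_mod_cast hi)
  have h2 : classicalField V = V 0 ∘ cstL d 0 := rfl
  rw [h2, h1]
  refine (ContinuousMultilinearMap.norm_compContinuousLinearMap_le _ _).trans ?_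
  refine (mul_le_of_le_one_right (norm_nonneg _) ?_).trans (hM _)
  exact Finset.prod_le_one (fun _ _ => norm_nonneg _) (fun _ _ => norm_cstL_le 0)

theorem contDiff_classicalField {V : PField d} {n : ℕ} (hV : ContDiff ℝ n (V 0)) :
    ContDiff ℝ n (classicalField V) := hV.comp (cstL d 0).contDiff

theorem classicalField_boundedLip2 (hT : 0 ≤ T) {V : PField d} {M : ℝ} (hM : 0 ≤ M)
    (h : frechetNorm T 2 V ≤ ENNReal.ofReal M) : BoundedLip2 M (classicalField V) := by
  have hs := frechetNorm_spec (h.trans_lt ENNReal.ofReal_lt_top)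
  have h0 : (0 : ℝ) ∈ Icc 0 T := ⟨le_rfl, hT⟩
  have hc := hs.1 0 h0
  have hb : ∀ i ≤ 2, ∀ x, ‖iteratedFDeriv ℝ i (classicalField V) x‖ ≤ M := fun i hi x =>
    norm_iteratedFDeriv_classicalField_le hc hi (fun y => norm_le_of_supNorm_le hM
      (F := fun a y => iteratedFDeriv ℝ i (V a) y) ((hs.2 i hi).trans h) h0 y) x
  exact boundedLip2_of_contDiff (contDiff_classicalField hc)
    (fun x => by simpa using hb 0 (by norm_num) x) (hb 1 (by norm_num)) (hb 2 le_rfl)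

theorem contDiff_three_of_iteratedFDeriv_two {X Y : Type*} [NormedAddCommGroup X]
    [NormedSpace ℝ X] [NormedAddCommGroup Y] [NormedSpace ℝ Y] {u : X → Y} (hu : ContDiff ℝ 2 u)
    (hu2 : ContDiff ℝ 1 (iteratedFDeriv ℝ 2 u)) : ContDiff ℝ 3 u := by
  have h2 := (contDiff_nat_iff_continuous_differentiable (𝕜 := ℝ) (n := 2) (f := u)).1 hu
  refine (contDiff_nat_iff_continuous_differentiable (𝕜 := ℝ) (n := 3) (f := u)).2
    ⟨fun m hm => ?_, fun m hm => ?_⟩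
  · rcases Nat.lt_or_ge m 3 with h | h
    · exact h2.1 m (by omega)
    · obtain rfl : m = 3 := by omega
      rw [iteratedFDeriv_succ_eq_comp_left]
      exact (LinearIsometryEquiv.continuous _).comp (hu2.continuous_fderiv (by norm_num))
  · rcases Nat.lt_or_ge m 2 with h | h
    · exact h2.2 m h
    · obtain rfl : m = 2 := by omega
      exact hu2.differentiable (by norm_num)

/-- The third derivative is controlled by the term `k = 2` of `⦅V⦆`, which contains the Fréchet
`C^1` norm of the second derivative. -/
theorem classicalField_of_mixedNorm_le (hT : 0 ≤ T) {V : PField d} {M : ℝ} (hM : 0 ≤ M)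
    (h : mixedNorm T V ≤ ENNReal.ofReal M) : BoundedLip2 M (classicalField V) ∧
      Differentiable ℝ (classicalField V) ∧ BoundedLip2 M (fderiv ℝ (classicalField V)) := by
  have hlt := h.trans_lt ENNReal.ofReal_lt_top
  have h0 : (0 : ℝ) ∈ Icc 0 T := ⟨le_rfl, hT⟩
  have hF : frechetNorm T 1 (frechet V 2) ≤ ENNReal.ofReal M :=
    ((frechetNorm_le_fineTail_zero _ _).trans (mixedNorm_fineTail_le hlt (k := 2) le_rfl)).trans h
  have hs := frechetNorm_spec (hF.trans_lt ENNReal.ofReal_lt_top)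
  have hc : ContDiff ℝ 3 (V 0) := contDiff_three_of_iteratedFDeriv_two
    ((mixedNorm_spec hlt).1 0 h0) (hs.1 0 h0)
  have hb : ∀ i ≤ 3, ∀ x, ‖iteratedFDeriv ℝ i (classicalField V) x‖ ≤ M := by
    intro i hi x
    refine norm_iteratedFDeriv_classicalField_le hc hi (fun y => ?_) x
    rcases Nat.lt_or_ge i 3 with hi' | hi'
    · exact norm_le_of_supNorm_le hM ((mixedNorm_supNorm_le hlt (k := i) (by omega)).trans h) h0 y
    · obtain rfl : i = 3 := by omega
      have := norm_le_of_supNorm_le hM ((hs.2 1 le_rfl).trans hF) h0 y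
      rw [← norm_fderiv_eq] at this
      rwa [← norm_fderiv_iteratedFDeriv]
  have hcc : ContDiff ℝ 3 (classicalField V) := contDiff_classicalField hc
  refine ⟨boundedLip2_of_contDiff (hcc.of_le (by norm_num))
    (fun x => by simpa using hb 0 (by norm_num) x) (hb 1 (by norm_num)) (hb 2 (by norm_num)),
    hcc.differentiable (by norm_num),
    boundedLip2_of_contDiff (hcc.fderiv_right (m := 2) (by norm_num)) (fun x => ?_)
      (fun x => ?_) (fun x => ?_)⟩
  · rw [norm_fderiv_eq]; exact hb 1 (by norm_num) x
  · rw [norm_iteratedFDeriv_fderiv]; exact hb 2 (by norm_num) x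
  · rw [norm_iteratedFDeriv_fderiv]; exact hb 3 (by norm_num) x

end Norms
-- Fields that depend only on the endpoint
section Endpoint

variable {d ℓ : ℕ} {T p : ℝ}

/-- The path may be replaced by the constant path at its endpoint. Constant paths of lengths `u` and
`0` have the same extension, so strong Lipschitz continuity removes the dependence on `u`. -/
theorem eq_classicalField {V : PField d} (hL : StronglyLipschitz T V)
    (hE : DependsOnlyOnEndpoint T V) {u : ℝ} (hu : u ∈ Icc 0 T) (y : Pth d u) :
    V u y = classicalField V (y ⟨u, hu.1, le_rfl⟩) := by
  obtain ⟨L, hL⟩ := hL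
  set x := y ⟨u, hu.1, le_rfl⟩ with hx
  rw [hE u hu y (cst u x) rfl]
  have h0 : (0 : ℝ) ∈ Icc 0 T := ⟨le_rfl, hu.1.trans hu.2⟩
  have h1 := hL u hu 0 h0 (cst u x) (cst 0 x)
  have h2 : stopped T hu.1 (cst u x) - stopped T h0.1 (cst 0 x) = 0 := sub_self (cst T x)
  rw [h2, norm_zero, mul_zero] at h1
  exact sub_eq_zero.1 (norm_le_zero_iff.1 h1)

/-- Along the line `x + t w` the field is a function of the endpoint; its derivative at `t = 0` is
computed by the chain rule and by differentiating the integral formula, and the two results must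
agree. -/
theorem fineAgreesAtZero_of_dependsOnlyOnEndpoint (hT : 0 < T) {V : PField d}
    (hL : StronglyLipschitz T V) (hE : DependsOnlyOnEndpoint T V)
    (hd : Differentiable ℝ (V 0)) : FineAgreesAtZero T V := by
  intro V' hV' x w
  rw [← fderiv_classicalField (hd _)]
  have hdc : Differentiable ℝ (classicalField V) := hd.comp (cstL d 0).differentiable
  let y : C(ℝ, E d) := ⟨fun t => x + t • w, by fun_prop⟩
  let z : C(ℝ, E d) := ContinuousMap.const _ w
  have hy : ∀ t, HasDerivAt y w t := fun t => by
    have := ((hasDerivAt_id t).smul_const w).const_add x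
    rwa [one_smul] at this
  let g : ℝ → E d := fun r =>
    (fun r => V' r (seg y r) (seg z r)) (projIcc (0 : ℝ) T hT.le r)
  have hg : Continuous g := (hV'.continuousOn y z).comp_continuous
    (continuous_subtype_val.comp continuous_projIcc) (fun r => (projIcc (0 : ℝ) T hT.le r).2)
  have hgr : ∀ r ∈ Icc 0 T, g r = V' r (seg y r) (seg z r) := by
    intro r hr
    simp only [g]
    rw [projIcc_of_mem _ hr]
  have h0 : (0 : ℝ) ∈ Icc 0 T := ⟨le_rfl, hT.le⟩
  have hval : ∀ a ∈ Icc 0 T, classicalField V (y a) =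
      V 0 (seg y 0) + ∫ r in (0 : ℝ)..a, g r := by
    intro a ha
    have h1 := hV'.ftc a ha y z (fun t _ => (hy t).hasDerivWithinAt)
    rw [eq_classicalField hL hE ha] at h1
    have h2 : (seg y a) ⟨a, ha.1, le_rfl⟩ = y a := rfl
    rw [h2] at h1
    rw [h1]
    congr 1
    refine intervalIntegral.integral_congr fun r hr => ?_
    rw [uIcc_of_le ha.1] at hr
    exact (hgr r ⟨hr.1, hr.2.trans ha.2⟩).symm
  have d1 : HasDerivWithinAt (fun a => classicalField V (y a)) (g 0) (Icc 0 T) 0 :=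
    ((intervalIntegral.integral_hasDerivAt_right (hg.intervalIntegrable _ _)
      (hg.stronglyMeasurableAtFilter _ _) hg.continuousAt).const_add
      (V 0 (seg y 0))).hasDerivWithinAt.congr hval (hval 0 h0)
  have d2 : HasDerivWithinAt (fun a => classicalField V (y a))
      (fderiv ℝ (classicalField V) (y 0) w) (Icc 0 T) 0 :=
    ((hdc (y 0)).hasFDerivAt.comp_hasDerivAt 0 (hy 0)).hasDerivWithinAt
  have huniq := (uniqueDiffOn_Icc hT 0 h0).eq_deriv _ d1 d2
  have hy0 : y 0 = x := by simp [y]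
  rw [hgr 0 h0, seg_zero, seg_zero, hy0] at huniq
  exact huniq

/-- Adding a constant path moves the endpoint by the same vector, so `along` becomes an ordinary
directional derivative. -/
theorem bracket_eq_lieBracket {V W : PField d} (hLV : StronglyLipschitz T V)
    (hEV : DependsOnlyOnEndpoint T V) (hdV : Differentiable ℝ (classicalField V))
    (hLW : StronglyLipschitz T W) (hEW : DependsOnlyOnEndpoint T W)
    (hdW : Differentiable ℝ (classicalField W)) {u : ℝ} (hu : u ∈ Icc 0 T) (y : Pth d u) :
    bracket V W u y = VectorField.lieBracket ℝ (classicalField V) (classicalField W)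
      (y ⟨u, hu.1, le_rfl⟩) := by
  have key : ∀ {V W : PField d}, StronglyLipschitz T V → DependsOnlyOnEndpoint T V →
      StronglyLipschitz T W → DependsOnlyOnEndpoint T W → Differentiable ℝ (classicalField W) →
      along V W u y = fderiv ℝ (classicalField W) (y ⟨u, hu.1, le_rfl⟩)
        (classicalField V (y ⟨u, hu.1, le_rfl⟩)) := by
    intro V W hLV hEV hLW hEW hdW
    simp only [along]
    rw [eq_classicalField hLV hEV hu]
    set x := y ⟨u, hu.1, le_rfl⟩ with hx
    set w := classicalField V x
    have e : (fun ε : ℝ => W u (y + ε • cst u w)) = fun ε : ℝ => classicalField W (x + ε • w) := by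
      funext ε
      rw [eq_classicalField hLW hEW hu]
      rfl
    rw [e]
    have h1 : HasDerivAt (fun ε : ℝ => x + ε • w) w 0 := by
      simpa using ((hasDerivAt_id (0 : ℝ)).smul_const w).const_add x
    have h2 : HasFDerivAt (classicalField W) (fderiv ℝ (classicalField W) x) (x + (0 : ℝ) • w) := by
      rw [zero_smul, add_zero]
      exact (hdW x).hasFDerivAt
    exact (h2.comp_hasDerivAt (0 : ℝ) h1).deriv
  rw [VectorField.lieBracket_eq]
  simp only [bracket]
  rw [key hLV hEV hLW hEW hdW, key hLW hEW hLV hEV hdV]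

theorem timeOne_iff_timeOneClassical (hT : 1 ≤ T) {h : ℝ → ℝ} {XR : RoughPath ℓ p T}
    {V : PField d} {F : Fin ℓ → PField d} (hLV : StronglyLipschitz T V)
    (hEV : DependsOnlyOnEndpoint T V) (hLF : ∀ i, StronglyLipschitz T (F i))
    (hEF : ∀ i, DependsOnlyOnEndpoint T (F i))
    (hd : ∀ i, Differentiable ℝ (classicalField (F i))) (s t : ℝ) (x x' : E d) :
    TimeOne (drivenField h XR V F s t) x x' ↔
      TimeOneClassical (drivenClassical h XR (classicalField V) (fun i => classicalField (F i)) s t)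
        x x' := by
  have key : ∀ (y : C(ℝ, E d)), ∀ u ∈ Icc (0 : ℝ) 1, drivenField h XR V F s t u (seg y u) =
      drivenClassical h XR (classicalField V) (fun i => classicalField (F i)) s t (y u) := by
    intro y u hu
    have huT : u ∈ Icc 0 T := ⟨hu.1, hu.2.trans hT⟩
    simp only [drivenField, drivenClassical]
    rw [eq_classicalField hLV hEV huT]
    simp only [fun i => eq_classicalField (hLF i) (hEF i) huT (seg y u),
      fun j k => bracket_eq_lieBracket (hLF j) (hEF j) (hd j) (hLF k) (hEF k) (hd k) huT (seg y u)]
    rfl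
  constructor
  · rintro ⟨y, h0, h1, hy⟩
    exact ⟨y, h0, h1, fun u hu => key y u hu ▸ hy u hu⟩
  · rintro ⟨y, h0, h1, hy⟩
    exact ⟨y, h0, h1, fun u hu => (key y u hu).symm ▸ hy u hu⟩

end Endpoint

/-! ### Solution flows from the Euler scheme -/

section Solution

variable {d ℓ : ℕ} {T p α γ : ℝ} {h : ℝ → ℝ} {XR : RoughPath ℓ p T}

/-- A Lipschitz flow close to the Euler scheme is the only flow close to any family of maps that
is close to the Euler scheme. -/
theorem isTheFlowCloseTo_of_euler (hT : 0 ≤ T) (hγ : 1 < γ) {μ : ℝ → ℝ → E d → E d → Prop}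
    {v : E d → E d} {f : Fin ℓ → E d → E d} {φ : ℝ → ℝ → E d → E d} (hφ : IsFlow T φ)
    {C C' δ δ' K : ℝ} (hC : 0 ≤ C) (hC' : 0 ≤ C') (hδ : 0 < δ) (hδ' : 0 < δ') (hK0 : 0 ≤ K)
    (hφE : ∀ s t, 0 ≤ s → s ≤ t → t ≤ T → t - s ≤ δ →
      ∀ x, ‖φ t s x - eulerMap h XR v f t s x‖ ≤ C * (t - s) ^ γ)
    (hK : ∀ s t, 0 ≤ s → s ≤ t → t ≤ T → ∀ x y, ‖φ t s x - φ t s y‖ ≤ K * ‖x - y‖)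
    (hμ : ∀ s t, 0 ≤ s → s ≤ t → t ≤ T → t - s ≤ δ' → ∀ x, (∃ x', μ s t x x') ∧
      ∀ x', μ s t x x' → ‖x' - eulerMap h XR v f t s x‖ ≤ C' * (t - s) ^ γ) :
    IsTheFlowCloseTo T γ μ φ := by
  refine ⟨⟨hφ, C + C' + 1, by positivity, min δ δ', lt_min hδ hδ', fun s t hs hst ht hτ x => ?_⟩,
    fun γ' hγ' ψ hψ => ?_⟩
  · obtain ⟨⟨x', hx'⟩, hcl⟩ := hμ s t hs hst ht (hτ.trans (min_le_right _ _)) x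
    refine ⟨x', hx', ?_⟩
    have h1 := hφE s t hs hst ht (hτ.trans (min_le_left _ _)) x
    have h2 := hcl x' hx'
    rw [norm_sub_rev] at h2
    have h3 := norm_sub_le_norm_sub_add_norm_sub (φ t s x) (eulerMap h XR v f t s x) x'
    have h4 : 0 ≤ (t - s) ^ γ := Real.rpow_nonneg (by linarith) _
    linarith
  · obtain ⟨hψf, c, hc, η, hη, hψμ⟩ := hψ
    -- On intervals of length at most `1` the smaller exponent dominates, and it still exceeds `1`.
    set g := min γ γ' with hg
    have hg1 : 1 < g := lt_min hγ hγ'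
    set B := C + C' + c with hB
    have hB0 : 0 ≤ B := by positivity
    have hshort : ∀ s t, 0 ≤ s → s ≤ t → t ≤ T → t - s ≤ min (min δ δ') (min η 1) →
        ∀ x, ‖ψ t s x - φ t s x‖ ≤ B * (t - s) ^ g ∧
          ‖ψ t s x - eulerMap h XR v f t s x‖ ≤ B * (t - s) ^ g := by
      intro s t hs hst ht hτ x
      have t1 : t - s ≤ δ := hτ.trans ((min_le_left _ _).trans (min_le_left _ _))
      have t2 : t - s ≤ δ' := hτ.trans ((min_le_left _ _).trans (min_le_right _ _))
      have t3 : t - s ≤ η := hτ.trans ((min_le_right _ _).trans (min_le_left _ _))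
      have t4 : t - s ≤ 1 := hτ.trans ((min_le_right _ _).trans (min_le_right _ _))
      have t0 : 0 ≤ t - s := by linarith
      obtain ⟨x', hx', h1⟩ := hψμ s t hs hst ht t3 x
      have h2 := (hμ s t hs hst ht t2 x).2 x' hx'
      have h3 := hφE s t hs hst ht t1 x
      have p1 : (t - s) ^ γ ≤ (t - s) ^ g :=
        Real.rpow_le_rpow_of_exponent_ge_of_imp t0 t4 (min_le_left _ _)
          (fun _ h => absurd h (by linarith))
      have p2 : (t - s) ^ γ' ≤ (t - s) ^ g :=
        Real.rpow_le_rpow_of_exponent_ge_of_imp t0 t4 (min_le_right _ _)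
          (fun _ h => absurd h (by linarith))
      have q1 := mul_le_mul_of_nonneg_left p1 hC
      have q2 := mul_le_mul_of_nonneg_left p1 hC'
      have q3 := mul_le_mul_of_nonneg_left p2 hc.le
      have n1 := norm_sub_le_norm_sub_add_norm_sub (ψ t s x) x' (eulerMap h XR v f t s x)
      have n2 := norm_sub_le_norm_sub_add_norm_sub (ψ t s x) (eulerMap h XR v f t s x) (φ t s x)
      rw [norm_sub_rev (eulerMap h XR v f t s x)] at n2
      have n3 := mul_nonneg hC (Real.rpow_nonneg t0 g)
      rw [hB]
      constructor <;> linarith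
    have hmin : 0 < min (min δ δ') (min η 1) := by positivity
    -- Flows are not assumed to satisfy `ψ s s = id`; it follows from the error bound at `t = s`,
    -- where `0 ^ g = 0`.
    have hψ0 : ∀ s, 0 ≤ s → s ≤ T → ∀ x, ψ s s x = x := by
      intro s hs hsT x
      have := (hshort s s hs le_rfl hsT (by rw [sub_self]; exact hmin.le) x).2
      rw [sub_self, Real.zero_rpow (by linarith), mul_zero, eulerMap_self hs hsT] at this
      exact sub_eq_zero.1 (norm_le_zero_iff.1 this)
    have hφ0 : ∀ s, 0 ≤ s → s ≤ T → ∀ x, φ s s x = x := by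
      intro s hs hsT x
      have := hφE s s hs le_rfl hsT (by rw [sub_self]; exact hδ.le) x
      rw [sub_self, Real.zero_rpow (by linarith), mul_zero, eulerMap_self hs hsT] at this
      exact sub_eq_zero.1 (norm_le_zero_iff.1 this)
    intro s t hs hst ht
    funext x
    have hlim := tendsto_nat_mul_div_rpow hg1 (K * B) T hT
    have hsm : ∀ᶠ n : ℕ in atTop, T / n ≤ min (min δ δ') (min η 1) :=
      (tendsto_const_div_atTop_nhds_zero_nat T).eventually (ge_mem_nhds hmin)
    have hle : ‖ψ t s x - φ t s x‖ ≤ 0 := by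
      refine ge_of_tendsto hlim ?_
      filter_upwards [hsm, eventually_gt_atTop 0] with n hn hn0
      refine (flow_dist_le (e := B * (T / n) ^ g) hφ hψf hφ0 hψ0 hK0 hK hn0
        (fun s t hs hst ht hτ x => ?_) hs hst ht x).trans (le_of_eq (by ring))
      refine ((hshort s t hs hst ht (hτ.trans hn) x).1).trans ?_
      exact mul_le_mul_of_nonneg_left (Real.rpow_le_rpow (by linarith) hτ (by linarith)) hB0
    exact sub_eq_zero.1 (norm_le_zero_iff.1 hle)

/-- The time one maps of regular fields exist on short intervals and are close to the Euler
scheme. -/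
theorem exists_timeOne_close_euler (hT : 1 ≤ T) (hp : 2 ≤ p) (hα : 1 < α + 1 / p) {H : ℝ}
    (hH : 0 ≤ H) (hb : DriverBound α h XR H) {V : PField d} {F : Fin ℓ → PField d}
    (hreg : Regular T V F) (hfine : ∀ i, FineAgreesAtZero T (F i)) :
    ∃ C δ, 0 ≤ C ∧ 0 < δ ∧ ∀ s t, 0 ≤ s → s ≤ t → t ≤ T → t - s ≤ δ → ∀ x,
      (∃ x', TimeOne (drivenField h XR V F s t) x x') ∧
      ∀ x', TimeOne (drivenField h XR V F s t) x x' →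
        ‖x' - eulerMap h XR (classicalField V) (fun i => classicalField (F i)) t s x‖ ≤
          C * (t - s) ^ (min (3 / p) (α + 1 / p)) := by
  have hp0 : 0 < p := by linarith
  obtain ⟨M, ⟨hV, hF⟩, hM⟩ := (((eventually_pathDrift hreg.drift_lip hreg.drift_norm).and
    (eventually_all.2 fun i => eventually_fineField (hreg.field_lip i) (hreg.field_norm i)
      (hfine i))).and (eventually_ge_atTop 0)).exists
  obtain ⟨C, hC, hclose⟩ := exists_timeOne_close (d := d) (XR := XR) (h := h) hT hM hH
  -- On intervals of length at most `δ` the driven field has Lipschitz constant at most `1/2`, as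
  -- the Picard iteration requires; `e` has been replaced by `2 r`.
  obtain ⟨δ, ⟨hδ1, hδ2⟩, hδ0⟩ : ∃ δ : ℝ,
      ((H * 2 * M + ℓ * (H * M) + ℓ ^ 2 * (H * 2 * (4 * M * M))) * δ ^ (1 / p) ≤ 1 / 2 ∧ δ ≤ 1) ∧
        0 < δ :=
    (((exists_pos_mul_rpow_le _ (by positivity) (by norm_num)).and
      (mem_nhdsWithin_of_mem_nhds (Iic_mem_nhds one_pos))).and self_mem_nhdsWithin).exists
  refine ⟨C * 2, δ, by positivity, hδ0, fun s t hs hst ht hτ x => ⟨?_, fun x' hx' => ?_⟩⟩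
  · have sc := scales (τ := δ) hp hα hδ0.le hδ2
    refine exists_timeOne_drivenField hT hV (fun i => (hF i).toPathField) hM
      (hb.incr hH hp hα hs hst ht hτ) hH sc.e_nonneg sc.r_nonneg (le_trans ?_ hδ1) x
    set e := δ ^ α + δ ^ (2 / p)
    set r := δ ^ (1 / p)
    have he := sc.e_le
    have h1 : H * e * M ≤ H * (2 * r) * M := by gcongr
    have h2 : ℓ ^ 2 * (H * e * (4 * M * M)) ≤ ℓ ^ 2 * (H * (2 * r) * (4 * M * M)) := by gcongr
    linarith
  · have sc := scales (τ := t - s) hp hα (by linarith) (by linarith)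
    refine (hclose V F hV hF _ _ s t sc.e_nonneg sc.r_nonneg sc.r_sq sc.e_le hs hst ht
      (hb.incr hH hp hα hs hst ht le_rfl) x x' hx').trans ?_
    rw [mul_assoc C]
    exact mul_le_mul_of_nonneg_left sc.mul_le hC

theorem Regular.eventually_smoothFields (hT : 0 ≤ T) {V : PField d} {F : Fin ℓ → PField d}
    (hreg : Regular T V F) :
    ∀ᶠ G in atTop, SmoothFields G (classicalField V) (fun i => classicalField (F i)) := by
  filter_upwards [eventually_ge_atTop 0, eventually_le_ofReal hreg.drift_norm,
    eventually_all.2 fun i => eventually_le_ofReal (hreg.field_norm i)] with G hG h1 h2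
  have h3 := fun i => classicalField_of_mixedNorm_le hT hG (h2 i)
  exact ⟨classicalField_boundedLip2 hT hG h1, fun i => (h3 i).1, fun i => (h3 i).2.1,
    fun i => (h3 i).2.2⟩

theorem SmoothFields.add {G ε : ℝ} {v v' : E d → E d} {f f' : Fin ℓ → E d → E d}
    (h : SmoothFields G v f) (h' : SmoothFields ε v' f') :
    SmoothFields (G + ε) (fun x => v x + v' x) (fun i x => f i x + f' i x) := by
  refine ⟨⟨h.drift.toBoundedLip.add h'.drift.toBoundedLip, h.drift.second.add h'.drift.second⟩,
    fun i => ⟨(h.field i).toBoundedLip.add (h'.field i).toBoundedLip,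
      (h.field i).second.add (h'.field i).second⟩, fun i => (h.diff i).add (h'.diff i),
    fun i => ?_⟩
  have e : fderiv ℝ (fun x => f i x + f' i x) = fun x => fderiv ℝ (f i) x + fderiv ℝ (f' i) x := by
    funext x
    exact fderiv_add (h.diff i x) (h'.diff i x)
  rw [e]
  exact ⟨(h.deriv i).toBoundedLip.add (h'.deriv i).toBoundedLip,
      (h.deriv i).second.add (h'.deriv i).second⟩

theorem norm_eulerMap_sub_le {G ε H e r s t : ℝ} {v v' : E d → E d} {f f' : Fin ℓ → E d → E d}
    (hS : SmoothFields G v f) (hS' : SmoothFields ε v' f') (hG : 0 ≤ G) (hε : 0 ≤ ε)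
    (hI : IncrBound h XR H e r s t) (hH : 0 ≤ H) (he : 0 ≤ e) (hr : 0 ≤ r) (x : E d) :
    ‖eulerMap h XR (fun x => v x + v' x) (fun i x => f i x + f' i x) t s x
      - eulerMap h XR v f t s x‖ ≤
      (H * e + ℓ * (H * r) + ℓ ^ 2 * (H * e * (2 * (2 * G + ε)))) * ε := by
  -- The factor `2` compensates the `1/2` in `norm_driver_le`; the Euler scheme has none in front of
  -- `𝕏`.
  have hx₂ : ∀ j k, ‖(2 : ℝ) • (fderiv ℝ (fun x => f k x + f' k x) x (f j x + f' j x)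
      - fderiv ℝ (f k) x (f j x))‖ ≤ 2 * (2 * G + ε) * ε := by
    intro j k
    have e1 : fderiv ℝ (fun x => f k x + f' k x) x (f j x + f' j x) - fderiv ℝ (f k) x (f j x) =
        fderiv ℝ (f k) x (f' j x) + fderiv ℝ (f' k) x (f j x) + fderiv ℝ (f' k) x (f' j x) := by
      rw [fderiv_fun_add (hS.diff k x) (hS'.diff k x)]
      simp only [FunLike.coe_add, Pi.add_apply, map_add]
      abel
    have b1 := (ContinuousLinearMap.le_opNorm (fderiv ℝ (f k) x) (f' j x)).trans
      (mul_le_mul ((hS.deriv k).bound x) ((hS'.field j).bound x) (norm_nonneg _) hG)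
    have b2 := (ContinuousLinearMap.le_opNorm (fderiv ℝ (f' k) x) (f j x)).trans
      (mul_le_mul ((hS'.deriv k).bound x) ((hS.field j).bound x) (norm_nonneg _) hε)
    have b3 := (ContinuousLinearMap.le_opNorm (fderiv ℝ (f' k) x) (f' j x)).trans
      (mul_le_mul ((hS'.deriv k).bound x) ((hS'.field j).bound x) (norm_nonneg _) hε)
    rw [norm_smul, Real.norm_of_nonneg zero_le_two, e1]
    have := norm_add₃_le (a := fderiv ℝ (f k) x (f' j x)) (b := fderiv ℝ (f' k) x (f j x))
      (c := fderiv ℝ (f' k) x (f' j x))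
    linarith
  have key := norm_driver_le hI hH he hr (hS'.drift.bound x) (fun i => (hS'.field i).bound x) hx₂
  have e2 : eulerMap h XR (fun x => v x + v' x) (fun i x => f i x + f' i x) t s x
      - eulerMap h XR v f t s x = (h t - h s) • v' x + ∑ i, XR.X t s i • f' i x
      + (1 / 2 : ℝ) • ∑ j, ∑ k, XR.XX t s j k •
        (2 : ℝ) • (fderiv ℝ (fun x => f k x + f' k x) x (f j x + f' j x)
          - fderiv ℝ (f k) x (f j x)) := by
    simp only [smul_comm _ (2 : ℝ), ← Finset.smul_sum]
    rw [smul_smul]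
    norm_num only [one_smul]
    simp only [eulerMap, eulerIncr, smul_add, smul_sub, Finset.sum_add_distrib,
      Finset.sum_sub_distrib]
    abel
  rw [e2]
  refine key.trans (le_of_eq ?_)
  ring

end Solution
-- Stability under perturbation of the fields
section Stability

variable {d ℓ : ℕ} {T p α : ℝ} {h : ℝ → ℝ} {XR : RoughPath ℓ p T}

theorem classicalField_add_sub (V W : PField d) :
    (fun x => classicalField V x + classicalField (W - V) x) = classicalField W := by
  funext x
  simp [classicalField]

theorem eventually_smoothFields_sub (hT : 0 ≤ T) {Λ : Type*} {l : Filter Λ} {Vl : Λ → PField d}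
    {Fl : Λ → Fin ℓ → PField d} {V : PField d} {F : Fin ℓ → PField d}
    (hV : Tendsto (fun a => frechetNorm T 2 (Vl a - V)) l (𝓝 0))
    (hF : ∀ i, Tendsto (fun a => mixedNorm T (Fl a i - F i)) l (𝓝 0)) {ε : ℝ} (hε : 0 < ε) :
    ∀ᶠ a in l, SmoothFields ε (classicalField (Vl a - V))
      (fun i => classicalField (Fl a i - F i)) := by
  have hε' : (0 : ℝ≥0∞) < ENNReal.ofReal ε := ENNReal.ofReal_pos.2 hε
  filter_upwards [hV.eventually (ge_mem_nhds hε'),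
    eventually_all.2 fun i => (hF i).eventually (ge_mem_nhds hε')] with a h1 h2
  have h3 := fun i => classicalField_of_mixedNorm_le hT hε.le (h2 i)
  exact ⟨classicalField_boundedLip2 hT hε.le h1, fun i => (h3 i).1, fun i => (h3 i).2.1,
    fun i => (h3 i).2.2⟩

/-- Two flows close to the Euler schemes of two nearby systems of fields are close. -/
theorem norm_flow_sub_le (hT : 1 ≤ T) (hp : 2 ≤ p) (hα : 1 < α + 1 / p) {H G ε γ : ℝ}
    (hH : 0 ≤ H) (hb : DriverBound α h XR H) (hG : 0 ≤ G) (hε : 0 ≤ ε) (hε1 : ε ≤ 1)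
    (hγ : 1 < γ) {v v' : E d → E d} {f f' : Fin ℓ → E d → E d} (hS : SmoothFields G v f)
    (hS' : SmoothFields ε v' f') {φ ψ : ℝ → ℝ → E d → E d} (hφ : IsFlow T φ) (hψ : IsFlow T ψ)
    {C δ K : ℝ} (hC : 0 ≤ C) (hδ : 0 < δ) (hK0 : 0 ≤ K)
    (hφE : ∀ s t, 0 ≤ s → s ≤ t → t ≤ T → t - s ≤ δ →
      ∀ x, ‖φ t s x - eulerMap h XR v f t s x‖ ≤ C * (t - s) ^ γ)
    (hψE : ∀ s t, 0 ≤ s → s ≤ t → t ≤ T → t - s ≤ δ →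
      ∀ x, ‖ψ t s x - eulerMap h XR (fun x => v x + v' x) (fun i x => f i x + f' i x) t s x‖
        ≤ C * (t - s) ^ γ)
    (hK : ∀ s t, 0 ≤ s → s ≤ t → t ≤ T → ∀ x y, ‖φ t s x - φ t s y‖ ≤ K * ‖x - y‖)
    {n : ℕ} (hn : 0 < n) (hnδ : T / n ≤ δ) {s t : ℝ} (hs : 0 ≤ s) (hst : s ≤ t) (ht : t ≤ T)
    (x : E d) :
    ‖ψ t s x - φ t s x‖ ≤ n * (2 * K * C * (T / n) ^ γ) +
      n * (K * (H * (T ^ α + T ^ (2 / p)) + ℓ * (H * T ^ (1 / p))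
        + ℓ ^ 2 * (H * (T ^ α + T ^ (2 / p)) * (2 * (2 * G + 1))))) * ε := by
  have hself : ∀ {χ : ℝ → ℝ → E d → E d} {w : E d → E d} {g : Fin ℓ → E d → E d},
      (∀ s t, 0 ≤ s → s ≤ t → t ≤ T → t - s ≤ δ →
        ∀ x, ‖χ t s x - eulerMap h XR w g t s x‖ ≤ C * (t - s) ^ γ) →
      ∀ s, 0 ≤ s → s ≤ T → ∀ x, χ s s x = x := by
    intro χ w g hχ s hs hsT x
    have := hχ s s hs le_rfl hsT (by rw [sub_self]; exact hδ.le) x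
    rw [sub_self, Real.zero_rpow (by linarith), mul_zero, eulerMap_self hs hsT] at this
    exact sub_eq_zero.1 (norm_le_zero_iff.1 this)
  have hT0 : 0 ≤ T := by linarith
  set e := T ^ α + T ^ (2 / p) with he
  set r := T ^ (1 / p) with hr
  have he0 : 0 ≤ e := by positivity
  have hr0 : 0 ≤ r := by positivity
  set B := H * e + ℓ * (H * r) + ℓ ^ 2 * (H * e * (2 * (2 * G + 1))) with hB
  -- The local error consists of two distances to Euler schemes and the distance between the
  -- schemes. For the latter the increments are crudely bounded by those over length `T`; this is
  -- harmless, as `n` is fixed before `ε` tends to `0`.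
  refine (flow_dist_le (e := 2 * C * (T / n) ^ γ + B * ε) hφ hψ (hself hφE) (hself hψE) hK0 hK hn
    (fun s t hs hst ht hτ x => ?_) hs hst ht x).trans (le_of_eq (by ring))
  have h1 := hφE s t hs hst ht (hτ.trans hnδ) x
  have h2 := hψE s t hs hst ht (hτ.trans hnδ) x
  have h3 := norm_eulerMap_sub_le hS hS' hG hε (hb.incr hH hp hα hs hst ht
    (show t - s ≤ T by linarith)) hH he0 hr0 x
  have h4 : (H * e + ℓ * (H * r) + ℓ ^ 2 * (H * e * (2 * (2 * G + ε)))) * ε ≤ B * ε := by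
    rw [hB]; gcongr
  have h5 : C * (t - s) ^ γ ≤ C * (T / n) ^ γ :=
    mul_le_mul_of_nonneg_left (Real.rpow_le_rpow (by linarith) hτ (by linarith)) hC
  rw [norm_sub_rev] at h1
  have n1 := norm_sub_le_norm_sub_add_norm_sub (ψ t s x)
    (eulerMap h XR (fun x => v x + v' x) (fun i x => f i x + f' i x) t s x) (φ t s x)
  have n2 := norm_sub_le_norm_sub_add_norm_sub
    (eulerMap h XR (fun x => v x + v' x) (fun i x => f i x + f' i x) t s x)
    (eulerMap h XR v f t s x) (φ t s x)
  linarith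

end Stability
end PathRDE

/-! ### The vanishing delay limit -/

theorem mainTheorem7 {d ℓ : ℕ} {T p α : ℝ} (hT : 1 ≤ T) (hp : 2 ≤ p) (hp3 : p < 3)
    (hα : 1 < α + 1 / p)
    (h : ℝ → ℝ)
    (hh : ∃ C : ℝ, ∀ s t, 0 ≤ s → s ≤ t → t ≤ T → |h t - h s| ≤ C * (t - s) ^ α)
    (XR : PathRDE.RoughPath ℓ p T)
    {Λ : Type*} (l : Filter Λ)
    (Vl : Λ → PathRDE.PField d) (Fl : Λ → Fin ℓ → PathRDE.PField d)
    (V : PathRDE.PField d) (F : Fin ℓ → PathRDE.PField d)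
    (hregl : ∀ a, PathRDE.Regular T (Vl a) (Fl a))
    (hfine : ∀ a i, PathRDE.FineAgreesAtZero T (Fl a i))
    (hreg : PathRDE.Regular T V F)
    (hV : Tendsto (fun a => PathRDE.frechetNorm T 2 (Vl a - V)) l (𝓝 0))
    (hF : ∀ i, Tendsto (fun a => PathRDE.mixedNorm T (Fl a i - F i)) l (𝓝 0))
    (hVend : PathRDE.DependsOnlyOnEndpoint T V)
    (hFend : ∀ i, PathRDE.DependsOnlyOnEndpoint T (F i)) :
    ∃ (φl : Λ → ℝ → ℝ → PathRDE.E d → PathRDE.E d) (φ : ℝ → ℝ → PathRDE.E d → PathRDE.E d),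
      (∀ a, PathRDE.IsTheSolutionFlow (min (3 / p) (α + 1 / p)) h XR (Vl a) (Fl a) (φl a)) ∧
      PathRDE.IsTheClassicalSolutionFlow (min (3 / p) (α + 1 / p)) h XR
        (PathRDE.classicalField V) (fun i => PathRDE.classicalField (F i)) φ ∧
      ∀ ε > 0, ∀ᶠ a in l, ∀ s t, 0 ≤ s → s ≤ t → t ≤ T → ∀ x, ‖φl a t s x - φ t s x‖ < ε := by
  open PathRDE in
  have hT0 : 0 ≤ T := by linarith
  have hγ : 1 < min (3 / p) (α + 1 / p) :=
    lt_min ((one_lt_div (by linarith)).2 hp3) hα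
  obtain ⟨H, hH, hb⟩ := exists_driverBound hh XR
  have hsol : ∀ (V : PField d) (F : Fin ℓ → PField d), Regular T V F →
      (∀ i, FineAgreesAtZero T (F i)) → ∀ (φ : ℝ → ℝ → E d → E d), IsFlow T φ →
      ∀ C δ K : ℝ, 0 ≤ C → 0 < δ → 0 ≤ K →
      (∀ s t, 0 ≤ s → s ≤ t → t ≤ T → t - s ≤ δ → ∀ x,
        ‖φ t s x - eulerMap h XR (classicalField V) (fun i => classicalField (F i)) t s x‖
          ≤ C * (t - s) ^ (min (3 / p) (α + 1 / p))) →
      (∀ s t, 0 ≤ s → s ≤ t → t ≤ T → ∀ x y, ‖φ t s x - φ t s y‖ ≤ K * ‖x - y‖) →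
      IsTheSolutionFlow (min (3 / p) (α + 1 / p)) h XR V F φ := by
    intro V F hreg hfine φ hφ C δ K hC hδ hK0 hφE hK
    obtain ⟨C', δ', hC', hδ', hμ⟩ := exists_timeOne_close_euler hT hp hα hH hb hreg hfine
    exact isTheFlowCloseTo_of_euler hT0 hγ hφ hC hC' hδ hδ' hK0 hφE hK hμ
  -- Constants here depend on `a`; the uniform ones come later through uniqueness.
  have hex : ∀ a, ∃ φ, IsTheSolutionFlow (min (3 / p) (α + 1 / p)) h XR (Vl a) (Fl a) φ := by
    intro a
    obtain ⟨G, hS, hG⟩ := (((hregl a).eventually_smoothFields hT0).and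
      (eventually_ge_atTop 0)).exists
    obtain ⟨C, δ, hC, hδ, hflow⟩ := exists_flow_euler (d := d) hp hp3 hα hG hH hb
    obtain ⟨φ, hφ, hφE, K, hK0, hK⟩ := hflow _ _ hS
    exact ⟨φ, hsol _ _ (hregl a) (hfine a) φ hφ C δ K hC hδ hK0 hφE hK⟩
  choose φl hφl using hex
  obtain ⟨G, hS, hG⟩ := ((hreg.eventually_smoothFields hT0).and (eventually_ge_atTop 0)).exists
  -- The bound `G + 1` leaves room for perturbations of size at most `1`: the same `C` and `δ` serve
  -- the limit fields and all nearby ones.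
  obtain ⟨C, δ, hC, hδ, hflow⟩ :=
    exists_flow_euler (d := d) hp hp3 hα (add_nonneg hG zero_le_one) hH hb
  obtain ⟨φ, hφ, hφE, K, hK0, hK⟩ := hflow (classicalField V) (fun i => classicalField (F i))
    ⟨hS.drift.mono (by linarith), fun i => (hS.field i).mono (by linarith), hS.diff,
      fun i => (hS.deriv i).mono (by linarith)⟩
  have hF0 : ∀ i, Differentiable ℝ (F i 0) := fun i =>
    ((mixedNorm_spec (hreg.field_norm i)).1 0 ⟨le_rfl, hT0⟩).differentiable (by norm_num)
  have hfineF : ∀ i, FineAgreesAtZero T (F i) := fun i =>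
    fineAgreesAtZero_of_dependsOnlyOnEndpoint (by linarith) (hreg.field_lip i) (hFend i) (hF0 i)
  have hφsol := hsol V F hreg hfineF φ hφ C δ K hC hδ hK0 hφE hK
  refine ⟨φl, φ, hφl, ?_, fun ε hε => ?_⟩
  · have e : (fun s t => TimeOne (drivenField h XR V F s t)) = fun s t =>
        TimeOneClassical (drivenClassical h XR (classicalField V)
          (fun i => classicalField (F i)) s t) := by
      funext s t x x'
      exact propext (timeOne_iff_timeOneClassical hT hreg.drift_lip hVend hreg.field_lip hFend
        hS.diff s t x x')
    rw [IsTheSolutionFlow, e] at hφsol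
    exact hφsol
  -- `n` is fixed so that the sewing errors sum to less than `ε / 2`; then `η` makes the `n`
  -- differences of schemes sum to less than `ε / 2`.
  · obtain ⟨n, ⟨hn1, hn2⟩, hn0⟩ := (((tendsto_nat_mul_div_rpow hγ (2 * K * C) T hT0).eventually
      (gt_mem_nhds (half_pos hε))).and ((tendsto_const_div_atTop_nhds_zero_nat T).eventually
      (ge_mem_nhds hδ)) |>.and (eventually_gt_atTop 0)).exists
    set B := n * (K * (H * (T ^ α + T ^ (2 / p)) + ℓ * (H * T ^ (1 / p))
        + ℓ ^ 2 * (H * (T ^ α + T ^ (2 / p)) * (2 * (2 * G + 1))))) with hB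
    have hB0 : 0 ≤ B := by positivity
    set η := min 1 (ε / (2 * (B + 1))) with hη
    have hη0 : 0 < η := lt_min one_pos (by positivity)
    have hBη : B * η < ε / 2 := by
      have h1 : B * η ≤ B * (ε / (2 * (B + 1))) :=
        mul_le_mul_of_nonneg_left (min_le_right _ _) hB0
      have h2 : (B + 1) * (ε / (2 * (B + 1))) = ε / 2 := by field_simp
      have h3 : 0 < ε / (2 * (B + 1)) := by positivity
      linarith
    filter_upwards [eventually_smoothFields_sub hT0 hV hF hη0] with a hSa s t hs hst ht x
    have hadd := hS.add hSa
    have hη1 : η ≤ 1 := min_le_left _ _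
    obtain ⟨ψ, hψ, hψE, K', hK'0, hK'⟩ := hflow _ _ (⟨hadd.drift.mono (by linarith),
      fun i => (hadd.field i).mono (by linarith), hadd.diff,
      fun i => (hadd.deriv i).mono (by linarith)⟩ : SmoothFields (G + 1) _ _)
    have hle := norm_flow_sub_le hT hp hα hH hb hG hη0.le hη1 hγ hS hSa hφ hψ hC hδ hK0 hφE hψE
      hK hn0 hn2 hs hst ht x
    rw [classicalField_add_sub] at hψE
    simp only [show (fun i x => classicalField (F i) x + classicalField (Fl a i - F i) x) =
      fun i => classicalField (Fl a i) from funext fun i => classicalField_add_sub _ _] at hψE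
    have hψsol := hsol (Vl a) (Fl a) (hregl a) (hfine a) ψ hψ C δ K' hC hδ hK'0 hψE hK'
    -- The flow `ψ`, sewn with the uniform constants, is the chosen `φl a` by uniqueness.
    have heq : ψ t s = φl a t s := (hφl a).2 _ hγ ψ hψsol.1 s t hs hst ht
    rw [← heq]
    linarith
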